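/- All graphs are finite, simple and undirected; $e(G)$ is the number of edges of $G$. For a graph $G$ and a set $S$ of at least two vertices, an *$S$-Steiner tree* is a subgraph $T$ of $G$ that is a tree with $S\subseteq V(T)$. Two $S$-Steiner trees $T,T'$ are *internally disjoint* if $E(T)\cap E(T')=\varnothing$ and $V(T)\cap V(T')=S$. Let $\kappa_G(S)$ be the maximum number of pairwise internally disjoint $S$-Steiner trees in $G$, and let $\overline{\kappa}_3(G)=\max\{\kappa_G(S): S\subseteq V(G),\ |S|=3\}$. **Base graphs.** For $m\ge 3$ let $P_m^2$ be the graph on $p_0,\dots,p_{m-1}$ in which $p_i$ and $p_j$ are adjacent iff $1\le |i-j|\le 2$. *Replacing an edge $xy$ by a diamond* means deleting $xy$ and adding two new vertices that are adjacent to each other and both adjacent to $x$ and to $y$. Define the following graphs $H_r^i$ of order $r$: * $H_r^1=K_2\vee (r-2)K_1$, for $r\ge 3$; * $H_r^2=P_r^2$ for even $r\ge 4$, and $H_r^3=P_r^2$ for odd $r\ge 3$; * $H_r^4$ for odd $r\ge 5$, and $H_r^5$ for even $r\ge 6$: the graph obtained from $P_{r-2}^2$ by replacing its first edge $p_0p_1$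 by a diamond; * $H_r^6$ for even $r\ge 8$, and $H_r^7$ for odd $r\ge 7$: the graph obtained from $P_{r-4}^2$ by replacing both its first edge $p_0p_1$ and its last edge $p_{r-6}p_{r-5}$ by diamonds. *Attaching a $K_4$ at a vertex $u$* means adding three new vertices that form a $K_4$ together with $u$. Let $\mathcal{H}_n^i$ be the class of graphs of order $n$ that are obtained from some $H_r^i$, $3\le r\le n$, by attaching one $K_4$ at each vertex of some (possibly empty) set of vertices that have degree $2$ in $H_r^i$. Let $G_1$ be $K_4$ with a pendant edge, $G_2$ two disjoint copies of $K_4$ joined by an edge, $G_3=K_{3,3}$, and $G_4$ the triangular prism $K_3\,\square\, K_2$. Up to isomorphism, put $$\mathcal{G}_3^*=\{K_3\},\quad \mathcal{G}_4^*=\{K_4\},\quad \mathcal{G}_5^*=\{G_1\}\cup\bigcup_{i=1}^7\mathcal{H}_5^i,\quad \mathcal{G}_6^*=\{G_3,G_4\}\cup\bigcup_{i=1}^7\mathcal{H}_6^i,\quad \mathcal{G}_8^*=\{G_2\}\cup\bigcup_{i=1}^7\mathcal{H}_8^i,$$ and $\mathcal{G}_n^*=\bigcup_{i=1}^7\mathcal{H}_n^i$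 for $n=7$ and for all $n\ge 9$. **Theorem.** Let $G$ be a connected graph of order $n\ge 3$ with $\overline{\kappa}_3(G)\le 2$. Then $$e(G)\le\begin{cases}2n-2 & \text{if } n=4,\\ 2n-3 & \text{if } n\ne 4,\end{cases}$$ and (for such $G$) equality holds if and only if $G\in\mathcal{G}_n^*$. -/

import Mathlib

open scoped SimpleGraph

namespace SteinerExtremal

universe u v

/-- An `S`-Steiner tree of `G`: a subgraph of `G` that is a tree and whose vertex set contains `S`. -/
def IsSteinerTree {V : Type u} {G : SimpleGraph V} (S : Set V) (T : G.Subgraph) : Prop :=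
  T.coe.IsTree ∧ S ⊆ T.verts

/-- Two `S`-Steiner trees are internally disjoint if they share no edge and
their common vertices are exactly the vertices of `S`. -/
def InternallyDisjoint {V : Type u} {G : SimpleGraph V} (S : Set V) (T T' : G.Subgraph) : Prop :=
  T.edgeSet ∩ T'.edgeSet = ∅ ∧ T.verts ∩ T'.verts = S

/-- `G` has `k` pairwise internally disjoint `S`-Steiner trees. -/
def HasDisjointSteinerTrees {V : Type u} (G : SimpleGraph V) (S : Set V) (k : ℕ) : Prop :=
  ∃ T : Fin k → G.Subgraph,
    (∀ i, IsSteinerTree S (T i)) ∧ ∀ i j, i ≠ j → InternallyDisjoint S (T i) (T j)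

/-- The generalized local connectivity `κ_G(S)`: the maximum number of pairwise internally
disjoint `S`-Steiner trees in `G`. -/
noncomputable def genLocalConnectivity {V : Type u} (G : SimpleGraph V) (S : Set V) : ℕ∞ :=
  ⨆ (k : ℕ) (_ : HasDisjointSteinerTrees G S k), (k : ℕ∞)

/-- The maximum generalized local connectivity: the maximum of `κ_G(S)` over all
vertex sets `S` with exactly `k` elements. -/
noncomputable def maxGenLocalConnectivity {V : Type u} (k : ℕ) (G : SimpleGraph V) : ℕ∞ :=
  ⨆ (S : Finset V) (_ : S.card = k), genLocalConnectivity G (S : Set V)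

/-- The join of `K₂` (the vertices `0, 1`) and `r - 2` isolated vertices. -/
def book (r : ℕ) : SimpleGraph (Fin r) where
  Adj i j := i ≠ j ∧ ((i : ℕ) < 2 ∨ (j : ℕ) < 2)
  symm := ⟨fun _ _ h => ⟨h.1.symm, h.2.symm⟩⟩
  loopless := ⟨fun _ h => h.1 rfl⟩

/-- The triangulated strip on `p₀, …, p_{m-1}`, in which `p_i` and `p_j` are adjacent iff
`1 ≤ |i - j| ≤ 2` (the square of a path). With `u_i = p_{2i-2}` and `v_i = p_{2i-1}` it is the
ladder with rails `u₁u₂…`, `v₁v₂…`, rungs `u_i v_i` and diagonals `v_i u_{i+1}`. -/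
def strip (m : ℕ) : SimpleGraph (Fin m) where
  Adj i j := i ≠ j ∧ (i : ℕ) ≤ j + 2 ∧ (j : ℕ) ≤ i + 2
  symm := ⟨fun _ _ h => ⟨h.1.symm, h.2.2, h.2.1⟩⟩
  loopless := ⟨fun _ h => h.1 rfl⟩

/-- Replace the edge `xy` of `G` by a diamond with tips `x, y`: delete `xy`, add two new adjacent
vertices, and join each of them to `x` and to `y`. -/
def replaceByDiamond {V : Type u} (G : SimpleGraph V) (x y : V) : SimpleGraph (V ⊕ Fin 2) where
  Adj
    | .inl a, .inl b => G.Adj a b ∧ s(a, b) ≠ s(x, y)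
    | .inl a, .inr _ => a = x ∨ a = y
    | .inr _, .inl a => a = x ∨ a = y
    | .inr i, .inr j => i ≠ j
  symm := ⟨by
    rintro (a | i) (b | j) h
    · exact ⟨h.1.symm, by rw [Sym2.eq_swap]; exact h.2⟩
    · exact h
    · exact h
    · exact Ne.symm h⟩
  loopless := ⟨by
    rintro (a | i) h
    · exact G.loopless.irrefl a h.1
    · exact h rfl⟩

/-- The strip on `k + 3` vertices with its first edge `p₀p₁` replaced by a diamond
(`k + 5` vertices). Equivalently: the 5-vertex graph `k = 0` and a strip on `k + 2` vertices,
glued along an edge. -/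
def oneDiamondStrip (k : ℕ) : SimpleGraph (Fin (k + 3) ⊕ Fin 2) :=
  replaceByDiamond (strip (k + 3)) ⟨0, by omega⟩ ⟨1, by omega⟩

/-- The strip on `k + 3` vertices with its first edge `p₀p₁` and its last edge `p_{k+1}p_{k+2}`
replaced by diamonds (`k + 7` vertices). -/
def twoDiamondStrip (k : ℕ) : SimpleGraph ((Fin (k + 3) ⊕ Fin 2) ⊕ Fin 2) :=
  replaceByDiamond (oneDiamondStrip k)
    (.inl ⟨k + 1, by omega⟩) (.inl ⟨k + 2, by omega⟩)

/-- `H` is (a copy of) the base graph of order `r` in the `i`-th of the seven base families. -/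
def IsBaseGraph (i : Fin 7) (r : ℕ) {W : Type u} (H : SimpleGraph W) : Prop :=
  match i with
  | 0 => 3 ≤ r ∧ Nonempty (H ≃g book r)
  | 1 => 3 ≤ r ∧ Even r ∧ Nonempty (H ≃g strip r)
  | 2 => 3 ≤ r ∧ Odd r ∧ Nonempty (H ≃g strip r)
  | 3 => Odd r ∧ ∃ k, r = k + 5 ∧ Nonempty (H ≃g oneDiamondStrip k)
  | 4 => Even r ∧ ∃ k, r = k + 5 ∧ Nonempty (H ≃g oneDiamondStrip k)
  | 5 => Even r ∧ ∃ k, r = k + 7 ∧ Nonempty (H ≃g twoDiamondStrip k)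
  | 6 => Odd r ∧ ∃ k, r = k + 7 ∧ Nonempty (H ≃g twoDiamondStrip k)

/-- Attach one `K₄` at every vertex `u ∈ U` of `H`: for each such `u` add three new vertices that
form a `K₄` together with `u`. -/
def attachK4 {V : Type u} (H : SimpleGraph V) (U : Set V) : SimpleGraph (V ⊕ (U × Fin 3)) where
  Adj
    | .inl a, .inl b => H.Adj a b
    | .inl a, .inr p => a = p.1
    | .inr p, .inl a => a = p.1
    | .inr p, .inr q => p.1 = q.1 ∧ p.2 ≠ q.2
  symm := ⟨by
    rintro (a | p) (b | q) h
    · exact SimpleGraph.Adj.symm (G := H) h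
    · exact h
    · exact h
    · exact ⟨h.1.symm, h.2.symm⟩⟩
  loopless := ⟨by
    rintro (a | p) h
    · exact H.loopless.irrefl a h
    · exact h.2 rfl⟩

/-- `G` has order `n` and is obtained from a base graph `H` of the `i`-th family, of order `r` with
`3 ≤ r ≤ n`, by attaching a `K₄` at each vertex of some (possibly empty) set of vertices of
degree `2` of `H`. -/
def InAttachClass (i : Fin 7) (n : ℕ) {V : Type v} (G : SimpleGraph V) : Prop :=
  Nat.card V = n ∧ ∃ r : ℕ, 3 ≤ r ∧ r ≤ n ∧ ∃ H : SimpleGraph (Fin r), IsBaseGraph i r H ∧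
    ∃ U : Set (Fin r), (∀ x ∈ U, (H.neighborSet x).ncard = 2) ∧ Nonempty (G ≃g attachK4 H U)

/-- `K₄` with a pendant edge. -/
def sporadic1 := attachK4 (⊤ : SimpleGraph (Fin 2)) {0}

/-- Two disjoint copies of `K₄` joined by an edge. -/
def sporadic2 := attachK4 (⊤ : SimpleGraph (Fin 2)) Set.univ

/-- The complete bipartite graph `K_{3,3}`. -/
def sporadic3 := completeBipartiteGraph (Fin 3) (Fin 3)

/-- The triangular prism. -/
def sporadic4 := (⊤ : SimpleGraph (Fin 3)) □ (⊤ : SimpleGraph (Fin 2))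

/-- The class `𝒢ₙ*` of graphs of order `n`, for `n ≥ 3`. -/
def InGStar (n : ℕ) {V : Type v} (G : SimpleGraph V) : Prop :=
  (n = 3 ∧ Nonempty (G ≃g (⊤ : SimpleGraph (Fin 3)))) ∨
  (n = 4 ∧ Nonempty (G ≃g (⊤ : SimpleGraph (Fin 4)))) ∨
  (5 ≤ n ∧ ∃ i : Fin 7, InAttachClass i n G) ∨
  (n = 5 ∧ Nonempty (G ≃g sporadic1)) ∨
  (n = 6 ∧ (Nonempty (G ≃g sporadic3) ∨ Nonempty (G ≃g sporadic4))) ∨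
  (n = 8 ∧ Nonempty (G ≃g sporadic2))

end SteinerExtremal

open scoped SimpleGraph

/-!
Three internally disjoint Steiner trees on three terminals are produced as three edge-disjoint
connected subgraphs that share no vertices but the terminals (`Bad`, `Bad.not_le_two`), so only
graphs that are not `Bad` matter. Besides subgraphs, one operation preserves this property: a
connected piece of the graph may be replaced by a single edge between two of its vertices
(`Bad.of_bypass`). In particular a vertex `v` may be split off at two of its neighbours `a, b`, that
is, deleted and replaced by an edge `ab`. If `v` has degree `d` and `a, b` are not adjacent, this
loses `d - 1` edges. A graph with fewer than `2n` edges has a vertex of degree at most `3`, and the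
bounds `2n - 2` and `2n - 3` drop by two with each vertex, so deleting a vertex of degree `2` and
splitting off a vertex of degree `3` both preserve extremality. Everything is proved by induction on
the order along these steps. Splitting off may disconnect the graph, but connectivity is not needed:
the induction concerns arbitrary graphs on a vertex set `X` inside one ambient type.

Bound (`countBound`). A graph that is not `Bad` has at most `2n - 2` edges, with equality only for
`K₁` and `K₄`: undoing a step from `K₄` gives a `K₄` with a second path along an edge, or a wheel,
unless the vertex lies in a `K₄`. A `K₄` is always an end block (`K4_peel`), because a further path
between two of its vertices makes the graph `Bad`.

Equality `2n - 3` (`classBound`). If there is a `K₄`, it hangs at one vertex of a smaller extremal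
graph, and this vertex has degree at most `2` in the base graph, since otherwise a hub edge with two
common neighbours supplies three paths away from it (`Class.attach`). Without `K₄` the graph is shown
to be a base graph:

* A vertex of degree `2` with adjacent neighbours is a second path along an edge of a smaller base
  graph. Inside a strip or along a spoke of a book such a path makes the graph `Bad`, so the edge is
  one of those at which the base graph can grow (`Base.earSpot`, `EarSpot.base_insert`).
* A diamond is replaced by an edge, and for the same reason this edge is one at which the base graph
  can grow (`EarSpot.base_diamond`).
* With minimum degree `3` and without diamonds, splitting off a vertex `v` of degree `3` creates no
  `K₄` (`not_clique_bypass`), so the graph is a base graph with one edge subdivided by `v` and `v`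
  joined to a third vertex `c`. Now `c` is the only vertex that can have degree `2` in the base graph,
  and each diamond of the base graph must be destroyed by the subdivision or by `c`. The only such
  graph that is not `Bad` is the prism (`SubdividedFrom.base_insert`).

The base graphs here include `K₂`, the strip on two vertices, to which `K₄`s are attached to give
the two sporadic graphs that contain `K₄`. The graph `K₃,₃` belongs to `𝒢₆*` but is itself `Bad`, so
the induction never meets it. Conversely, that all graphs in `𝒢ₙ*` have the extremal number of edges
is a count (`InGStar.ncard_edgeSet`).
-/

namespace SteinerExtremal

variable {V : Type*}

/-! ### Three disjoint connectors and how they transfer between graphs -/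

/-- `G` has three edge-disjoint subgraphs, each joining the three terminals `a, b, c`, such that
a vertex met by two of them is a terminal. This is `κ_G({a, b, c}) ≥ 3` with connected subgraphs
in place of trees: it is easier to produce, and spanning trees of the components of the
terminals turn it into Steiner trees. -/
def Bad (G : SimpleGraph V) : Prop :=
  ∃ (a b c : V) (T : Fin 3 → SimpleGraph V), a ≠ b ∧ a ≠ c ∧ b ≠ c ∧ (∀ i, T i ≤ G) ∧
    (∀ i, (T i).Reachable a b ∧ (T i).Reachable a c) ∧
    ∀ i j, i ≠ j → ∀ x y, (T i).Adj x y →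
      ¬ (T j).Adj x y ∧ ∀ z, (T j).Adj x z → x = a ∨ x = b ∨ x = c

/-- A spanning tree of the component of `T` that contains the terminals is a Steiner tree. Its
vertices have an edge of `T`, so it meets another such tree only where the connectors themselves
meet. -/
lemma exists_steinerTree {G T : SimpleGraph V} (hT : T ≤ G) {a b c : V}
    (hb : T.Reachable a b) (hc : T.Reachable a c) (hab : a ≠ b) :
    ∃ S : G.Subgraph, IsSteinerTree ({a, b, c} : Set V) S ∧
      (∀ x y, S.Adj x y → T.Adj x y) ∧ ∀ x ∈ S.verts, ∃ y, T.Adj x y := by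
  set C := T.connectedComponentMk a with hC
  have hconn : C.toSimpleGraph.Connected := C.connected_toSimpleGraph
  obtain ⟨F, hF, hFt⟩ := hconn.exists_isTree_le
  let S : G.Subgraph :=
    { verts := C.supp
      Adj := fun x y => ∃ (hx : x ∈ C.supp) (hy : y ∈ C.supp), F.Adj ⟨x, hx⟩ ⟨y, hy⟩
      adj_sub := by
        rintro x y ⟨hx, hy, h⟩
        exact hT (hF h)
      edge_vert := by
        rintro x y ⟨hx, hy, h⟩
        exact hx
      symm := ⟨by
        rintro x y ⟨hx, hy, h⟩
        exact ⟨hy, hx, h.symm⟩⟩ }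
  have hmem : ∀ x, x ∈ C.supp ↔ T.Reachable a x := by
    intro x
    rw [SimpleGraph.ConnectedComponent.mem_supp_iff, hC, SimpleGraph.ConnectedComponent.eq]
    exact ⟨fun h => h.symm, fun h => h.symm⟩
  refine ⟨S, ⟨?_, ?_⟩, ?_, ?_⟩
  · have : S.coe = F := by
      ext x y
      constructor
      · rintro ⟨hx, hy, h⟩
        exact h
      · intro h
        exact ⟨x.2, y.2, h⟩
    rw [this]
    exact hFt
  · rintro x (rfl | rfl | rfl)
    · exact (hmem _).2 (SimpleGraph.Reachable.refl _)
    · exact (hmem _).2 hb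
    · exact (hmem _).2 hc
  · rintro x y ⟨hx, hy, h⟩
    exact hF h
  · intro x hx
    have hx' := (hmem x).1 hx
    by_cases hxa : x = a
    · subst hxa
      obtain ⟨w⟩ := hb
      cases w with
      | nil => exact absurd rfl hab
      | cons h _ => exact ⟨_, h⟩
    · obtain ⟨w⟩ := hx'.symm
      cases w with
      | nil => exact absurd rfl hxa
      | cons h _ => exact ⟨_, h⟩

/-- Three disjoint connectors contain three internally disjoint Steiner trees, so `κ̄₃(G) ≥ 3`. -/
lemma Bad.not_le_two {G : SimpleGraph V} (h : Bad G) : ¬ maxGenLocalConnectivity 3 G ≤ 2 := by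
  classical
  obtain ⟨a, b, c, T, hab, hac, hbc, hT, hr, hd⟩ := h
  choose S hS hadj hsupp using fun i => exists_steinerTree (hT i) (hr i).1 (hr i).2 hab
  have h3 : HasDisjointSteinerTrees G (({a, b, c} : Finset V) : Set V) 3 := by
    refine ⟨S, ?_, ?_⟩
    · simpa using hS
    · intro i j hij
      refine ⟨?_, ?_⟩
      · ext e
        induction e with
        | h x y =>
          simp only [Set.mem_inter_iff, SimpleGraph.Subgraph.mem_edgeSet, Set.mem_empty_iff_false,
            iff_false, not_and]
          intro h1 h2
          exact (hd i j hij x y (hadj i _ _ h1)).1 (hadj j _ _ h2)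
      · apply Set.Subset.antisymm
        · rintro x ⟨h1, h2⟩
          obtain ⟨y, hy⟩ := hsupp i x h1
          obtain ⟨z, hz⟩ := hsupp j x h2
          simpa using (hd i j hij x y hy).2 z hz
        · intro x hx
          have hx' : x ∈ ({a, b, c} : Set V) := by simpa using hx
          exact ⟨(hS i).2 hx', (hS j).2 hx'⟩
  intro hle
  have h4 : ((3 : ℕ) : ℕ∞) ≤ maxGenLocalConnectivity 3 G := by
    unfold maxGenLocalConnectivity genLocalConnectivity
    refine le_trans ?_ (le_iSup₂ (f := fun (S : Finset V) (_ : S.card = 3) =>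
      ⨆ (k : ℕ) (_ : HasDisjointSteinerTrees G (S : Set V) k), (k : ℕ∞)) {a, b, c}
      (Finset.card_eq_three.2 ⟨a, b, c, hab, hac, hbc, rfl⟩))
    exact le_iSup₂ (f := fun (k : ℕ) (_ : HasDisjointSteinerTrees G _ k) => (k : ℕ∞)) 3 h3
  have h5 := h4.trans hle
  exact absurd (by exact_mod_cast h5 : (3 : ℕ) ≤ 2) (by norm_num)

lemma Bad.mono {G H : SimpleGraph V} (h : G ≤ H) (hG : Bad G) : Bad H := by
  obtain ⟨a, b, c, T, hab, hac, hbc, hT, hr⟩ := hG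
  exact ⟨a, b, c, T, hab, hac, hbc, fun i => (hT i).trans h, hr⟩

/-- The subgraph of `G` on the whole vertex type whose edges are those of `G` inside `A`. -/
def within (G : SimpleGraph V) (A : Set V) : SimpleGraph V where
  Adj x y := G.Adj x y ∧ x ∈ A ∧ y ∈ A
  symm := ⟨fun _ _ h => ⟨h.1.symm, h.2.2, h.2.1⟩⟩
  loopless := ⟨fun _ h => G.loopless.irrefl _ h.1⟩

lemma within_le (G : SimpleGraph V) (A : Set V) : within G A ≤ G := fun _ _ h => h.1

/-- The graph obtained from `G` by replacing the part of `G` on `A` by the single edge `uc`: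
the vertices of `A` other than `u, c` become isolated. -/
def bypass (G : SimpleGraph V) (A : Set V) (u c : V) : SimpleGraph V where
  Adj x y := x ≠ y ∧ ((x = u ∧ y = c) ∨ (x = c ∧ y = u) ∨
    (G.Adj x y ∧ ¬ (x ∈ A ∧ y ∈ A) ∧ (x ∈ A → x = u ∨ x = c) ∧ (y ∈ A → y = u ∨ y = c)))
  symm := ⟨by
    rintro x y ⟨hne, h | h | h⟩
    · exact ⟨hne.symm, Or.inr (Or.inl h.symm)⟩
    · exact ⟨hne.symm, Or.inl h.symm⟩
    · exact ⟨hne.symm, Or.inr (Or.inr ⟨h.1.symm, fun h' => h.2.1 h'.symm, h.2.2.2, h.2.2.1⟩)⟩⟩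
  loopless := ⟨fun _ h => h.1 rfl⟩

/-- A connected piece of `G` may be used in place of an edge: in the connector that uses the edge
`uc`, the edge is replaced by everything inside `A`. -/
lemma Bad.of_bypass {G : SimpleGraph V} {A : Set V} {u c : V} (hu : u ∈ A) (hc : c ∈ A)
    (hr : (within G A).Reachable u c) (h : Bad (bypass G A u c)) : Bad G := by
  classical
  obtain ⟨t₁, t₂, t₃, T, h12, h13, h23, hT, hreach, hd⟩ := h
  let T' : Fin 3 → SimpleGraph V := fun i =>
    (T i ⊓ G) ⊔ (if (T i).Adj u c then within G A else ⊥)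
  have hT'adj : ∀ i x y, (T' i).Adj x y ↔
      ((T i).Adj x y ∧ G.Adj x y) ∨ ((T i).Adj u c ∧ G.Adj x y ∧ x ∈ A ∧ y ∈ A) := by
    intro i x y
    by_cases huc : (T i).Adj u c <;> simp [T', huc, within]
  have hsub : ∀ i x y, (T i).Adj x y → (T' i).Reachable x y := by
    intro i x y hxy
    by_cases hG : G.Adj x y
    · exact SimpleGraph.Adj.reachable ((hT'adj i x y).2 (Or.inl ⟨hxy, hG⟩))
    · have hle : (T i).Adj u c → within G A ≤ T' i := fun h x y hxy =>
        (hT'adj i x y).2 (Or.inr ⟨h, hxy⟩)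
      rcases (hT i hxy).2 with ⟨rfl, rfl⟩ | ⟨rfl, rfl⟩ | h
      · exact hr.mono (hle hxy)
      · exact (hr.mono (hle hxy.symm)).symm
      · exact absurd h.1 hG
  have hreach' : ∀ i x y, (T i).Reachable x y → (T' i).Reachable x y := by
    rintro i x y ⟨w⟩
    induction w with
    | nil => exact SimpleGraph.Reachable.refl _
    | cons h _ ih => exact (hsub i _ _ h).trans ih
  have hA : ∀ i x y, (T i).Adj x y → x ∈ A → x = u ∨ x = c := by
    intro i x y hxy hx
    rcases (hT i hxy).2 with h | h | h
    · exact Or.inl h.1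
    · exact Or.inr h.1
    · exact h.2.2.1 hx
  have hAA : ∀ i x y, (T i).Adj x y → x ∈ A → y ∈ A → (T i).Adj u c := by
    intro i x y hxy hx hy
    rcases (hT i hxy).2 with h | h | h
    · rw [← h.1, ← h.2]; exact hxy
    · rw [← h.1, ← h.2]; exact hxy.symm
    · exact absurd ⟨hx, hy⟩ h.2.1
  refine ⟨t₁, t₂, t₃, T', h12, h13, h23, ?_, ?_, ?_⟩
  · intro i x y hxy
    rcases (hT'adj i x y).1 hxy with h | h
    · exact h.2
    · exact h.2.1
  · exact fun i => ⟨hreach' i _ _ (hreach i).1, hreach' i _ _ (hreach i).2⟩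
  · intro i j hij x y hxy
    have huse : ∀ x z, (T' j).Adj x z → ((∃ z', (T j).Adj x z') ∨ ((T j).Adj u c ∧ x ∈ A)) := by
      intro x z hz
      rcases (hT'adj j x z).1 hz with h | h
      · exact Or.inl ⟨z, h.1⟩
      · exact Or.inr ⟨h.1, h.2.2.1⟩
    have hnot : (T i).Adj u c → ¬ (T j).Adj u c := fun h => (hd i j hij u c h).1
    have hnot' : (T j).Adj u c → ¬ (T i).Adj u c := fun h => (hd j i hij.symm u c h).1
    rcases (hT'adj i x y).1 hxy with h | h
    · refine ⟨?_, ?_⟩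
      · intro h'
        rcases (hT'adj j x y).1 h' with h'' | h''
        · exact (hd i j hij x y h.1).1 h''.1
        · exact hnot' h''.1 (hAA i x y h.1 h''.2.2.1 h''.2.2.2)
      · intro z hz
        rcases huse x z hz with ⟨z', hz'⟩ | ⟨h1, h2⟩
        · exact (hd i j hij x y h.1).2 z' hz'
        · rcases hA i x y h.1 h2 with rfl | rfl
          · exact (hd i j hij x y h.1).2 _ h1
          · exact (hd i j hij x y h.1).2 _ h1.symm
    · refine ⟨?_, ?_⟩
      · intro h'
        rcases (hT'adj j x y).1 h' with h'' | h''
        · exact hnot h.1 (hAA j x y h''.1 h.2.2.1 h.2.2.2)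
        · exact hnot h.1 h''.1
      · intro z hz
        rcases huse x z hz with ⟨z', hz'⟩ | ⟨h1, h2⟩
        · rcases hA j x z' hz' h.2.2.1 with rfl | rfl
          · exact (hd i j hij _ _ h.1).2 _ hz'
          · exact (hd i j hij _ _ h.1.symm).2 _ hz'
        · exact absurd h1 (hnot h.1)

/-- Bypassing the path `a, v, b` is splitting off `v`: delete `v` and add the edge `ab`. -/
lemma bypass_path_adj {G : SimpleGraph V} {a v b x y : V} (hav : a ≠ v) (hvb : v ≠ b)
    (hab : a ≠ b) :
    (bypass G {a, v, b} a b).Adj x y ↔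
      (x = a ∧ y = b) ∨ (x = b ∧ y = a) ∨ (G.Adj x y ∧ x ≠ v ∧ y ≠ v) := by
  have := G.ne_of_adj (a := x) (b := y)
  simp only [bypass, Set.mem_insert_iff, Set.mem_singleton_iff]
  grind

/-- Splitting off a vertex does not create three disjoint connectors. -/
lemma Bad.of_bypass_path {G : SimpleGraph V} {a v b : V} (h1 : G.Adj a v) (h2 : G.Adj v b)
    (h : Bad (bypass G {a, v, b} a b)) : Bad G := by
  refine Bad.of_bypass (by simp) (by simp) ?_ h
  have e1 : (within G {a, v, b}).Adj a v := ⟨h1, by simp, by simp⟩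
  have e2 : (within G {a, v, b}).Adj v b := ⟨h2, by simp, by simp⟩
  exact e1.reachable.trans e2.reachable

/-! ### Small obstructions -/

/-- The edges of the list `l`, taken in order, each start at a vertex already reached from
`seen`; the result lists all vertices reached. -/
def growList {α : Type*} [DecidableEq α] : List α → List (α × α) → Option (List α)
  | seen, [] => some seen
  | seen, e :: l => if e.1 ∈ seen then growList (e.2 :: seen) l else none

lemma reachable_of_growList {α : Type*} [DecidableEq α] {f : α → V} {T : SimpleGraph V} {r : V}
    (l : List (α × α)) : ∀ (seen out : List α), (∀ x ∈ seen, T.Reachable r (f x)) →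
      (∀ e ∈ l, T.Reachable (f e.1) (f e.2)) → growList seen l = some out →
      ∀ x ∈ out, T.Reachable r (f x) := by
  induction l with
  | nil =>
    intro seen out hs _ ho
    simp only [growList, Option.some.injEq] at ho
    subst ho
    exact hs
  | cons e l ih =>
    intro seen out hs hl ho
    simp only [growList] at ho
    split_ifs at ho with he
    refine ih _ _ ?_ (fun e' he' => hl e' (List.mem_cons_of_mem _ he')) ho
    intro x hx
    rcases List.mem_cons.1 hx with rfl | hx
    · exact (hs _ he).trans (hl e List.mem_cons_self)
    · exact hs x hx

/-- The edges `e, e'` differ and share no vertex other than the terminals `0, 1, 2`. -/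
def ApartAt {k : ℕ} (e e' : Fin k × Fin k) : Prop :=
  e ≠ e' ∧ e ≠ e'.swap ∧ (e.1 = e'.1 → e.1.val < 3) ∧ (e.1 = e'.2 → e.1.val < 3) ∧
    (e.2 = e'.1 → e.2.val < 3) ∧ (e.2 = e'.2 → e.2.val < 3)

instance {k : ℕ} (e e' : Fin k × Fin k) : Decidable (ApartAt e e') := by
  unfold ApartAt; infer_instance

/-- Three edge lists on `Fin (m + 3)` that certify three disjoint connectors of the terminals
`0, 1, 2`. -/
def Certifies {m : ℕ} (l : Fin 3 → List (Fin (m + 3) × Fin (m + 3))) : Prop :=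
  (∀ i, ⟨1, by omega⟩ ∈ (growList [⟨0, by omega⟩] (l i)).getD [] ∧
    ⟨2, by omega⟩ ∈ (growList [⟨0, by omega⟩] (l i)).getD []) ∧
  ∀ i j, i ≠ j → ∀ e ∈ l i, ∀ e' ∈ l j, ApartAt e e'

instance {m : ℕ} (l : Fin 3 → List (Fin (m + 3) × Fin (m + 3))) : Decidable (Certifies l) := by
  unfold Certifies; infer_instance

/-- A copy in `G` of a certified configuration on `Fin (m + 3)`. Extra edges of `G` do no harm,
so each obstruction below lists only the edges that its three connectors use. -/
lemma Bad.of_certifies {G : SimpleGraph V} {m : ℕ}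
    {l : Fin 3 → List (Fin (m + 3) × Fin (m + 3))} (hl : Certifies l) (f : Fin (m + 3) → V)
    (hf : (List.ofFn f).Nodup) (hG : ∀ i, ∀ e ∈ l i, G.Adj (f e.1) (f e.2)) : Bad G := by
  have hf : Function.Injective f := List.nodup_ofFn.1 hf
  obtain ⟨hreach, hd⟩ := hl
  let T : Fin 3 → SimpleGraph V := fun i =>
    SimpleGraph.fromRel (fun x y => ∃ e ∈ l i, f e.1 = x ∧ f e.2 = y)
  have hadj : ∀ i x y, (T i).Adj x y → ∃ e ∈ l i,
      (f e.1 = x ∧ f e.2 = y) ∨ (f e.1 = y ∧ f e.2 = x) := by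
    intro i x y h
    rcases ((SimpleGraph.fromRel_adj _ _ _).1 h).2 with ⟨e, he, h⟩ | ⟨e, he, h⟩
    · exact ⟨e, he, Or.inl h⟩
    · exact ⟨e, he, Or.inr h⟩
  have hterm : ∀ x : Fin (m + 3), x.val < 3 →
      x = ⟨0, by omega⟩ ∨ x = ⟨1, by omega⟩ ∨ x = ⟨2, by omega⟩ := by
    intro x hx
    simp only [Fin.ext_iff]
    omega
  have hne : ∀ x y : Fin (m + 3), x.val ≠ y.val → f x ≠ f y := fun x y h h' =>
    h (congrArg Fin.val (hf h'))
  refine ⟨f ⟨0, by omega⟩, f ⟨1, by omega⟩, f ⟨2, by omega⟩, T, ?_, ?_, ?_, ?_, ?_, ?_⟩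
  · apply hne; simp
  · apply hne; simp
  · apply hne; simp
  · intro i x y h
    obtain ⟨e, he, ⟨rfl, rfl⟩ | ⟨rfl, rfl⟩⟩ := hadj i x y h
    · exact hG i e he
    · exact (hG i e he).symm
  · intro i
    have hstep : ∀ e ∈ l i, (T i).Reachable (f e.1) (f e.2) := fun e he =>
      SimpleGraph.Adj.reachable ((SimpleGraph.fromRel_adj _ _ _).2
        ⟨(hG i e he).ne, Or.inl ⟨e, he, rfl, rfl⟩⟩)
    have h := hreach i
    cases ho : growList [⟨0, by omega⟩] (l i) with
    | none => rw [ho] at h; simp at h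
    | some out =>
      rw [ho] at h
      simp only [Option.getD_some] at h
      have key := reachable_of_growList (f := f) (l i) [⟨0, by omega⟩] out
        (by intro x hx; rw [List.mem_singleton.1 hx]) hstep ho
      exact ⟨key _ h.1, key _ h.2⟩
  · intro i j hij x y hxy
    obtain ⟨e, he, h⟩ := hadj i x y hxy
    refine ⟨?_, ?_⟩
    · intro h'
      obtain ⟨e', he', h'⟩ := hadj j x y h'
      have hk := hd i j hij e he e' he'
      have hs : ∀ e e' : Fin (m + 3) × Fin (m + 3), f e.1 = f e'.1 → f e.2 = f e'.2 → e = e' :=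
        fun e e' h1 h2 => Prod.ext (hf h1) (hf h2)
      rcases h with h | h <;> rcases h' with h' | h'
      · exact hk.1 (hs _ _ (h.1.trans h'.1.symm) (h.2.trans h'.2.symm))
      · exact hk.2.1 (hs _ _ (h.1.trans h'.2.symm) (h.2.trans h'.1.symm))
      · exact hk.2.1 (hs _ _ (h.1.trans h'.2.symm) (h.2.trans h'.1.symm))
      · exact hk.1 (hs _ _ (h.1.trans h'.1.symm) (h.2.trans h'.2.symm))
    · intro z hz
      obtain ⟨e', he', h'⟩ := hadj j x z hz
      have hk := (hd i j hij e he e' he').2.2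
      have fin : ∀ k : Fin (m + 3), f k = x → k.val < 3 → x = f ⟨0, by omega⟩ ∨
          x = f ⟨1, by omega⟩ ∨ x = f ⟨2, by omega⟩ := by
        rintro k rfl hk
        rcases hterm k hk with rfl | rfl | rfl <;> simp
      rcases h with h | h <;> rcases h' with h' | h'
      · exact fin _ h.1 (hk.1 (hf (h.1.trans h'.1.symm)))
      · exact fin _ h.1 (hk.2.1 (hf (h.1.trans h'.2.symm)))
      · exact fin _ h.2 (hk.2.2.1 (hf (h.2.trans h'.1.symm)))
      · exact fin _ h.2 (hk.2.2.2 (hf (h.2.trans h'.2.symm)))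

variable {G : SimpleGraph V}

/-- `K₄` with a second path between two of its vertices. -/
lemma bad_of_K4_ear {q₀ q₁ q₂ q₃ z : V} (hn : [q₀, q₁, q₂, q₃, z].Nodup)
    (hG : G.Adj q₀ q₃ ∧ G.Adj q₃ q₁ ∧ G.Adj q₃ q₂ ∧ G.Adj q₀ q₁ ∧ G.Adj q₁ q₂ ∧ G.Adj q₀ q₂
      ∧ G.Adj q₀ z ∧ G.Adj z q₁) : Bad G :=
  Bad.of_certifies (m := 2)
    (l := ![[(0, 3), (3, 1), (3, 2)],
      [(0, 1), (1, 2)],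
      [(0, 2), (0, 4), (4, 1)]])
    (by decide) ![q₀, q₁, q₂, q₃, z] (by simpa using hn) (by simp [Fin.forall_fin_succ]; tauto)

/-- The wheel with four spokes: hub `g`, rim `a, b, c, d`. -/
lemma bad_of_wheel {g a c b d : V} (hn : [g, a, c, b, d].Nodup)
    (hG : G.Adj g b ∧ G.Adj b a ∧ G.Adj b c ∧ G.Adj g d ∧ G.Adj d a ∧ G.Adj d c ∧ G.Adj g a
      ∧ G.Adj g c) : Bad G :=
  Bad.of_certifies (m := 2)
    (l := ![[(0, 3), (3, 1), (3, 2)],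
      [(0, 4), (4, 1), (4, 2)],
      [(0, 1), (0, 2)]])
    (by decide) ![g, a, c, b, d] (by simpa using hn) (by simp [Fin.forall_fin_succ]; tauto)

/-- `K₃,₃`. -/
lemma bad_of_K33 {a b c x y z : V} (hn : [a, b, c, x, y, z].Nodup)
    (hG : G.Adj a x ∧ G.Adj x b ∧ G.Adj x c ∧ G.Adj a y ∧ G.Adj y b ∧ G.Adj y c ∧ G.Adj a z
      ∧ G.Adj z b ∧ G.Adj z c) : Bad G :=
  Bad.of_certifies (m := 3)
    (l := ![[(0, 3), (3, 1), (3, 2)],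
      [(0, 4), (4, 1), (4, 2)],
      [(0, 5), (5, 1), (5, 2)]])
    (by decide) ![a, b, c, x, y, z] (by simpa using hn) (by simp [Fin.forall_fin_succ]; tauto)

/-- `K₄` meeting a `K₄` minus an edge in an end of the hub edge `uw` of the latter: three paths
run from `u` into both sides. -/
lemma bad_of_K4_at_hub {u q₁ w q₂ q₃ x y : V} (hn : [u, q₁, w, q₂, q₃, x, y].Nodup)
    (hG : G.Adj u q₁ ∧ G.Adj u w ∧ G.Adj u q₂ ∧ G.Adj q₂ q₁ ∧ G.Adj u x ∧ G.Adj x w ∧ G.Adj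
      u q₃ ∧ G.Adj q₃ q₁ ∧ G.Adj u y ∧ G.Adj y w) : Bad G :=
  Bad.of_certifies (m := 4)
    (l := ![[(0, 1), (0, 2)],
      [(0, 3), (3, 1), (0, 5), (5, 2)],
      [(0, 4), (4, 1), (0, 6), (6, 2)]])
    (by decide) ![u, q₁, w, q₂, q₃, x, y] (by simpa using hn) (by simp [Fin.forall_fin_succ]; tauto)

set_option maxRecDepth 2000 in
/-- `K₄` at a vertex of the prism. -/
lemma bad_of_K4_at_prism {a₀ q₁ b₀ q₂ q₃ a₁ a₂ b₁ b₂ : V} (hn : [a₀, q₁, b₀, q₂, q₃, a₁, a₂, b₁, b₂].Nodup)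
    (hG : G.Adj a₀ q₁ ∧ G.Adj a₀ b₀ ∧ G.Adj a₀ q₂ ∧ G.Adj q₂ q₁ ∧ G.Adj a₀ a₁ ∧ G.Adj a₁ b₁
      ∧ G.Adj b₁ b₀ ∧ G.Adj a₀ q₃ ∧ G.Adj q₃ q₁ ∧ G.Adj a₀ a₂ ∧ G.Adj a₂ b₂ ∧ G.Adj b₂ b₀) : Bad G :=
  Bad.of_certifies (m := 6)
    (l := ![[(0, 1), (0, 2)],
      [(0, 3), (3, 1), (0, 5), (5, 7), (7, 2)],
      [(0, 4), (4, 1), (0, 6), (6, 8), (8, 2)]])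
    (by decide) ![a₀, q₁, b₀, q₂, q₃, a₁, a₂, b₁, b₂] (by simpa using hn) (by simp [Fin.forall_fin_succ]; tauto)

/-- The fan with hub `g` over a path on five vertices. -/
lemma bad_of_fan {g v₂ v₄ v₁ v₃ v₅ : V} (hn : [g, v₂, v₄, v₁, v₃, v₅].Nodup)
    (hG : G.Adj g v₁ ∧ G.Adj v₁ v₂ ∧ G.Adj g v₄ ∧ G.Adj g v₂ ∧ G.Adj g v₅ ∧ G.Adj v₅ v₄ ∧
      G.Adj g v₃ ∧ G.Adj v₃ v₂ ∧ G.Adj v₃ v₄) : Bad G :=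
  Bad.of_certifies (m := 3)
    (l := ![[(0, 3), (3, 1), (0, 2)],
      [(0, 1), (0, 5), (5, 2)],
      [(0, 4), (4, 1), (4, 2)]])
    (by decide) ![g, v₂, v₄, v₁, v₃, v₅] (by simpa using hn) (by simp [Fin.forall_fin_succ]; tauto)

/-- A triangle with a further triangle on each edge. -/
lemma bad_of_sun {a b c d e g : V} (hn : [a, b, c, d, e, g].Nodup)
    (hG : G.Adj a b ∧ G.Adj a c ∧ G.Adj a d ∧ G.Adj d b ∧ G.Adj b c ∧ G.Adj a g ∧ G.Adj g c
      ∧ G.Adj c e ∧ G.Adj e b) : Bad G :=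
  Bad.of_certifies (m := 3)
    (l := ![[(0, 1), (0, 2)],
      [(0, 3), (3, 1), (1, 2)],
      [(0, 5), (5, 2), (2, 4), (4, 1)]])
    (by decide) ![a, b, c, d, e, g] (by simpa using hn) (by simp [Fin.forall_fin_succ]; tauto)

/-- Three triangles on the edge `gk`, and one more on the edge from `k` to the page `z`. -/
lemma bad_of_book_spoke {g k z x y w : V} (hn : [g, k, z, x, y, w].Nodup)
    (hG : G.Adj g y ∧ G.Adj y k ∧ G.Adj k z ∧ G.Adj g x ∧ G.Adj x k ∧ G.Adj k w ∧ G.Adj w z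
      ∧ G.Adj g k ∧ G.Adj g z) : Bad G :=
  Bad.of_certifies (m := 3)
    (l := ![[(0, 4), (4, 1), (1, 2)],
      [(0, 3), (3, 1), (1, 5), (5, 2)],
      [(0, 1), (0, 2)]])
    (by decide) ![g, k, z, x, y, w] (by simpa using hn) (by simp [Fin.forall_fin_succ]; tauto)

/-- Four common neighbours of `x, y`, two of them adjacent. -/
lemma bad_of_diamond_pages {x y s t p q : V} (hn : [x, y, s, t, p, q].Nodup)
    (hG : G.Adj x t ∧ G.Adj t y ∧ G.Adj t s ∧ G.Adj x s ∧ G.Adj x p ∧ G.Adj p y ∧ G.Adj x q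
      ∧ G.Adj q y ∧ G.Adj y s) : Bad G :=
  Bad.of_certifies (m := 3)
    (l := ![[(0, 3), (3, 1), (3, 2)],
      [(0, 2), (0, 4), (4, 1)],
      [(0, 5), (5, 1), (1, 2)]])
    (by decide) ![x, y, s, t, p, q] (by simpa using hn) (by simp [Fin.forall_fin_succ]; tauto)

/-- The wheel with hub `p₁` and rim `s, t, p₂, p₃`, with `tp₂` subdivided by `p₀` and `p₃s`
subdivided by `v`: a diamond `s, t` between `p₀` and `p₁` whose edge `sp₀` is subdivided by `v`. -/
lemma bad_of_diamond_tip {p₁ s p₂ t p₀ p₃ v : V} (hn : [p₁, s, p₂, t, p₀, p₃, v].Nodup)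
    (hG : G.Adj p₁ t ∧ G.Adj t s ∧ G.Adj t p₀ ∧ G.Adj p₀ p₂ ∧ G.Adj p₁ p₃ ∧ G.Adj p₃ p₂ ∧
      G.Adj p₃ v ∧ G.Adj v s ∧ G.Adj p₁ s ∧ G.Adj p₁ p₂) : Bad G :=
  Bad.of_certifies (m := 4)
    (l := ![[(0, 3), (3, 1), (3, 4), (4, 2)],
      [(0, 5), (5, 2), (5, 6), (6, 1)],
      [(0, 1), (0, 2)]])
    (by decide) ![p₁, s, p₂, t, p₀, p₃, v] (by simpa using hn) (by simp [Fin.forall_fin_succ]; tauto)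

/-- The wheel with hub `p₁` and rim `v, t, p₂, p₃`, with `tp₂` subdivided by `p₀` and `tv`
subdivided by `s`: a diamond `s, t` between `p₀` and `p₁` whose edge `sp₁` is subdivided by `v`. -/
lemma bad_of_diamond_tip' {p₁ v p₂ t s p₀ p₃ : V} (hn : [p₁, v, p₂, t, s, p₀, p₃].Nodup)
    (hG : G.Adj p₁ t ∧ G.Adj t s ∧ G.Adj s v ∧ G.Adj t p₀ ∧ G.Adj p₀ p₂ ∧ G.Adj p₁ p₃ ∧
      G.Adj p₃ v ∧ G.Adj p₃ p₂ ∧ G.Adj p₁ v ∧ G.Adj p₁ p₂) : Bad G :=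
  Bad.of_certifies (m := 4)
    (l := ![[(0, 3), (3, 4), (4, 1), (3, 5), (5, 2)],
      [(0, 6), (6, 1), (6, 2)],
      [(0, 1), (0, 2)]])
    (by decide) ![p₁, v, p₂, t, s, p₀, p₃] (by simpa using hn) (by simp [Fin.forall_fin_succ]; tauto)

/-- Prism with a second path along a triangle edge. -/
lemma bad_of_prism_triangle_ear {a₀ a₁ a₂ b₀ b₁ b₂ v : V} (hn : [a₀, a₁, a₂, b₀, b₁, b₂, v].Nodup)
    (hG : G.Adj a₀ v ∧ G.Adj v a₁ ∧ G.Adj a₁ a₂ ∧ G.Adj a₀ a₁ ∧ G.Adj a₀ a₂ ∧ G.Adj a₀ b₀ ∧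
      G.Adj b₀ b₁ ∧ G.Adj b₁ a₁ ∧ G.Adj b₀ b₂ ∧ G.Adj b₂ a₂) : Bad G :=
  Bad.of_certifies (m := 4)
    (l := ![[(0, 6), (6, 1), (1, 2)],
      [(0, 1), (0, 2)],
      [(0, 3), (3, 4), (4, 1), (3, 5), (5, 2)]])
    (by decide) ![a₀, a₁, a₂, b₀, b₁, b₂, v] (by simpa using hn) (by simp [Fin.forall_fin_succ]; tauto)

/-- Prism with a second path along a rung. -/
lemma bad_of_prism_rung_ear {a₀ b₀ a₁ a₂ b₁ b₂ v : V} (hn : [a₀, b₀, a₁, a₂, b₁, b₂, v].Nodup)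
    (hG : G.Adj a₀ b₀ ∧ G.Adj a₀ a₁ ∧ G.Adj a₀ v ∧ G.Adj v b₀ ∧ G.Adj b₀ b₁ ∧ G.Adj b₁ a₁ ∧
      G.Adj a₀ a₂ ∧ G.Adj a₂ a₁ ∧ G.Adj a₂ b₂ ∧ G.Adj b₂ b₀) : Bad G :=
  Bad.of_certifies (m := 4)
    (l := ![[(0, 1), (0, 2)],
      [(0, 6), (6, 1), (1, 4), (4, 2)],
      [(0, 3), (3, 2), (3, 5), (5, 1)]])
    (by decide) ![a₀, b₀, a₁, a₂, b₁, b₂, v] (by simpa using hn) (by simp [Fin.forall_fin_succ]; tauto)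

/-- Prism, triangle edge `a₀a₁` subdivided by `v`, and `v` joined to the third vertex of that
triangle. -/
lemma bad_of_prism_sub_same {a₂ a₀ a₁ b₂ b₀ b₁ v : V} (hn : [a₂, a₀, a₁, b₂, b₀, b₁, v].Nodup)
    (hG : G.Adj a₂ v ∧ G.Adj v a₀ ∧ G.Adj v a₁ ∧ G.Adj a₂ b₂ ∧ G.Adj b₂ b₀ ∧ G.Adj b₀ a₀ ∧
      G.Adj b₂ b₁ ∧ G.Adj b₁ a₁ ∧ G.Adj a₂ a₀ ∧ G.Adj a₂ a₁) : Bad G :=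
  Bad.of_certifies (m := 4)
    (l := ![[(0, 6), (6, 1), (6, 2)],
      [(0, 3), (3, 4), (4, 1), (3, 5), (5, 2)],
      [(0, 1), (0, 2)]])
    (by decide) ![a₂, a₀, a₁, b₂, b₀, b₁, v] (by simpa using hn) (by simp [Fin.forall_fin_succ]; tauto)

/-- Prism, triangle edge `a₀a₁` subdivided by `v`, and `v` joined to `b₀`. -/
lemma bad_of_prism_sub_mate {b₀ a₀ b₁ v a₁ b₂ a₂ : V} (hn : [b₀, a₀, b₁, v, a₁, b₂, a₂].Nodup)
    (hG : G.Adj b₀ v ∧ G.Adj v a₀ ∧ G.Adj v a₁ ∧ G.Adj a₁ b₁ ∧ G.Adj b₀ b₂ ∧ G.Adj b₂ b₁ ∧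
      G.Adj b₂ a₂ ∧ G.Adj a₂ a₀ ∧ G.Adj b₀ a₀ ∧ G.Adj b₀ b₁) : Bad G :=
  Bad.of_certifies (m := 4)
    (l := ![[(0, 3), (3, 1), (3, 4), (4, 2)],
      [(0, 5), (5, 2), (5, 6), (6, 1)],
      [(0, 1), (0, 2)]])
    (by decide) ![b₀, a₀, b₁, v, a₁, b₂, a₂] (by simpa using hn) (by simp [Fin.forall_fin_succ]; tauto)

/-- Prism, triangle edge `a₀a₁` subdivided by `v`, and `v` joined to `b₂`. -/
lemma bad_of_prism_sub_opp {a₀ a₁ b₂ v a₂ b₀ b₁ : V} (hn : [a₀, a₁, b₂, v, a₂, b₀, b₁].Nodup)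
    (hG : G.Adj a₀ v ∧ G.Adj v a₁ ∧ G.Adj v b₂ ∧ G.Adj a₀ a₂ ∧ G.Adj a₂ a₁ ∧ G.Adj a₂ b₂ ∧
      G.Adj a₀ b₀ ∧ G.Adj b₀ b₁ ∧ G.Adj b₁ a₁ ∧ G.Adj b₀ b₂) : Bad G :=
  Bad.of_certifies (m := 4)
    (l := ![[(0, 3), (3, 1), (3, 2)],
      [(0, 4), (4, 1), (4, 2)],
      [(0, 5), (5, 6), (6, 1), (5, 2)]])
    (by decide) ![a₀, a₁, b₂, v, a₂, b₀, b₁] (by simpa using hn) (by simp [Fin.forall_fin_succ]; tauto)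

/-- Prism, rung `a₀b₀` subdivided by `v`, and `v` joined to `a₁`. -/
lemma bad_of_prism_sub_rung {a₁ a₀ b₁ a₂ b₂ v b₀ : V} (hn : [a₁, a₀, b₁, a₂, b₂, v, b₀].Nodup)
    (hG : G.Adj a₁ a₂ ∧ G.Adj a₂ a₀ ∧ G.Adj a₂ b₂ ∧ G.Adj b₂ b₁ ∧ G.Adj a₁ v ∧ G.Adj v a₀ ∧
      G.Adj v b₀ ∧ G.Adj b₀ b₁ ∧ G.Adj a₁ a₀ ∧ G.Adj a₁ b₁) : Bad G :=
  Bad.of_certifies (m := 4)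
    (l := ![[(0, 3), (3, 1), (3, 4), (4, 2)],
      [(0, 5), (5, 1), (5, 6), (6, 2)],
      [(0, 1), (0, 2)]])
    (by decide) ![a₁, a₀, b₁, a₂, b₂, v, b₀] (by simpa using hn) (by simp [Fin.forall_fin_succ]; tauto)

/-! ### Counting edges -/

/-- All edges of `G` lie inside the vertex set `X`. Graphs of varying order are treated as graphs
on one ambient vertex type with a prescribed set of vertices. -/
def EdgesIn (G : SimpleGraph V) (X : Finset V) : Prop := ∀ x y, G.Adj x y → x ∈ X

lemma ncard_edgeSet_eq_add [Finite V] {G H K : SimpleGraph V}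
    (h : ∀ x y, G.Adj x y ↔ H.Adj x y ∨ K.Adj x y) (hd : ∀ x y, H.Adj x y → ¬ K.Adj x y) :
    G.edgeSet.ncard = H.edgeSet.ncard + K.edgeSet.ncard := by
  rw [← Set.ncard_union_eq]
  · congr 1
    ext e
    induction e with
    | h x y => simp [h]
  · rw [Set.disjoint_left]
    intro e
    induction e with
    | h x y => exact hd x y

/-- Two parts of the vertex set that share at most one vertex and cover all edges. -/
lemma ncard_edgeSet_split [Finite V] {G : SimpleGraph V} {A B : Set V}
    (h : ∀ x y, G.Adj x y → (x ∈ A ∧ y ∈ A) ∨ (x ∈ B ∧ y ∈ B))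
    (hd : ∀ x y, x ∈ A → y ∈ A → x ∈ B → y ∈ B → x = y) :
    G.edgeSet.ncard = (within G A).edgeSet.ncard + (within G B).edgeSet.ncard := by
  apply ncard_edgeSet_eq_add
  · intro x y
    simp only [within]
    have := h x y
    tauto
  · rintro x y ⟨h1, h2, h3⟩ ⟨_, h4, h5⟩
    exact h1.ne (hd x y h2 h3 h4 h5)

lemma ncard_edgeSet_delete [Finite V] (G : SimpleGraph V) (v : V) :
    G.edgeSet.ncard = (within G {v}ᶜ).edgeSet.ncard + (G.neighborSet v).ncard := by
  have h : G.edgeSet = (within G {v}ᶜ).edgeSet ∪ (fun x => s(v, x)) '' G.neighborSet v := by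
    ext e
    induction e with
    | h x y =>
      simp only [SimpleGraph.mem_edgeSet, within, Set.mem_union, Set.mem_image,
        SimpleGraph.mem_neighborSet, Set.mem_compl_iff, Set.mem_singleton_iff, Sym2.eq_iff]
      constructor
      · intro h
        by_cases hx : x = v
        · subst hx; exact Or.inr ⟨y, h, by simp⟩
        · by_cases hy : y = v
          · subst hy; exact Or.inr ⟨x, h.symm, by simp⟩
          · exact Or.inl ⟨h, hx, hy⟩
      · rintro (h | ⟨z, h, ⟨rfl, rfl⟩ | ⟨rfl, rfl⟩⟩)
        · exact h.1
        · exact h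
        · exact h.symm
  rw [h, Set.ncard_union_eq, Set.ncard_image_of_injective]
  · intro x y hxy
    exact Sym2.congr_right.1 hxy
  · rw [Set.disjoint_left]
    rintro e he ⟨z, hz, rfl⟩
    exact he.2.1 rfl

lemma ncard_edgeSet_add_edge [Finite V] {G H : SimpleGraph V} {a b : V}
    (hn : ¬ G.Adj a b)
    (h : ∀ x y, H.Adj x y ↔ (x = a ∧ y = b) ∨ (x = b ∧ y = a) ∨ G.Adj x y) :
    H.edgeSet.ncard = G.edgeSet.ncard + 1 := by
  have hs : H.edgeSet = insert s(a, b) G.edgeSet := by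
    ext e
    induction e with
    | h x y =>
      simp only [SimpleGraph.mem_edgeSet, Set.mem_insert_iff, Sym2.eq_iff, h]
      tauto
  rw [hs, Set.ncard_insert_of_notMem (by simpa using hn)]

/-- Splitting off a vertex `v` of degree `d` at non-adjacent neighbours loses `d - 1` edges. -/
lemma ncard_edgeSet_bypass [Finite V] {G : SimpleGraph V} {a v b : V} (h1 : G.Adj a v)
    (h2 : G.Adj v b) (hab : a ≠ b) (hn : ¬ G.Adj a b) :
    (bypass G {a, v, b} a b).edgeSet.ncard + (G.neighborSet v).ncard = G.edgeSet.ncard + 1 := by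
  have : (bypass G {a, v, b} a b).edgeSet.ncard = (within G {v}ᶜ).edgeSet.ncard + 1 := by
    apply ncard_edgeSet_add_edge (a := a) (b := b) (G := within G {v}ᶜ) (fun h => hn h.1)
    intro x y
    rw [bypass_path_adj h1.ne h2.ne hab]
    rfl
  rw [ncard_edgeSet_delete G v]
  omega

lemma sum_ncard_neighborSet [Fintype V] {G : SimpleGraph V} {X : Finset V} (hX : EdgesIn G X) :
    ∑ v ∈ X, (G.neighborSet v).ncard = 2 * G.edgeSet.ncard := by
  classical
  have h1 : ∀ v, (G.neighborSet v).ncard = G.degree v := by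
    intro v
    rw [Set.ncard_eq_toFinset_card', Set.toFinset_card, SimpleGraph.card_neighborSet_eq_degree]
  have h2 : G.edgeSet.ncard = G.edgeFinset.card := by
    rw [Set.ncard_eq_toFinset_card']
    rfl
  rw [h2, ← G.sum_degrees_eq_twice_card_edges]
  simp only [h1]
  apply Finset.sum_subset (Finset.subset_univ _)
  intro v _ hv
  by_contra h
  obtain ⟨w, hw⟩ := (G.degree_pos_iff_exists_adj v).1 (Nat.pos_of_ne_zero h)
  exact hv (hX _ _ hw)

/-- Fewer than `2|X|` edges leave a vertex of degree at most `3`, by the degree sum. -/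
lemma exists_ncard_neighborSet_le_three [Fintype V] {G : SimpleGraph V} {X : Finset V}
    (hX : EdgesIn G X) (h : G.edgeSet.ncard < 2 * X.card) :
    ∃ v ∈ X, (G.neighborSet v).ncard ≤ 3 := by
  by_contra! hc
  have h1 : ∑ _v ∈ X, 4 ≤ ∑ v ∈ X, (G.neighborSet v).ncard :=
    Finset.sum_le_sum fun v hv => hc v hv
  rw [sum_ncard_neighborSet hX] at h1
  simp at h1
  omega

lemma neighborSet_subset_erase {G : SimpleGraph V} {X : Finset V} [DecidableEq V]
    (hX : EdgesIn G X) (v : V) : G.neighborSet v ⊆ (X.erase v : Finset V) := by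
  intro w hw
  have hw : G.Adj v w := hw
  simpa [hw.ne'] using hX _ _ hw.symm

lemma ncard_edgeSet_le_six [Fintype V] {G : SimpleGraph V} {X : Finset V} (hX : EdgesIn G X)
    (h : X.card = 4) : G.edgeSet.ncard ≤ 6 := by
  classical
  have h1 : ∑ v ∈ X, (G.neighborSet v).ncard ≤ ∑ _v ∈ X, 3 := by
    refine Finset.sum_le_sum fun v hv => ?_
    have := Set.ncard_le_ncard (neighborSet_subset_erase hX v)
    rw [Set.ncard_coe_finset, Finset.card_erase_of_mem hv] at this
    omega
  rw [sum_ncard_neighborSet hX] at h1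
  simp [h] at h1
  omega

lemma ncard_edgeSet_complete [Fintype V] {G : SimpleGraph V} {X : Finset V} (hX : EdgesIn G X)
    (hc : ∀ x ∈ X, ∀ y ∈ X, x ≠ y → G.Adj x y) :
    X.card * (X.card - 1) = 2 * G.edgeSet.ncard := by
  classical
  rw [← sum_ncard_neighborSet hX, ← smul_eq_mul, ← Finset.sum_const]
  refine Finset.sum_congr rfl fun v hv => ?_
  have : G.neighborSet v = (X.erase v : Finset V) := by
    apply (neighborSet_subset_erase hX v).antisymm
    intro w hw
    simp only [Finset.coe_erase, Set.mem_sdiff, Finset.mem_coe, Set.mem_singleton_iff] at hw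
    exact hc v hv w hw.1 (Ne.symm hw.2)
  rw [this, Set.ncard_coe_finset, Finset.card_erase_of_mem hv]

lemma edgesIn_within {G : SimpleGraph V} (X : Finset V) : EdgesIn (within G (X : Set V)) X :=
  fun _ _ h => h.2.1

/-! ### Graphs that contain a `K₄` -/

/-- The part of the extremal statement for order `m` that bounds the number of edges: at most
`2m - 2`, with equality only for `K₁` and `K₄`. No connectivity is assumed. -/
def CountBound (V : Type*) (m : ℕ) : Prop :=
  ∀ (X : Finset V) (G : SimpleGraph V), X.card = m → EdgesIn G X → ¬ Bad G →
    G.edgeSet.ncard + 2 ≤ 2 * m ∧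
    (G.edgeSet.ncard + 2 = 2 * m → m = 1 ∨ (m = 4 ∧ ∀ x ∈ X, ∀ y ∈ X, x ≠ y → G.Adj x y))

/-- Two copies of `K₄` that share the vertex `u`. -/
lemma bad_of_K4_K4 {G : SimpleGraph V} {u : V} {Q R : Finset V} (hQ : G.IsNClique 4 Q)
    (hR : G.IsNClique 4 R) (hu : ∀ x, x ∈ Q ∧ x ∈ R ↔ x = u) : Bad G := by
  classical
  obtain ⟨q₁, q₂, q₃, h12, h13, h23, hq⟩ := Finset.card_eq_three.1
    (by rw [Finset.card_erase_of_mem ((hu u).2 rfl).1, hQ.card_eq] : (Q.erase u).card = 3)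
  obtain ⟨r₁, r₂, r₃, k12, k13, k23, hr⟩ := Finset.card_eq_three.1
    (by rw [Finset.card_erase_of_mem ((hu u).2 rfl).2, hR.card_eq] : (R.erase u).card = 3)
  have hq' : ∀ x, (x ≠ u ∧ x ∈ Q) ↔ (x = q₁ ∨ x = q₂ ∨ x = q₃) := by
    intro x; rw [← Finset.mem_erase, hq]; simp
  have hr' : ∀ x, (x ≠ u ∧ x ∈ R) ↔ (x = r₁ ∨ x = r₂ ∨ x = r₃) := by
    intro x; rw [← Finset.mem_erase, hr]; simp
  have aQ : ∀ x ∈ Q, ∀ y ∈ Q, x ≠ y → G.Adj x y := fun x hx y hy h => hQ.isClique hx hy h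
  have aR : ∀ x ∈ R, ∀ y ∈ R, x ≠ y → G.Adj x y := fun x hx y hy h => hR.isClique hx hy h
  have n1 := (hq' q₁).2 (by simp)
  have n2 := (hq' q₂).2 (by simp)
  have n3 := (hq' q₃).2 (by simp)
  have m1 := (hr' r₁).2 (by simp)
  have m2 := (hr' r₂).2 (by simp)
  have m3 := (hr' r₃).2 (by simp)
  have hu' := (hu u).2 rfl
  refine bad_of_K4_at_hub (u := u) (q₁ := q₁) (w := r₁) (q₂ := q₂) (q₃ := q₃) (x := r₂) (y := r₃)
    ?_ ?_
  · simp only [List.nodup_cons, List.mem_cons]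
    grind
  · grind

/-- The vertices other than `u` of a `4`-clique. -/
lemma exists_of_isNClique {G : SimpleGraph V} {Q : Finset V} (hQ : G.IsNClique 4 Q) {u : V}
    (hu : u ∈ Q) : ∃ x y z, (∀ w, w ∈ Q ↔ w = u ∨ w = x ∨ w = y ∨ w = z) ∧
      [u, x, y, z].Nodup ∧ G.Adj u x ∧ G.Adj u y ∧ G.Adj u z ∧ G.Adj x y ∧ G.Adj x z ∧
      G.Adj y z := by
  classical
  obtain ⟨x, y, z, h12, h13, h23, hq⟩ := Finset.card_eq_three.1
    (by rw [Finset.card_erase_of_mem hu, hQ.card_eq] : (Q.erase u).card = 3)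
  have hq' : ∀ w, (w ≠ u ∧ w ∈ Q) ↔ (w = x ∨ w = y ∨ w = z) := by
    intro x; rw [← Finset.mem_erase, hq]; simp
  have aQ : ∀ x ∈ Q, ∀ y ∈ Q, x ≠ y → G.Adj x y := fun x hx y hy h => hQ.isClique hx hy h
  have n1 := (hq' x).2 (by simp)
  have n2 := (hq' y).2 (by simp)
  have n3 := (hq' z).2 (by simp)
  refine ⟨x, y, z, ?_, ?_, ?_⟩
  · intro w
    rw [← hq' w]
    by_cases h : w = u <;> simp [h, hu]
  · simp only [List.nodup_cons, List.mem_cons]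
    grind
  · grind

/-- A `K₄` in a graph without three disjoint connectors is an end block: outside of it there is
only one part `A`, hanging at a single vertex `u`. -/
lemma K4_peel [Fintype V] {n : ℕ} (ih : ∀ m, 0 < m → m < n → CountBound V m) {X : Finset V}
    {G : SimpleGraph V} (hn : X.card = n) (hX : EdgesIn G X) (hG : ¬ Bad G) {Q : Finset V}
    (hQ : G.IsNClique 4 Q) (he : 2 * n ≤ G.edgeSet.ncard + 3) :
    X = Q ∨ (G.edgeSet.ncard + 3 = 2 * n ∧ ∃ u ∈ Q, ∃ A : Finset V, 2 ≤ A.card ∧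
      A.card + 3 = n ∧ (∀ x, x ∈ A ∧ x ∈ Q ↔ x = u) ∧ (∀ x, x ∈ X ↔ x ∈ A ∨ x ∈ Q) ∧
      (∀ x y, G.Adj x y → (x ∈ A ∧ y ∈ A) ∨ (x ∈ Q ∧ y ∈ Q)) ∧
      (∀ x ∈ A, (within G (A : Set V)).Reachable u x) ∧
      (within G (A : Set V)).edgeSet.ncard + 3 = 2 * A.card) := by
  classical
  have aQ : ∀ x ∈ Q, ∀ y ∈ Q, x ≠ y → G.Adj x y := fun x hx y hy h => hQ.isClique hx hy h
  have hQX : Q ⊆ X := by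
    intro x hx
    obtain ⟨y, hy, hyx⟩ := Finset.exists_mem_ne (by rw [hQ.card_eq]; norm_num : 1 < Q.card) x
    exact hX x y (aQ x hx y hy hyx.symm)
  have hQ4 := hQ.card_eq
  by_cases hout : ∃ u ∈ Q, ∃ x, x ∉ Q ∧ G.Adj u x
  · right
    obtain ⟨u, hu, x₀, hx₀, hux₀⟩ := hout
    -- `A` is the component of `u` after deleting the rest of `Q`
    let H : SimpleGraph V := within G {x | x ∈ Q → x = u}
    let A : Finset V := X.filter fun x => H.Reachable u x
    have huX := hQX hu
    have huA : u ∈ A := by simp [A, huX]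
    have hHu : ∀ x, H.Reachable u x → x ∈ Q → x = u := by
      rintro x hx hxQ
      by_contra hne
      obtain ⟨w⟩ := hx.symm
      cases w with
      | nil => exact hne rfl
      | cons h _ => exact hne (h.2.1 hxQ)
    have hAQ : ∀ x, x ∈ A → x ∈ Q → x = u := fun x hx hxQ =>
      hHu x (Finset.mem_filter.1 hx).2 hxQ
    have hAstep : ∀ x y, x ∈ A → H.Adj x y → y ∈ A := by
      intro x y hx hxy
      refine Finset.mem_filter.2 ⟨hX _ _ hxy.1.symm, ?_⟩
      exact (Finset.mem_filter.1 hx).2.trans hxy.reachable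
    have hreach : ∀ x ∈ A, (within G (A : Set V)).Reachable u x := by
      have key : ∀ x y, H.Walk x y → x ∈ A → (within G (A : Set V)).Reachable x y := by
        intro x y w
        induction w with
        | nil => intro _; exact SimpleGraph.Reachable.refl _
        | cons h _ ihw =>
          intro hx
          have hy := hAstep _ _ hx h
          have hadj : (within G (A : Set V)).Adj _ _ := ⟨h.1, hx, hy⟩
          exact hadj.reachable.trans (ihw hy)
      intro x hx
      obtain ⟨w⟩ := (Finset.mem_filter.1 hx).2
      exact key _ _ w huA
    -- an edge from `A` to the rest of `Q` closes a second path between two vertices of `Q`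
    have hcross : ∀ z q, z ∈ A → z ≠ u → q ∈ Q → q ≠ u → ¬ G.Adj z q := by
      intro z q hz hzu hq hqu hzq
      apply hG
      apply Bad.of_bypass (A := (A : Set V)) (u := u) (c := z) huA hz (hreach z hz)
      obtain ⟨x, y, w, hmem, hnd, -⟩ := exists_of_isNClique hQ hu
      have hzQ : z ∉ Q := fun h => hzu (hAQ z hz h)
      have key : ∀ a b, a ∈ Q → b ∈ Q → a ≠ b → (bypass G (A : Set V) u z).Adj a b := by
        intro a b ha hb hab
        refine ⟨hab, Or.inr (Or.inr ⟨aQ a ha b hb hab, ?_, ?_, ?_⟩)⟩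
        · rintro ⟨h1, h2⟩
          exact hab ((hAQ a h1 ha).trans (hAQ b h2 hb).symm)
        · intro h; exact Or.inl (hAQ a h ha)
        · intro h; exact Or.inl (hAQ b h hb)
      have kz : (bypass G (A : Set V) u z).Adj u z := ⟨Ne.symm hzu, Or.inl ⟨rfl, rfl⟩⟩
      have kq : (bypass G (A : Set V) u z).Adj q z := by
        refine ⟨hzq.ne', Or.inr (Or.inr ⟨hzq.symm, ?_, ?_, ?_⟩)⟩
        · rintro ⟨h1, -⟩
          exact hqu (hAQ q h1 hq)
        · intro h; exact Or.inl (hAQ q h hq)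
        · intro h; exact Or.inr rfl
      obtain ⟨y', w', hperm⟩ : ∃ y' w', [u, q, y', w'].Nodup ∧ y' ∈ Q ∧ w' ∈ Q := by
        simp only [List.nodup_cons, List.mem_cons] at hnd ⊢
        have := (hmem q).1 hq
        have hx : x ∈ Q := by rw [hmem]; simp
        have hy : y ∈ Q := by rw [hmem]; simp
        have hw : w ∈ Q := by rw [hmem]; simp
        rcases this with h | rfl | rfl | rfl
        · exact absurd h hqu
        · exact ⟨y, w, by grind⟩
        · exact ⟨x, w, by grind⟩
        · exact ⟨x, y, by grind⟩
      obtain ⟨hp, hy', hw'⟩ := hperm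
      refine bad_of_K4_ear (q₀ := u) (q₁ := q) (q₂ := y') (q₃ := w') (z := z) ?_ ?_
      · simp only [List.nodup_cons, List.mem_cons] at hp ⊢
        grind
      · simp only [List.nodup_cons, List.mem_cons] at hp
        have := (bypass G (A : Set V) u z).adj_comm
        refine ⟨?_, ?_, ?_, ?_, ?_, ?_, kz, kq.symm⟩ <;> (apply key <;> grind)
    -- so `G` is the union of its parts on `A` and on `B`, which share only `u`
    let B : Finset V := (X \ A) ∪ {u}
    have hcov : ∀ x y, G.Adj x y → (x ∈ A ∧ y ∈ A) ∨ (x ∈ B ∧ y ∈ B) := by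
      have h1 : ∀ x y, G.Adj x y → x ∈ A → x ≠ u → y ∈ A := by
        intro x y hxy hx hxu
        by_cases hy : y ∈ Q
        · by_cases hyu : y = u
          · rw [hyu]; exact huA
          · exact absurd hxy (hcross x y hx hxu hy hyu)
        · exact hAstep x y hx ⟨hxy, fun h => hAQ x hx h, fun h => absurd h hy⟩
      intro x y hxy
      have hx := hX _ _ hxy
      have hy := hX _ _ hxy.symm
      by_cases hx1 : x ∈ A ∧ x ≠ u
      · exact Or.inl ⟨hx1.1, h1 x y hxy hx1.1 hx1.2⟩
      by_cases hy1 : y ∈ A ∧ y ≠ u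
      · exact Or.inl ⟨h1 y x hxy.symm hy1.1 hy1.2, hy1.1⟩
      right
      simp only [B, Finset.mem_union, Finset.mem_sdiff, Finset.mem_singleton]
      tauto
    have hAB : ∀ x, x ∈ A ∧ x ∈ B ↔ x = u := by
      intro x
      simp only [B, Finset.mem_union, Finset.mem_sdiff, Finset.mem_singleton]
      constructor
      · tauto
      · rintro rfl; exact ⟨huA, Or.inr rfl⟩
    have hAX : A ⊆ X := Finset.filter_subset _ _
    have hcard : A.card + B.card = n + 1 := by
      have h1 : B.card = (X \ A).card + 1 := by
        rw [Finset.card_union_of_disjoint (by simp [huA]), Finset.card_singleton]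
      have h2 := Finset.card_sdiff_add_card_eq_card hAX
      omega
    have hQB : Q ⊆ B := by
      intro x hx
      by_cases hxA : x ∈ A
      · rw [hAQ x hxA hx]; exact ((hAB u).2 rfl).2
      · exact Finset.mem_union_left _ (Finset.mem_sdiff.2 ⟨hQX hx, hxA⟩)
    have hB4 : 4 ≤ B.card := hQ4 ▸ Finset.card_le_card hQB
    have hx₀A : x₀ ∈ A := hAstep u x₀ huA ⟨hux₀, fun _ => rfl, fun h => absurd h hx₀⟩
    have hA2 : 2 ≤ A.card := by
      have : ({u, x₀} : Finset V) ⊆ A := by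
        intro x hx
        rcases Finset.mem_insert.1 hx with rfl | hx
        · exact huA
        · rw [Finset.mem_singleton.1 hx]; exact hx₀A
      simpa [Finset.card_pair hux₀.ne] using Finset.card_le_card this
    have hsplit := ncard_edgeSet_split (G := G) (A := (A : Set V)) (B := (B : Set V)) hcov
      (fun x y h1 h2 h3 h4 => ((hAB x).1 ⟨h1, h3⟩).trans ((hAB y).1 ⟨h2, h4⟩).symm)
    have hbA := ih A.card (by omega) (by omega) A (within G (A : Set V)) rfl (edgesIn_within A)
      (fun h => hG (h.mono (within_le _ _)))
    have hbB := ih B.card (by omega) (by omega) B (within G (B : Set V)) rfl (edgesIn_within B)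
      (fun h => hG (h.mono (within_le _ _)))
    have hAne : (within G (A : Set V)).edgeSet.ncard + 2 ≠ 2 * A.card := by
      intro h
      rcases hbA.2 h with h1 | ⟨h4, hc⟩
      · omega
      · refine hG (bad_of_K4_K4 (u := u) hQ (R := A) ⟨?_, h4⟩ ?_)
        · intro x hx y hy hxy
          exact (hc x hx y hy hxy).1
        · intro x
          constructor
          · exact fun h => hAQ x h.2 h.1
          · rintro rfl; exact ⟨hu, huA⟩
    have hBcard : B.card = 4 := by
      rcases hbB.2 (by omega) with h | h
      · omega
      · exact h.1
    have hBQ : B = Q := (Finset.eq_of_subset_of_card_le hQB (by omega)).symm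
    refine ⟨by omega, u, hu, A, hA2, by omega, ?_, ?_, ?_, hreach, by omega⟩
    · rw [← hBQ]; exact hAB
    · intro x
      rw [← hBQ]
      simp only [B, Finset.mem_union, Finset.mem_sdiff, Finset.mem_singleton]
      constructor
      · tauto
      · rintro (h | h | rfl)
        · exact hAX h
        · exact h.1
        · exact huX
    · rw [← hBQ]; exact hcov
  · left
    push Not at hout
    by_contra hne
    have hlt : Q.card < X.card := Finset.card_lt_card
      (Finset.ssubset_iff_subset_ne.2 ⟨hQX, fun h => hne h.symm⟩)
    have hcov : ∀ x y, G.Adj x y → (x ∈ Q ∧ y ∈ Q) ∨ (x ∈ X \ Q ∧ y ∈ X \ Q) := by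
      intro x y hxy
      have hx := hX _ _ hxy
      have hy := hX _ _ hxy.symm
      have h2 := hout x
      have h3 := hout y
      have h4 := hxy.symm
      simp only [Finset.mem_sdiff]
      by_cases hxA : x ∈ Q <;> by_cases hyA : y ∈ Q
      · simp_all
      · exact absurd hxy (h2 hxA y hyA)
      · exact absurd h4 (h3 hyA x hxA)
      · simp_all
    have hsplit := ncard_edgeSet_split (G := G) (A := (Q : Set V)) (B := ((X \ Q : Finset V) : Set V))
      hcov (fun x y h1 h2 h3 h4 => absurd h1 (Finset.mem_sdiff.1 h3).2)
    have hc := Finset.card_sdiff_add_card_eq_card hQX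
    have hbB := ih (X \ Q).card (by omega) (by omega) (X \ Q) (within G ((X \ Q : Finset V) : Set V))
      rfl (edgesIn_within _) (fun h => hG (h.mono (within_le _ _)))
    have hbQ := ncard_edgeSet_le_six (edgesIn_within (G := G) Q) hQ4
    omega

/-! ### The base graphs inside an ambient vertex type -/

/-- `G` on the vertex set `X` is the strip on `p 0, …, p (r - 1)`. -/
structure StripOn (G : SimpleGraph V) (X : Finset V) (p : ℕ → V) (r : ℕ) : Prop where
  inj : ∀ i j, i < r → j < r → p i = p j → i = j
  mem : ∀ x, x ∈ X ↔ ∃ i, i < r ∧ p i = x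
  adj : ∀ i j, i < r → j < r → (G.Adj (p i) (p j) ↔ i ≠ j ∧ i ≤ j + 2 ∧ j ≤ i + 2)

/-- `G` on the vertex set `X` is the join of the edge `gk` and an independent set. -/
structure BookOn (G : SimpleGraph V) (X : Finset V) (g k : V) : Prop where
  ne : g ≠ k
  hg : g ∈ X
  hk : k ∈ X
  adj : ∀ x y, x ∈ X → y ∈ X →
    (G.Adj x y ↔ x ≠ y ∧ ((x = g ∨ x = k) ∨ (y = g ∨ y = k)))

/-- `G` on the vertex set `X` is the strip on `p 0, …, p (m - 1)` whose first edge is replaced by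
the diamond with new vertices `s, t`. -/
structure OneOn (G : SimpleGraph V) (X : Finset V) (p : ℕ → V) (s t : V) (m : ℕ) : Prop where
  inj : ∀ i j, i < m → j < m → p i = p j → i = j
  ne_s : ∀ i, i < m → p i ≠ s
  ne_t : ∀ i, i < m → p i ≠ t
  mem : ∀ x, x ∈ X ↔ (∃ i, i < m ∧ p i = x) ∨ x = s ∨ x = t
  adj : ∀ i j, i < m → j < m →
    (G.Adj (p i) (p j) ↔ i ≠ j ∧ i ≤ j + 2 ∧ j ≤ i + 2 ∧ i + j ≠ 1)
  st : G.Adj s t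
  sp : ∀ i, i < m → (G.Adj s (p i) ↔ i ≤ 1)
  tp : ∀ i, i < m → (G.Adj t (p i) ↔ i ≤ 1)

/-- `G` on the vertex set `X` is the strip on `p 0, …, p (m - 1)` whose first and last edges are
replaced by diamonds with new vertices `s, t` and `s', t'`. -/
structure TwoOn (G : SimpleGraph V) (X : Finset V) (p : ℕ → V) (s t s' t' : V) (m : ℕ) :
    Prop where
  inj : ∀ i j, i < m → j < m → p i = p j → i = j
  ne_s : ∀ i, i < m → p i ≠ s
  ne_t : ∀ i, i < m → p i ≠ t
  ne_s' : ∀ i, i < m → p i ≠ s'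
  ne_t' : ∀ i, i < m → p i ≠ t'
  nodup : [s, t, s', t'].Nodup
  mem : ∀ x, x ∈ X ↔ (∃ i, i < m ∧ p i = x) ∨ x = s ∨ x = t ∨ x = s' ∨ x = t'
  adj : ∀ i j, i < m → j < m →
    (G.Adj (p i) (p j) ↔ i ≠ j ∧ i ≤ j + 2 ∧ j ≤ i + 2 ∧ i + j ≠ 1 ∧ i + j + 3 ≠ 2 * m)
  st : G.Adj s t
  sp : ∀ i, i < m → (G.Adj s (p i) ↔ i ≤ 1)
  tp : ∀ i, i < m → (G.Adj t (p i) ↔ i ≤ 1)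
  st' : G.Adj s' t'
  sp' : ∀ i, i < m → (G.Adj s' (p i) ↔ m ≤ i + 2)
  tp' : ∀ i, i < m → (G.Adj t' (p i) ↔ m ≤ i + 2)
  ss' : ¬ G.Adj s s'
  ts' : ¬ G.Adj t s'
  st'' : ¬ G.Adj s t'
  tt' : ¬ G.Adj t t'

/-- `G` on the vertex set `X` is the triangular prism. -/
structure PrismOn (G : SimpleGraph V) (X : Finset V) (f : Fin 3 → Fin 2 → V) : Prop where
  inj : ∀ i j e d, f i e = f j d → i = j ∧ e = d
  mem : ∀ x, x ∈ X ↔ ∃ i e, f i e = x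
  adj : ∀ i j e d, G.Adj (f i e) (f j d) ↔ (i ≠ j ∧ e = d) ∨ (i = j ∧ e ≠ d)

/-- The graphs to which copies of `K₄` get attached, on the vertex set `X`. The strip on two
vertices, which is `K₂`, is included: it gives rise to the two sporadic graphs that contain
`K₄`. -/
inductive Base (X : Finset V) (G : SimpleGraph V) : Prop
  | strip (p : ℕ → V) (r : ℕ) (hr : 2 ≤ r) (h : StripOn G X p r) : Base X G
  | book (g k : V) (hX : 5 ≤ X.card) (h : BookOn G X g k) : Base X G
  | one (p : ℕ → V) (s t : V) (m : ℕ) (hm : 3 ≤ m) (h : OneOn G X p s t m) : Base X G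
  | two (p : ℕ → V) (s t s' t' : V) (m : ℕ) (hm : 3 ≤ m) (h : TwoOn G X p s t s' t' m) : Base X G
  | prism (f : Fin 3 → Fin 2 → V) (h : PrismOn G X f) : Base X G

lemma StripOn.rev {G : SimpleGraph V} {X : Finset V} {p : ℕ → V} {r : ℕ} (h : StripOn G X p r) :
    StripOn G X (fun i => p (r - 1 - i)) r where
  inj i j hi hj hij := by
    have := h.inj _ _ (by omega) (by omega) hij
    omega
  mem x := by
    rw [h.mem]
    constructor
    · rintro ⟨i, hi, rfl⟩
      exact ⟨r - 1 - i, by omega, by congr 1; omega⟩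
    · rintro ⟨i, hi, rfl⟩
      exact ⟨r - 1 - i, by omega, rfl⟩
  adj i j hi hj := by
    rw [h.adj _ _ (by omega) (by omega)]
    omega

lemma TwoOn.rev {G : SimpleGraph V} {X : Finset V} {p : ℕ → V} {s t s' t' : V} {m : ℕ}
    (h : TwoOn G X p s t s' t' m) (hm : 3 ≤ m) :
    TwoOn G X (fun i => p (m - 1 - i)) s' t' s t m where
  inj i j hi hj hij := by
    have := h.inj _ _ (by omega) (by omega) hij
    omega
  ne_s i hi := h.ne_s' _ (by omega)
  ne_t i hi := h.ne_t' _ (by omega)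
  ne_s' i hi := h.ne_s _ (by omega)
  ne_t' i hi := h.ne_t _ (by omega)
  nodup := by
    have := h.nodup
    simp only [List.nodup_cons, List.mem_cons] at this ⊢
    grind
  mem x := by
    rw [h.mem]
    have : (∃ i, i < m ∧ p i = x) ↔ ∃ i, i < m ∧ p (m - 1 - i) = x := by
      constructor
      · rintro ⟨i, hi, rfl⟩
        exact ⟨m - 1 - i, by omega, by congr 1; omega⟩
      · rintro ⟨i, hi, rfl⟩
        exact ⟨m - 1 - i, by omega, rfl⟩
    rw [this]
    grind
  adj i j hi hj := by
    rw [h.adj _ _ (by omega) (by omega)]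
    omega
  st := h.st'
  sp i hi := by rw [h.sp' _ (by omega)]; omega
  tp i hi := by rw [h.tp' _ (by omega)]; omega
  st' := h.st
  sp' i hi := by rw [h.sp _ (by omega)]; omega
  tp' i hi := by rw [h.tp _ (by omega)]; omega
  ss' := fun h' => h.ss' h'.symm
  ts' := fun h' => h.st'' h'.symm
  st'' := fun h' => h.ts' h'.symm
  tt' := fun h' => h.tt' h'.symm

/-- Exchanging the names of the two new vertices of the first diamond. -/
lemma OneOn.swap {G : SimpleGraph V} {X : Finset V} {p : ℕ → V} {s t : V} {m : ℕ}
    (h : OneOn G X p s t m) : OneOn G X p t s m where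
  inj := h.inj
  ne_s := h.ne_t
  ne_t := h.ne_s
  mem x := by rw [h.mem]; grind
  adj := h.adj
  st := h.st.symm
  sp := h.tp
  tp := h.sp

lemma TwoOn.swap {G : SimpleGraph V} {X : Finset V} {p : ℕ → V} {s t s' t' : V} {m : ℕ}
    (h : TwoOn G X p s t s' t' m) : TwoOn G X p t s s' t' m where
  inj := h.inj
  ne_s := h.ne_t
  ne_t := h.ne_s
  ne_s' := h.ne_s'
  ne_t' := h.ne_t'
  nodup := by
    have := h.nodup
    simp only [List.nodup_cons, List.mem_cons] at this ⊢
    grind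
  mem x := by rw [h.mem]; grind
  adj := h.adj
  st := h.st.symm
  sp := h.tp
  tp := h.sp
  st' := h.st'
  sp' := h.sp'
  tp' := h.tp'
  ss' := h.ts'
  ts' := h.ss'
  st'' := h.tt'
  tt' := h.st''

/-! ### Obstructions along a strip -/

/-- `G` contains the strip on `p 0, …, p (m - 1)`, possibly without its first edge. -/
structure Ladder (G : SimpleGraph V) (p : ℕ → V) (m : ℕ) : Prop where
  inj : ∀ i j, i < m → j < m → p i = p j → i = j
  step1 : ∀ i, 1 ≤ i → i + 1 < m → G.Adj (p i) (p (i + 1))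
  step2 : ∀ i, i + 2 < m → G.Adj (p i) (p (i + 2))

/-- A second path along an edge of the strip other than its two end edges. -/
lemma Ladder.bad_of_ear {G : SimpleGraph V} {p : ℕ → V} {r : ℕ} (L : Ladder G p r)
    (h01 : G.Adj (p 0) (p 1)) (hr : 5 ≤ r) {v : V} (hv : ∀ i, i < r → p i ≠ v) {i j : ℕ}
    (hij : i < j) (hj : j < r) (hji : j ≤ i + 2) (h1 : ¬ (i = 0 ∧ j = 1))
    (h2 : ¬ (i + 2 = r ∧ j + 1 = r)) (hi : G.Adj (p i) v) (hjv : G.Adj (p j) v) : Bad G := by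
  have step : ∀ a b, a < b → b < r → b ≤ a + 2 → G.Adj (p a) (p b) := by
    intro a b hab hb hba
    by_cases h : b = a + 2
    · subst h; exact L.step2 a hb
    · obtain rfl : b = a + 1 := by omega
      rcases Nat.eq_zero_or_pos a with rfl | ha
      · exact h01
      · exact L.step1 a ha hb
  have step' : ∀ a b, a < b → b < r → b ≤ a + 2 → G.Adj (p b) (p a) :=
    fun a b h1 h2 h3 => (step a b h1 h2 h3).symm
  have ne : ∀ a b, a < r → b < r → a ≠ b → p a ≠ p b := fun a b h1 h2 h3 h4 =>
    h3 (L.inj a b h1 h2 h4)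
  have hv' : ∀ i, i < r → v ≠ p i := fun i hi h => hv i hi h.symm
  by_cases hj1 : j = i + 1
  · subst hj1
    obtain ⟨i, rfl⟩ : ∃ k, i = k + 1 := ⟨i - 1, by omega⟩
    by_cases hlast : i + 4 < r
    · refine bad_of_book_spoke (g := p (i + 1)) (k := p (i + 2)) (z := p (i + 3)) (x := p i)
        (y := v) (w := p (i + 4)) ?_ ?_
      · simp only [List.nodup_cons, List.mem_cons, List.not_mem_nil, or_false, not_or,
          List.nodup_nil, and_true, not_false_eq_true]
        refine ⟨⟨?_, ?_, ?_, ?_, ?_⟩, ⟨?_, ?_, ?_, ?_⟩, ⟨?_, ?_, ?_⟩, ⟨?_, ?_⟩, ?_⟩ <;>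
          first | (apply ne <;> omega) | (apply hv; omega) | (apply hv'; omega)
      · refine ⟨?_, ?_, ?_, ?_, ?_, ?_, ?_, ?_, ?_⟩ <;>
          first | assumption | exact hjv.symm | (apply step <;> omega) | (apply step' <;> omega)
    · obtain ⟨i, rfl⟩ : ∃ k, i = k + 1 := ⟨i - 1, by omega⟩
      refine bad_of_book_spoke (g := p (i + 3)) (k := p (i + 2)) (z := p (i + 1)) (x := p (i + 4))
        (y := v) (w := p i) ?_ ?_
      · simp only [List.nodup_cons, List.mem_cons, List.not_mem_nil, or_false, not_or,
          List.nodup_nil, and_true, not_false_eq_true]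
        refine ⟨⟨?_, ?_, ?_, ?_, ?_⟩, ⟨?_, ?_, ?_, ?_⟩, ⟨?_, ?_, ?_⟩, ⟨?_, ?_⟩, ?_⟩ <;>
          first | (apply ne <;> omega) | (apply hv; omega) | (apply hv'; omega)
      · refine ⟨?_, ?_, ?_, ?_, ?_, ?_, ?_, ?_, ?_⟩ <;>
          first | assumption | exact hi.symm | (apply step <;> omega) | (apply step' <;> omega)
  · obtain rfl : j = i + 2 := by omega
    rcases Nat.eq_zero_or_pos i with rfl | hi0
    · refine bad_of_fan (g := p 2) (v₁ := v) (v₂ := p 0) (v₃ := p 1) (v₄ := p 3) (v₅ := p 4) ?_ ?_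
      · simp only [List.nodup_cons, List.mem_cons, List.not_mem_nil, or_false, not_or,
          List.nodup_nil, and_true, not_false_eq_true]
        refine ⟨⟨?_, ?_, ?_, ?_, ?_⟩, ⟨?_, ?_, ?_, ?_⟩, ⟨?_, ?_, ?_⟩, ⟨?_, ?_⟩, ?_⟩ <;>
          first | (apply ne <;> omega) | (apply hv; omega) | (apply hv'; omega)
      · refine ⟨?_, ?_, ?_, ?_, ?_, ?_, ?_, ?_, ?_⟩ <;>
          first | assumption | exact hi.symm | (apply step <;> omega) | (apply step' <;> omega)
    obtain ⟨i, rfl⟩ : ∃ k, i = k + 1 := ⟨i - 1, by omega⟩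
    by_cases hlast : i + 4 < r
    · refine bad_of_sun (a := p (i + 1)) (b := p (i + 2)) (c := p (i + 3)) (d := p i)
        (e := p (i + 4)) (g := v) ?_ ?_
      · simp only [List.nodup_cons, List.mem_cons, List.not_mem_nil, or_false, not_or,
          List.nodup_nil, and_true, not_false_eq_true]
        refine ⟨⟨?_, ?_, ?_, ?_, ?_⟩, ⟨?_, ?_, ?_, ?_⟩, ⟨?_, ?_, ?_⟩, ⟨?_, ?_⟩, ?_⟩ <;>
          first | (apply ne <;> omega) | (apply hv; omega)
      · refine ⟨?_, ?_, ?_, ?_, ?_, ?_, ?_, ?_, ?_⟩ <;>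
          first | assumption | exact hjv.symm | (apply step <;> omega) | (apply step' <;> omega)
    · obtain ⟨i, rfl⟩ : ∃ k, i = k + 1 := ⟨i - 1, by omega⟩
      refine bad_of_fan (g := p (i + 2)) (v₁ := v) (v₂ := p (i + 4)) (v₃ := p (i + 3))
        (v₄ := p (i + 1)) (v₅ := p i) ?_ ?_
      · simp only [List.nodup_cons, List.mem_cons, List.not_mem_nil, or_false, not_or,
          List.nodup_nil, and_true, not_false_eq_true]
        refine ⟨⟨?_, ?_, ?_, ?_, ?_⟩, ⟨?_, ?_, ?_, ?_⟩, ⟨?_, ?_, ?_⟩, ⟨?_, ?_⟩, ?_⟩ <;>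
          first | (apply ne <;> omega) | (apply hv; omega) | (apply hv'; omega)
      · refine ⟨?_, ?_, ?_, ?_, ?_, ?_, ?_, ?_, ?_⟩ <;>
          first | assumption | exact hjv.symm | (apply step <;> omega) | (apply step' <;> omega)

/-- A `K₄` on `u, q₁, q₂, q₃` that meets a set of vertices given by `P` in `u` only. The edge `q₂q₃`
is not required, as no obstruction uses it. -/
structure K4At (G : SimpleGraph V) (P : V → Prop) (u q₁ q₂ q₃ : V) : Prop where
  nodup : [q₁, q₂, q₃].Nodup
  not1 : ¬ P q₁
  not2 : ¬ P q₂
  not3 : ¬ P q₃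
  u1 : G.Adj u q₁
  u2 : G.Adj u q₂
  u3 : G.Adj u q₃
  a12 : G.Adj q₁ q₂
  a13 : G.Adj q₁ q₃

/-- No `K₄` can be attached at `u` if `u` is an end of an edge `uw` with two common neighbours
`x, y`. -/
lemma K4At.bad_of_hub {G : SimpleGraph V} {P : V → Prop} {u q₁ q₂ q₃ w x y : V}
    (K : K4At G P u q₁ q₂ q₃) (hu : P u) (hw : P w) (hx : P x) (hy : P y) (hxy : x ≠ y)
    (huw : G.Adj u w) (hux : G.Adj u x) (huy : G.Adj u y) (hwx : G.Adj w x) (hwy : G.Adj w y) :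
    Bad G := by
  have h1 := K.not1
  have h2 := K.not2
  have h3 := K.not3
  have hn := K.nodup
  have e1 := huw.ne
  have e2 := hux.ne
  have e3 := huy.ne
  have e4 := hwx.ne
  have e5 := hwy.ne
  refine bad_of_K4_at_hub (u := u) (q₁ := q₁) (w := w) (q₂ := q₂) (q₃ := q₃) (x := x) (y := y)
    ?_ ⟨K.u1, huw, K.u2, K.a12.symm, hux, hwx.symm, K.u3, K.a13.symm, huy, hwy.symm⟩
  simp only [List.nodup_cons, List.mem_cons] at hn ⊢
  grind (splits := 30)

/-- A `K₄` at a vertex of the strip other than its two ends. -/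
lemma Ladder.bad_of_K4At {G : SimpleGraph V} {p : ℕ → V} {r : ℕ} (L : Ladder G p r)
    (h01 : G.Adj (p 0) (p 1)) (hr : 4 ≤ r) {P : V → Prop} (hP : ∀ i, i < r → P (p i)) {i : ℕ}
    (hi : 1 ≤ i) (hir : i + 1 < r) {q₁ q₂ q₃ : V} (K : K4At G P (p i) q₁ q₂ q₃) : Bad G := by
  obtain ⟨i, rfl⟩ : ∃ k, i = k + 1 := ⟨i - 1, by omega⟩
  have hii : G.Adj (p i) (p (i + 1)) := by
    rcases Nat.eq_zero_or_pos i with rfl | ha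
    · exact h01
    · exact L.step1 i ha (by omega)
  have h12 := L.step1 (i + 1) (by omega) (by omega)
  by_cases hlast : i + 3 < r
  · refine K.bad_of_hub (w := p (i + 2)) (x := p i) (y := p (i + 3)) (hP _ (by omega))
      (hP _ (by omega)) (hP _ (by omega)) (hP _ (by omega)) ?_ h12 hii.symm
      (L.step2 (i + 1) (by omega)) (L.step2 i (by omega)).symm
      (L.step1 (i + 2) (by omega) (by omega))
    intro h
    have := L.inj _ _ (by omega) (by omega) h
    omega
  · obtain ⟨i, rfl⟩ : ∃ k, i = k + 1 := ⟨i - 1, by omega⟩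
    have hii' : G.Adj (p i) (p (i + 1)) := by
      rcases Nat.eq_zero_or_pos i with rfl | ha
      · exact h01
      · exact L.step1 i ha (by omega)
    refine K.bad_of_hub (w := p (i + 1)) (x := p i) (y := p (i + 3)) (hP _ (by omega))
      (hP _ (by omega)) (hP _ (by omega)) (hP _ (by omega)) ?_ hii.symm
      (L.step2 i (by omega)).symm h12 hii'.symm (L.step2 (i + 1) (by omega))
    intro h
    have := L.inj _ _ (by omega) (by omega) h
    omega

/-- `G` contains the strip on `p 0, …, p (m - 1)` with its first edge replaced by the diamond with
new vertices `s, t`. -/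
structure DiamondLadder (G : SimpleGraph V) (p : ℕ → V) (s t : V) (m : ℕ) : Prop extends
    Ladder G p m where
  ne_s : ∀ i, i < m → p i ≠ s
  ne_t : ∀ i, i < m → p i ≠ t
  st : G.Adj s t
  s0 : G.Adj s (p 0)
  s1 : G.Adj s (p 1)
  t0 : G.Adj t (p 0)
  t1 : G.Adj t (p 1)

/-- Adding `t` in front of the strip. -/
def consSeq (t : V) (p : ℕ → V) : ℕ → V
  | 0 => t
  | i + 1 => p i

/-- Using `s` as a path between the tips turns the diamond into a triangle, hence the whole
into a strip that starts with `t`. -/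
lemma DiamondLadder.bypass {G : SimpleGraph V} {p : ℕ → V} {s t : V} {m : ℕ}
    (D : DiamondLadder G p s t m) (hm : 3 ≤ m) :
    Ladder (bypass G {p 0, s, p 1} (p 0) (p 1)) (consSeq t p) (m + 1) ∧
      (SteinerExtremal.bypass G {p 0, s, p 1} (p 0) (p 1)).Adj t (p 0) := by
  have h0 : p 0 ≠ s := D.ne_s 0 (by omega)
  have h1 : s ≠ p 1 := (D.ne_s 1 (by omega)).symm
  have h01 : p 0 ≠ p 1 := fun h => by
    have := D.inj _ _ (by omega) (by omega) h
    omega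
  have hts : t ≠ s := D.st.ne'
  refine ⟨⟨?_, ?_, ?_⟩, ?_⟩
  · rintro (_ | i) (_ | j) hi hj h
    · rfl
    · exact absurd h.symm (D.ne_t j (by omega))
    · exact absurd h (D.ne_t i (by omega))
    · rw [D.inj i j (by omega) (by omega) h]
  · rintro (_ | _ | i) hi hj
    · omega
    · rw [bypass_path_adj h0 h1 h01]
      exact Or.inl ⟨rfl, rfl⟩
    · rw [bypass_path_adj h0 h1 h01]
      exact Or.inr (Or.inr ⟨D.step1 (i + 1) (by omega) (by omega), D.ne_s _ (by omega),
        D.ne_s _ (by omega)⟩)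
  · rintro (_ | i) hi
    · rw [bypass_path_adj h0 h1 h01]
      exact Or.inr (Or.inr ⟨D.t1, hts, h1.symm⟩)
    · rw [bypass_path_adj h0 h1 h01]
      exact Or.inr (Or.inr ⟨D.step2 i (by omega), D.ne_s _ (by omega), D.ne_s _ (by omega)⟩)
  · rw [bypass_path_adj h0 h1 h01]
    exact Or.inr (Or.inr ⟨D.t0, hts, h0⟩)

lemma DiamondLadder.bypass_adj {G : SimpleGraph V} {p : ℕ → V} {s t : V} {m : ℕ}
    (D : DiamondLadder G p s t m) (hm : 3 ≤ m) {x y : V} (hx : x ≠ s) (hy : y ≠ s)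
    (h : G.Adj x y) : (SteinerExtremal.bypass G {p 0, s, p 1} (p 0) (p 1)).Adj x y := by
  rw [bypass_path_adj (D.ne_s 0 (by omega)) (D.ne_s 1 (by omega)).symm ?_]
  · exact Or.inr (Or.inr ⟨h, hx, hy⟩)
  · intro h
    have := D.inj _ _ (by omega) (by omega) h
    omega

/-- A second path along an edge between two strip vertices: using `s` as a path between the tips
of the diamond reduces this to a strip that starts with `t`. -/
lemma DiamondLadder.bad_of_ear {G : SimpleGraph V} {p : ℕ → V} {s t : V} {m : ℕ}
    (D : DiamondLadder G p s t m) (hm : 4 ≤ m) {v : V} (hv : ∀ i, i < m → p i ≠ v)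
    (hvs : v ≠ s) (hvt : v ≠ t) {i j : ℕ} (hij : i < j) (hj : j < m) (hji : j ≤ i + 2)
    (h2 : ¬ (i + 2 = m ∧ j + 1 = m)) (hi : G.Adj (p i) v) (hjv : G.Adj (p j) v) : Bad G := by
  apply Bad.of_bypass_path D.s0.symm D.s1
  obtain ⟨L, h0⟩ := D.bypass (by omega)
  refine L.bad_of_ear (i := i + 1) (j := j + 1) (v := v) h0 (by omega) ?_ (by omega) (by omega)
    (by omega) (by omega) (by omega) ?_ ?_
  · rintro (_ | i) hi
    · exact hvt.symm
    · exact hv i (by omega)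
  · exact D.bypass_adj (by omega) (D.ne_s _ (by omega)) hvs hi
  · exact D.bypass_adj (by omega) (D.ne_s _ (by omega)) hvs hjv

/-- A second path along an edge of a diamond: the strip joins the tips, which makes the diamond
a `K₄`. -/
lemma DiamondLadder.bad_of_diamond_ear {G : SimpleGraph V} {p : ℕ → V} {s t : V} {m : ℕ}
    (D : DiamondLadder G p s t m) (hm : 3 ≤ m) {v : V} (hv : ∀ i, i < m → p i ≠ v)
    (hvs : v ≠ s) (hvt : v ≠ t) (h1 : G.Adj s v)
    (h2 : G.Adj t v ∨ G.Adj (p 0) v ∨ G.Adj (p 1) v) : Bad G := by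
  have n01 : p 0 ≠ p 1 := fun h => by
    have := D.inj _ _ (by omega) (by omega) h
    omega
  have n02 : p 0 ≠ p 2 := fun h => by
    have := D.inj _ _ (by omega) (by omega) h
    omega
  have n12 : p 2 ≠ p 1 := fun h => by
    have := D.inj _ _ (by omega) (by omega) h
    omega
  have s0 := D.ne_s 0 (by omega)
  have s1 := D.ne_s 1 (by omega)
  have s2 := D.ne_s 2 (by omega)
  have t0 := D.ne_t 0 (by omega)
  have t1 := D.ne_t 1 (by omega)
  have t2 := D.ne_t 2 (by omega)
  have v0 := hv 0 (by omega)
  have v1 := hv 1 (by omega)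
  have v2 := hv 2 (by omega)
  have hst := D.st.ne
  apply Bad.of_bypass_path (D.step2 0 (by omega)) (D.step1 1 (by omega) (by omega)).symm
  set G' := SteinerExtremal.bypass G {p 0, p (0 + 2), p 1} (p 0) (p 1) with hG'
  have hadj : ∀ x y, x ≠ p 2 → y ≠ p 2 → G.Adj x y → G'.Adj x y := by
    intro x y hx hy h
    rw [hG', bypass_path_adj n02 n12 n01]
    exact Or.inr (Or.inr ⟨h, hx, hy⟩)
  have h01 : G'.Adj (p 0) (p 1) := by
    rw [hG', bypass_path_adj n02 n12 n01]
    exact Or.inl ⟨rfl, rfl⟩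
  have e1 := hadj _ _ s2.symm v2.symm h1
  have e2 := hadj _ _ s2.symm t2.symm D.st
  have e3 := hadj _ _ s2.symm n02 D.s0
  have e4 := hadj _ _ s2.symm n12.symm D.s1
  have e5 := hadj _ _ t2.symm n02 D.t0
  have e6 := hadj _ _ t2.symm n12.symm D.t1
  rcases h2 with h2 | h2 | h2
  · refine bad_of_K4_ear (q₀ := s) (q₁ := t) (q₂ := p 0) (q₃ := p 1) (z := v) ?_ ?_
    · simp only [List.nodup_cons, List.mem_cons]; grind
    · have e7 := hadj _ _ t2.symm v2.symm h2
      exact ⟨e4, e6.symm, h01.symm, e2, e5, e3, e1, e7.symm⟩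
  · refine bad_of_K4_ear (q₀ := s) (q₁ := p 0) (q₂ := t) (q₃ := p 1) (z := v) ?_ ?_
    · simp only [List.nodup_cons, List.mem_cons]; grind
    · have e7 := hadj _ _ n02 v2.symm h2
      exact ⟨e4, h01.symm, e6.symm, e3, e5.symm, e2, e1, e7.symm⟩
  · refine bad_of_K4_ear (q₀ := s) (q₁ := p 1) (q₂ := t) (q₃ := p 0) (z := v) ?_ ?_
    · simp only [List.nodup_cons, List.mem_cons]; grind
    · have e7 := hadj _ _ n12.symm v2.symm h2
      exact ⟨e3, h01, e5.symm, e4, e6.symm, e2, e1, e7.symm⟩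

/-- A `K₄` at a strip vertex other than the last one, again by using `s` as a path between the
tips. -/
lemma DiamondLadder.bad_of_K4At {G : SimpleGraph V} {p : ℕ → V} {s t : V} {m : ℕ}
    (D : DiamondLadder G p s t m) (hm : 3 ≤ m) {P : V → Prop} (hP : ∀ i, i < m → P (p i))
    (hs : P s) (ht : P t) {i : ℕ} (hi : i + 1 < m) {q₁ q₂ q₃ : V}
    (K : K4At G P (p i) q₁ q₂ q₃) : Bad G := by
  apply Bad.of_bypass_path D.s0.symm D.s1
  obtain ⟨L, h0⟩ := D.bypass hm
  have h1 : q₁ ≠ s := fun h => K.not1 (h ▸ hs)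
  have h2 : q₂ ≠ s := fun h => K.not2 (h ▸ hs)
  have h3 : q₃ ≠ s := fun h => K.not3 (h ▸ hs)
  refine L.bad_of_K4At (P := P) (i := i + 1) h0 (by omega) ?_ (by omega) (by omega)
    (q₁ := q₁) (q₂ := q₂) (q₃ := q₃)
    ⟨K.nodup, K.not1, K.not2, K.not3, ?_, ?_, ?_, ?_, ?_⟩
  · rintro (_ | i) hi
    · exact ht
    · exact hP i (by omega)
  · exact D.bypass_adj hm (D.ne_s _ (by omega)) h1 K.u1
  · exact D.bypass_adj hm (D.ne_s _ (by omega)) h2 K.u2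
  · exact D.bypass_adj hm (D.ne_s _ (by omega)) h3 K.u3
  · exact D.bypass_adj hm h1 h2 K.a12
  · exact D.bypass_adj hm h1 h3 K.a13

/-- Adding `s` behind the strip on `p 0, …, p (m - 1)`. -/
def snocSeq (p : ℕ → V) (m : ℕ) (s : V) : ℕ → V := fun i => if i < m then p i else s

lemma snocSeq_lt {p : ℕ → V} {m : ℕ} {s : V} {i : ℕ} (h : i < m) : snocSeq p m s i = p i :=
  if_pos h

lemma snocSeq_self {p : ℕ → V} {m : ℕ} {s : V} : snocSeq p m s m = s := if_neg (lt_irrefl m)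

/-- `G` contains the strip on `p 0, …, p (m - 1)`, possibly without its first edge, with its last
edge replaced by the diamond with new vertices `s, t`. The edge `st` plays no role. -/
structure TailLadder (G : SimpleGraph V) (p : ℕ → V) (s t : V) (m : ℕ) : Prop where
  inj : ∀ i j, i < m → j < m → p i = p j → i = j
  step1 : ∀ i, 1 ≤ i → i + 2 < m → G.Adj (p i) (p (i + 1))
  step2 : ∀ i, i + 2 < m → G.Adj (p i) (p (i + 2))
  ne_s : ∀ i, i < m → p i ≠ s
  ne_t : ∀ i, i < m → p i ≠ t
  ne : s ≠ t
  s0 : G.Adj s (p (m - 1))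
  s1 : G.Adj s (p (m - 2))
  t0 : G.Adj t (p (m - 1))
  t1 : G.Adj t (p (m - 2))

/-- Using `t` as a path between the tips of the diamond. -/
lemma TailLadder.bypass {G : SimpleGraph V} {p : ℕ → V} {s t : V} {m : ℕ}
    (D : TailLadder G p s t m) (hm : 3 ≤ m) :
    Ladder (bypass G {p (m - 2), t, p (m - 1)} (p (m - 2)) (p (m - 1)))
      (snocSeq p m s) (m + 1) ∧
    ∀ x y, x ≠ t → y ≠ t → G.Adj x y →
      (SteinerExtremal.bypass G {p (m - 2), t, p (m - 1)} (p (m - 2)) (p (m - 1))).Adj x y := by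
  have h0 : p (m - 2) ≠ t := D.ne_t _ (by omega)
  have h1 : t ≠ p (m - 1) := (D.ne_t _ (by omega)).symm
  have h01 : p (m - 2) ≠ p (m - 1) := fun h => by
    have := D.inj _ _ (by omega) (by omega) h
    omega
  have key : ∀ x y, x ≠ t → y ≠ t → G.Adj x y →
      (SteinerExtremal.bypass G {p (m - 2), t, p (m - 1)} (p (m - 2)) (p (m - 1))).Adj x y := by
    intro x y hx hy h
    rw [bypass_path_adj h0 h1 h01]
    exact Or.inr (Or.inr ⟨h, hx, hy⟩)
  refine ⟨⟨?_, ?_, ?_⟩, key⟩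
  · intro i j hi hj h
    unfold snocSeq at h
    split_ifs at h with h1 h2 h2
    · exact D.inj i j h1 h2 h
    · exact absurd h (D.ne_s i h1)
    · exact absurd h.symm (D.ne_s j h2)
    · omega
  · intro i hi1 hi
    rcases Nat.lt_or_ge (i + 2) m with h | h
    · rw [snocSeq_lt (by omega), snocSeq_lt (by omega)]
      exact key _ _ (D.ne_t _ (by omega)) (D.ne_t _ (by omega)) (D.step1 i hi1 h)
    · rcases Nat.lt_or_ge (i + 1) m with h' | h'
      · rw [snocSeq_lt (by omega), snocSeq_lt (by omega), bypass_path_adj h0 h1 h01]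
        left
        obtain rfl : i = m - 2 := by omega
        exact ⟨rfl, by congr 1; omega⟩
      · obtain rfl : m = i + 1 := by omega
        rw [snocSeq_lt (by omega), snocSeq_self]
        exact key _ _ (D.ne_t _ (by omega)) D.ne D.s0.symm
  · intro i hi
    rcases Nat.lt_or_ge (i + 2) m with h | h
    · rw [snocSeq_lt (by omega), snocSeq_lt (by omega)]
      exact key _ _ (D.ne_t _ (by omega)) (D.ne_t _ (by omega)) (D.step2 i h)
    · obtain rfl : m = i + 2 := by omega
      rw [snocSeq_lt (by omega), snocSeq_self]
      exact key _ _ (D.ne_t _ (by omega)) D.ne D.s1.symm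

/-- `G` contains the strip on `p 0, …, p (m - 1)` with its first and last edges replaced by
diamonds. -/
structure DoubleLadder (G : SimpleGraph V) (p : ℕ → V) (s t s' t' : V) (m : ℕ) : Prop where
  tail : TailLadder G p s' t' m
  ne_s : ∀ i, i < m → p i ≠ s
  ne_t : ∀ i, i < m → p i ≠ t
  nodup : [s, t, s', t'].Nodup
  st : G.Adj s t
  s0 : G.Adj s (p 0)
  s1 : G.Adj s (p 1)
  t0 : G.Adj t (p 0)
  t1 : G.Adj t (p 1)

/-- Using `t'` as a path between the tips of the last diamond leaves a strip with one diamond. -/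
lemma DoubleLadder.bypass {G : SimpleGraph V} {p : ℕ → V} {s t s' t' : V} {m : ℕ}
    (D : DoubleLadder G p s t s' t' m) (hm : 3 ≤ m) :
    DiamondLadder (bypass G {p (m - 2), t', p (m - 1)} (p (m - 2)) (p (m - 1)))
      (snocSeq p m s') s t (m + 1) ∧
    ∀ x y, x ≠ t' → y ≠ t' → G.Adj x y →
      (SteinerExtremal.bypass G {p (m - 2), t', p (m - 1)} (p (m - 2)) (p (m - 1))).Adj x y := by
  obtain ⟨L, key⟩ := D.tail.bypass hm
  have hn := D.nodup
  simp only [List.nodup_cons, List.mem_cons, List.not_mem_nil, or_false, not_or,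
          List.nodup_nil, and_true, not_false_eq_true] at hn
  obtain ⟨⟨n1, n2, n3⟩, ⟨n4, n5⟩, n6⟩ := hn
  have l0 : snocSeq p m s' 0 = p 0 := snocSeq_lt (by omega)
  have l1 : snocSeq p m s' 1 = p 1 := snocSeq_lt (by omega)
  have nt' := D.tail.ne_t
  refine ⟨⟨L, ?_, ?_, key _ _ n3 n5 D.st, ?_, ?_, ?_, ?_⟩, key⟩
  · intro i hi
    unfold snocSeq
    split_ifs with h
    · exact D.ne_s i h
    · exact Ne.symm n2
  · intro i hi
    unfold snocSeq
    split_ifs with h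
    · exact D.ne_t i h
    · exact Ne.symm n4
  · rw [l0]; exact key _ _ n3 (nt' _ (by omega)) D.s0
  · rw [l1]; exact key _ _ n3 (nt' _ (by omega)) D.s1
  · rw [l0]; exact key _ _ n5 (nt' _ (by omega)) D.t0
  · rw [l1]; exact key _ _ n5 (nt' _ (by omega)) D.t1

lemma DoubleLadder.bypass_bad {G : SimpleGraph V} {p : ℕ → V} {s t s' t' : V} {m : ℕ}
    (D : DoubleLadder G p s t s' t' m)
    (h : Bad (SteinerExtremal.bypass G {p (m - 2), t', p (m - 1)} (p (m - 2)) (p (m - 1)))) :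
    Bad G := Bad.of_bypass_path D.tail.t1.symm D.tail.t0 h

lemma DoubleLadder.bad_of_ear {G : SimpleGraph V} {p : ℕ → V} {s t s' t' : V} {m : ℕ}
    (D : DoubleLadder G p s t s' t' m) (hm : 3 ≤ m) {v : V} (hv : ∀ i, i < m → p i ≠ v)
    (hvs : v ≠ s) (hvt : v ≠ t) (hvs' : v ≠ s') (hvt' : v ≠ t') {i j : ℕ} (hij : i < j)
    (hj : j < m) (hji : j ≤ i + 2) (hi : G.Adj (p i) v) (hjv : G.Adj (p j) v) : Bad G := by
  obtain ⟨L, key⟩ := D.bypass hm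
  refine D.bypass_bad (L.bad_of_ear (v := v) (i := i) (j := j) (by omega) ?_ hvs hvt hij (by omega)
    hji (by omega) ?_ ?_)
  · intro i hi
    unfold snocSeq
    split_ifs with h
    · exact hv i h
    · exact hvs'.symm
  · rw [snocSeq_lt (by omega)]
    exact key _ _ (D.tail.ne_t _ (by omega)) hvt' hi
  · rw [snocSeq_lt (by omega)]
    exact key _ _ (D.tail.ne_t _ (by omega)) hvt' hjv

lemma DoubleLadder.bad_of_diamond_ear {G : SimpleGraph V} {p : ℕ → V} {s t s' t' : V} {m : ℕ}
    (D : DoubleLadder G p s t s' t' m) (hm : 3 ≤ m) {v : V} (hv : ∀ i, i < m → p i ≠ v)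
    (hvs : v ≠ s) (hvt : v ≠ t) (hvs' : v ≠ s') (hvt' : v ≠ t') (h1 : G.Adj s v)
    (h2 : G.Adj t v ∨ G.Adj (p 0) v ∨ G.Adj (p 1) v) : Bad G := by
  obtain ⟨L, key⟩ := D.bypass hm
  have hn := D.nodup
  simp only [List.nodup_cons, List.mem_cons, List.not_mem_nil, or_false, not_or,
          List.nodup_nil, and_true, not_false_eq_true] at hn
  refine D.bypass_bad (L.bad_of_diamond_ear (v := v) (by omega) ?_ hvs hvt
    (key _ _ hn.1.2.2 hvt' h1) ?_)
  · intro i hi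
    unfold snocSeq
    split_ifs with h
    · exact hv i h
    · exact hvs'.symm
  · rw [snocSeq_lt (by omega), snocSeq_lt (by omega)]
    rcases h2 with h2 | h2 | h2
    · exact Or.inl (key _ _ hn.2.1.2 hvt' h2)
    · exact Or.inr (Or.inl (key _ _ (D.tail.ne_t _ (by omega)) hvt' h2))
    · exact Or.inr (Or.inr (key _ _ (D.tail.ne_t _ (by omega)) hvt' h2))

lemma DoubleLadder.bad_of_K4At {G : SimpleGraph V} {p : ℕ → V} {s t s' t' : V} {m : ℕ}
    (D : DoubleLadder G p s t s' t' m) (hm : 3 ≤ m) {P : V → Prop} (hP : ∀ i, i < m → P (p i))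
    (hs : P s) (ht : P t) (hs' : P s') (ht' : P t') {i : ℕ} (hi : i < m) {q₁ q₂ q₃ : V}
    (K : K4At G P (p i) q₁ q₂ q₃) : Bad G := by
  obtain ⟨L, key⟩ := D.bypass hm
  have h1 : q₁ ≠ t' := fun h => K.not1 (h ▸ ht')
  have h2 : q₂ ≠ t' := fun h => K.not2 (h ▸ ht')
  have h3 : q₃ ≠ t' := fun h => K.not3 (h ▸ ht')
  have h0 := D.tail.ne_t i hi
  refine D.bypass_bad (L.bad_of_K4At (P := P) (i := i) (by omega) ?_ hs ht (by omega) (q₁ := q₁)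
    (q₂ := q₂) (q₃ := q₃) ?_)
  · intro i hi
    unfold snocSeq
    split_ifs with h
    · exact hP i h
    · exact hs'
  · rw [snocSeq_lt (by omega)]
    exact ⟨K.nodup, K.not1, K.not2, K.not3, key _ _ h0 h1 K.u1, key _ _ h0 h2 K.u2,
      key _ _ h0 h3 K.u3, key _ _ h1 h2 K.a12, key _ _ h1 h3 K.a13⟩

lemma StripOn.ladder {B G : SimpleGraph V} {X : Finset V} {p : ℕ → V} {r : ℕ}
    (h : StripOn B X p r) (hBG : B ≤ G) : Ladder G p r where
  inj := h.inj
  step1 i _ hi := hBG ((h.adj _ _ (by omega) (by omega)).2 (by omega))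
  step2 i hi := hBG ((h.adj _ _ (by omega) (by omega)).2 (by omega))

lemma StripOn.first {B G : SimpleGraph V} {X : Finset V} {p : ℕ → V} {r : ℕ}
    (h : StripOn B X p r) (hBG : B ≤ G) (hr : 2 ≤ r) : G.Adj (p 0) (p 1) :=
  hBG ((h.adj _ _ (by omega) (by omega)).2 (by omega))

lemma OneOn.diamondLadder {B G : SimpleGraph V} {X : Finset V} {p : ℕ → V} {s t : V} {m : ℕ}
    (h : OneOn B X p s t m) (hBG : B ≤ G) (hm : 3 ≤ m) : DiamondLadder G p s t m where
  inj := h.inj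
  step1 i _ hi := hBG ((h.adj _ _ (by omega) (by omega)).2 (by omega))
  step2 i hi := hBG ((h.adj _ _ (by omega) (by omega)).2 (by omega))
  ne_s := h.ne_s
  ne_t := h.ne_t
  st := hBG h.st
  s0 := hBG ((h.sp 0 (by omega)).2 (by omega))
  s1 := hBG ((h.sp 1 (by omega)).2 (by omega))
  t0 := hBG ((h.tp 0 (by omega)).2 (by omega))
  t1 := hBG ((h.tp 1 (by omega)).2 (by omega))

lemma TwoOn.doubleLadder {B G : SimpleGraph V} {X : Finset V} {p : ℕ → V} {s t s' t' : V} {m : ℕ}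
    (h : TwoOn B X p s t s' t' m) (hBG : B ≤ G) (hm : 3 ≤ m) :
    DoubleLadder G p s t s' t' m where
  tail :=
    { inj := h.inj
      step1 := fun i _ hi => hBG ((h.adj _ _ (by omega) (by omega)).2 (by omega))
      step2 := fun i hi => hBG ((h.adj _ _ (by omega) (by omega)).2 (by omega))
      ne_s := h.ne_s'
      ne_t := h.ne_t'
      ne := h.st'.ne
      s0 := hBG ((h.sp' _ (by omega)).2 (by omega))
      s1 := hBG ((h.sp' _ (by omega)).2 (by omega))
      t0 := hBG ((h.tp' _ (by omega)).2 (by omega))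
      t1 := hBG ((h.tp' _ (by omega)).2 (by omega)) }
  ne_s := h.ne_s
  ne_t := h.ne_t
  nodup := h.nodup
  st := hBG h.st
  s0 := hBG ((h.sp 0 (by omega)).2 (by omega))
  s1 := hBG ((h.sp 1 (by omega)).2 (by omega))
  t0 := hBG ((h.tp 0 (by omega)).2 (by omega))
  t1 := hBG ((h.tp 1 (by omega)).2 (by omega))

lemma PrismOn.eq_iff {G : SimpleGraph V} {X : Finset V} {f : Fin 3 → Fin 2 → V}
    (h : PrismOn G X f) (i j : Fin 3) (e d : Fin 2) : f i e = f j d ↔ i = j ∧ e = d :=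
  ⟨h.inj i j e d, by rintro ⟨rfl, rfl⟩; rfl⟩

lemma fin3_third (i j : Fin 3) (h : i ≠ j) :
    ∃ l, l ≠ i ∧ l ≠ j ∧ ∀ x, x = i ∨ x = j ∨ x = l := by
  revert h; revert i j; decide

lemma fin3_others (i : Fin 3) :
    ∃ j l, j ≠ i ∧ l ≠ i ∧ l ≠ j ∧ ∀ x, x = i ∨ x = j ∨ x = l := by
  revert i; decide

lemma fin2_other (e : Fin 2) : ∃ d, d ≠ e ∧ ∀ x, x = e ∨ x = d := by
  revert e; decide

/-! ### Where a `K₄` can be attached -/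

lemma ncard_neighborSet_le_two {G : SimpleGraph V} {u : V} (x y : V)
    (h : ∀ z, G.Adj u z → z = x ∨ z = y) : (G.neighborSet u).ncard ≤ 2 := by
  have h1 : G.neighborSet u ⊆ ({x, y} : Set V) := fun z hz => by
    simpa using h z hz
  refine (Set.ncard_le_ncard h1 (Set.toFinite _)).trans ((Set.ncard_insert_le _ _).trans ?_)
  rw [Set.ncard_singleton]

lemma exists_adj_ne_of_two_lt {G : SimpleGraph V} {u : V} (h : 2 < (G.neighborSet u).ncard)
    (x y : V) : ∃ z, G.Adj u z ∧ z ≠ x ∧ z ≠ y := by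
  by_contra! hc
  refine absurd (ncard_neighborSet_le_two x y fun z hz => ?_) (not_le.2 h)
  by_cases hx : z = x
  · exact Or.inl hx
  · exact Or.inr (hc z hz hx)

lemma StripOn.adj_zero {B : SimpleGraph V} {X : Finset V} {p : ℕ → V} {r : ℕ}
    (h : StripOn B X p r) (hX : EdgesIn B X) (hr : 2 ≤ r) (z : V) (hz : B.Adj (p 0) z) :
    z = p 1 ∨ z = p 2 := by
  obtain ⟨j, hj, rfl⟩ := (h.mem z).1 (hX _ _ hz.symm)
  have := (h.adj _ _ (by omega) hj).1 hz
  obtain rfl | rfl : j = 1 ∨ j = 2 := by omega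
  · exact Or.inl rfl
  · exact Or.inr rfl

lemma StripOn.adj_last {B : SimpleGraph V} {X : Finset V} {p : ℕ → V} {r : ℕ}
    (h : StripOn B X p r) (hX : EdgesIn B X) (hr : 2 ≤ r) (z : V) (hz : B.Adj (p (r - 1)) z) :
    z = p (r - 2) ∨ z = p (r - 3) := by
  obtain ⟨j, hj, rfl⟩ := (h.mem z).1 (hX _ _ hz.symm)
  have := (h.adj _ _ (by omega) hj).1 hz
  obtain rfl | rfl : j = r - 2 ∨ j = r - 3 := by omega
  · exact Or.inl rfl
  · exact Or.inr rfl

lemma OneOn.adj_last {B : SimpleGraph V} {X : Finset V} {p : ℕ → V} {s t : V} {m : ℕ}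
    (h : OneOn B X p s t m) (hX : EdgesIn B X) (hm : 3 ≤ m) (z : V)
    (hz : B.Adj (p (m - 1)) z) : z = p (m - 2) ∨ z = p (m - 3) := by
  rcases (h.mem z).1 (hX _ _ hz.symm) with ⟨j, hj, rfl⟩ | rfl | rfl
  · have := (h.adj _ _ (by omega) hj).1 hz
    obtain rfl | rfl : j = m - 2 ∨ j = m - 3 := by omega
    · exact Or.inl rfl
    · exact Or.inr rfl
  · have := (h.sp _ (by omega)).1 hz.symm
    omega
  · have := (h.tp _ (by omega)).1 hz.symm
    omega

lemma BookOn.adj_page {B : SimpleGraph V} {X : Finset V} {g k : V}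
    (h : BookOn B X g k) (hX : EdgesIn B X) {u : V} (hg : u ≠ g) (hk : u ≠ k) (z : V)
    (hz : B.Adj u z) : z = g ∨ z = k := by
  have := (h.adj u z (hX _ _ hz) (hX _ _ hz.symm)).1 hz
  tauto

lemma BookOn.symm {B : SimpleGraph V} {X : Finset V} {g k : V} (h : BookOn B X g k) :
    BookOn B X k g where
  ne := h.ne.symm
  hg := h.hk
  hk := h.hg
  adj x y hx hy := by rw [h.adj x y hx hy]; tauto

lemma BookOn.exists_pages [DecidableEq V] {B : SimpleGraph V} {X : Finset V} {g k : V}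
    (h : BookOn B X g k) (hX : 4 ≤ X.card) :
    ∃ x y, x ∈ X ∧ y ∈ X ∧ x ≠ y ∧ x ≠ g ∧ x ≠ k ∧ y ≠ g ∧ y ≠ k := by
  have h1 : 1 < ((X.erase g).erase k).card := by
    rw [Finset.card_erase_of_mem (by simp [h.ne.symm, h.hk]), Finset.card_erase_of_mem h.hg]
    omega
  obtain ⟨x, hx, y, hy, hxy⟩ := Finset.one_lt_card.1 h1
  simp only [Finset.mem_erase] at hx hy
  exact ⟨x, y, hx.2.2, hy.2.2, hxy, hx.2.1, hx.1, hy.2.1, hy.1⟩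

/-- From a vertex of degree at least `3` of a base graph three disjoint paths lead to some other
vertex, so a `K₄` cannot be attached there. -/
lemma Base.ncard_neighborSet_le_two [DecidableEq V] {B G : SimpleGraph V} {X : Finset V}
    (hB : Base X B) (hX : EdgesIn B X) (hBG : B ≤ G) (hG : ¬ Bad G) {u q₁ q₂ q₃ : V} (hu : u ∈ X)
    (K : K4At G (· ∈ X) u q₁ q₂ q₃) : (B.neighborSet u).ncard ≤ 2 := by
  cases hB with
  | strip p r hr h =>
    obtain ⟨i, hi, rfl⟩ := (h.mem u).1 hu
    rcases Nat.eq_zero_or_pos i with rfl | hi0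
    · exact SteinerExtremal.ncard_neighborSet_le_two _ _ (h.adj_zero hX hr)
    by_cases hil : i = r - 1
    · subst hil
      exact SteinerExtremal.ncard_neighborSet_le_two _ _ (h.adj_last hX hr)
    by_cases hr4 : 4 ≤ r
    · exact absurd ((h.ladder hBG).bad_of_K4At (h.first hBG hr) hr4
        (fun i hi => (h.mem _).2 ⟨i, hi, rfl⟩) hi0 (by omega) K) hG
    · obtain rfl : r = 3 := by omega
      obtain rfl : i = 1 := by omega
      refine SteinerExtremal.ncard_neighborSet_le_two (p 0) (p 2) fun z hz => ?_
      obtain ⟨j, hj, rfl⟩ := (h.mem z).1 (hX _ _ hz.symm)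
      have := (h.adj _ _ (by omega) hj).1 hz
      obtain rfl | rfl : j = 0 ∨ j = 2 := by omega
      · exact Or.inl rfl
      · exact Or.inr rfl
  | book g k hc h =>
    obtain ⟨x, y, hx, hy, hxy, hxg, hxk, hyg, hyk⟩ := h.exists_pages (by omega)
    by_cases hg : u = g
    · subst hg
      refine absurd (K.bad_of_hub hu h.hk hx hy hxy ?_ ?_ ?_ ?_ ?_) hG <;> apply hBG
      · exact (h.adj _ _ h.hg h.hk).2 ⟨h.ne, by simp⟩
      · exact (h.adj _ _ h.hg hx).2 ⟨hxg.symm, by simp⟩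
      · exact (h.adj _ _ h.hg hy).2 ⟨hyg.symm, by simp⟩
      · exact (h.adj _ _ h.hk hx).2 ⟨hxk.symm, by simp⟩
      · exact (h.adj _ _ h.hk hy).2 ⟨hyk.symm, by simp⟩
    by_cases hk : u = k
    · subst hk
      refine absurd (K.bad_of_hub hu h.hg hx hy hxy ?_ ?_ ?_ ?_ ?_) hG <;> apply hBG
      · exact (h.adj _ _ h.hk h.hg).2 ⟨h.ne.symm, by simp⟩
      · exact (h.adj _ _ h.hk hx).2 ⟨hxk.symm, by simp⟩
      · exact (h.adj _ _ h.hk hy).2 ⟨hyk.symm, by simp⟩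
      · exact (h.adj _ _ h.hg hx).2 ⟨hxg.symm, by simp⟩
      · exact (h.adj _ _ h.hg hy).2 ⟨hyg.symm, by simp⟩
    exact SteinerExtremal.ncard_neighborSet_le_two _ _ (h.adj_page hX hg hk)
  | one p s t m hm h =>
    have D := h.diamondLadder hBG hm
    have hp : ∀ i, i < m → p i ∈ X := fun i hi => (h.mem _).2 (Or.inl ⟨i, hi, rfl⟩)
    have hs : s ∈ X := (h.mem _).2 (by simp)
    have ht : t ∈ X := (h.mem _).2 (by simp)
    have h01 : p 0 ≠ p 1 := fun h' => by
      have := h.inj _ _ (by omega) (by omega) h'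
      omega
    rcases (h.mem u).1 hu with ⟨i, hi, rfl⟩ | rfl | rfl
    · by_cases hil : i = m - 1
      · subst hil
        exact SteinerExtremal.ncard_neighborSet_le_two _ _ (h.adj_last hX hm)
      · exact absurd (D.bad_of_K4At hm hp hs ht (by omega) K) hG
    · exact absurd (K.bad_of_hub hs ht (hp 0 (by omega)) (hp 1 (by omega)) h01 D.st D.s0 D.s1 D.t0
        D.t1) hG
    · exact absurd (K.bad_of_hub ht hs (hp 0 (by omega)) (hp 1 (by omega)) h01 D.st.symm D.t0 D.t1
        D.s0 D.s1) hG
  | two p s t s' t' m hm h =>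
    have D := h.doubleLadder hBG hm
    have D' := (h.rev hm).doubleLadder hBG hm
    have hp : ∀ i, i < m → p i ∈ X := fun i hi => (h.mem _).2 (Or.inl ⟨i, hi, rfl⟩)
    have hs : s ∈ X := (h.mem _).2 (by simp)
    have ht : t ∈ X := (h.mem _).2 (by simp)
    have hs' : s' ∈ X := (h.mem _).2 (by simp)
    have ht' : t' ∈ X := (h.mem _).2 (by simp)
    have h01 : p 0 ≠ p 1 := fun h' => by
      have := h.inj _ _ (by omega) (by omega) h'
      omega
    have h01' : p (m - 1 - 0) ≠ p (m - 1 - 1) := fun h' => by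
      have := h.inj _ _ (by omega) (by omega) h'
      omega
    rcases (h.mem u).1 hu with ⟨i, hi, rfl⟩ | rfl | rfl | rfl | rfl
    · exact absurd (D.bad_of_K4At hm hp hs ht hs' ht' hi K) hG
    · exact absurd (K.bad_of_hub hs ht (hp 0 (by omega)) (hp 1 (by omega)) h01 D.st D.s0 D.s1 D.t0
        D.t1) hG
    · exact absurd (K.bad_of_hub ht hs (hp 0 (by omega)) (hp 1 (by omega)) h01 D.st.symm D.t0 D.t1
        D.s0 D.s1) hG
    · exact absurd (K.bad_of_hub hs' ht' (hp _ (by omega)) (hp _ (by omega)) h01' D'.st D'.s0 D'.s1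
        D'.t0 D'.t1) hG
    · exact absurd (K.bad_of_hub ht' hs' (hp _ (by omega)) (hp _ (by omega)) h01' D'.st.symm D'.t0
        D'.t1 D'.s0 D'.s1) hG
  | prism f h =>
    obtain ⟨i, e, rfl⟩ := (h.mem u).1 hu
    obtain ⟨j, l, hji, hli, hlj, -⟩ := fin3_others i
    obtain ⟨d, hde, -⟩ := fin2_other e
    have hm : ∀ i e, f i e ∈ X := fun i e => (h.mem _).2 ⟨i, e, rfl⟩
    have hq : ∀ q, ¬ q ∈ X → ∀ i e, f i e ≠ q := fun q hq i e h' => hq (h' ▸ hm i e)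
    have hq1 := hq _ K.not1
    have hq2 := hq _ K.not2
    have hq3 := hq _ K.not3
    have hn := K.nodup
    refine absurd (bad_of_K4_at_prism (a₀ := f i e) (q₁ := q₁) (b₀ := f i d) (q₂ := q₂) (q₃ := q₃)
      (a₁ := f j e) (a₂ := f l e) (b₁ := f j d) (b₂ := f l d) ?_
      ⟨K.u1, ?_, K.u2, K.a12.symm, ?_, ?_, ?_, K.u3, K.a13.symm, ?_, ?_, ?_⟩) hG
    · simp only [List.nodup_cons, List.mem_cons, List.not_mem_nil, or_false, not_or,
          List.nodup_nil, and_true, not_false_eq_true, h.eq_iff] at hn ⊢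
      simp [hq1, hq2, hq3, fun i e => (hq1 i e).symm, fun i e => (hq2 i e).symm,
        fun i e => (hq3 i e).symm, hn, hlj, hji.symm,
        hli.symm, hlj.symm, hde, hde.symm]
    all_goals
      apply hBG
      rw [h.adj]
      simp [hji, hli, hji.symm, hli.symm, hde.symm]

/-! ### Edges along which a base graph can be extended -/

/-- Renaming the vertices of a strip by an involution that is an automorphism. -/
lemma StripOn.comp {B : SimpleGraph V} {X : Finset V} {p : ℕ → V} {r : ℕ} (h : StripOn B X p r)
    (σ : ℕ → ℕ) (hσ : ∀ i < r, σ i < r ∧ σ (σ i) = i)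
    (hadj : ∀ i < r, ∀ j < r, (σ i ≠ σ j ∧ σ i ≤ σ j + 2 ∧ σ j ≤ σ i + 2 ↔
      i ≠ j ∧ i ≤ j + 2 ∧ j ≤ i + 2)) : StripOn B X (fun i => p (σ i)) r where
  inj i j hi hj hij := by
    have := h.inj _ _ (hσ i hi).1 (hσ j hj).1 hij
    rw [← (hσ i hi).2, this, (hσ j hj).2]
  mem x := by
    rw [h.mem]
    constructor
    · rintro ⟨i, hi, rfl⟩
      exact ⟨σ i, (hσ i hi).1, by rw [(hσ i hi).2]⟩
    · rintro ⟨i, hi, rfl⟩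
      exact ⟨σ i, (hσ i hi).1, rfl⟩
  adj i j hi hj := by
    rw [h.adj _ _ (hσ i hi).1 (hσ j hj).1, hadj i hi j hj]

/-- If only one strip vertex lies beyond the diamond, the tips of the diamond can be exchanged. -/
lemma OneOn.swap_tips {B : SimpleGraph V} {X : Finset V} {p : ℕ → V} {s t : V}
    (h : OneOn B X p s t 3) : OneOn B X (fun i => p (Equiv.swap 0 1 i)) s t 3 := by
  have hσ : ∀ i < 3, Equiv.swap 0 1 i < 3 ∧ Equiv.swap 0 1 (Equiv.swap 0 1 i) = i := by decide
  have h1 : ∀ i < 3, (Equiv.swap 0 1 i ≤ 1 ↔ i ≤ 1) := by decide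
  have hadj : ∀ i < 3, ∀ j < 3, (Equiv.swap 0 1 i ≠ Equiv.swap 0 1 j ∧
      Equiv.swap 0 1 i ≤ Equiv.swap 0 1 j + 2 ∧ Equiv.swap 0 1 j ≤ Equiv.swap 0 1 i + 2 ∧
      Equiv.swap 0 1 i + Equiv.swap 0 1 j ≠ 1 ↔
      i ≠ j ∧ i ≤ j + 2 ∧ j ≤ i + 2 ∧ i + j ≠ 1) := by decide
  constructor
  · intro i j hi hj hij
    have := h.inj _ _ (hσ i hi).1 (hσ j hj).1 hij
    rw [← (hσ i hi).2, this, (hσ j hj).2]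
  · exact fun i hi => h.ne_s _ (hσ i hi).1
  · exact fun i hi => h.ne_t _ (hσ i hi).1
  · intro x
    rw [h.mem]
    have : (∃ i, i < 3 ∧ p i = x) ↔ ∃ i, i < 3 ∧ p (Equiv.swap 0 1 i) = x := by
      constructor
      · rintro ⟨i, hi, rfl⟩
        exact ⟨Equiv.swap 0 1 i, (hσ i hi).1, by rw [(hσ i hi).2]⟩
      · rintro ⟨i, hi, rfl⟩
        exact ⟨Equiv.swap 0 1 i, (hσ i hi).1, rfl⟩
    rw [this]
  · intro i j hi hj
    rw [h.adj _ _ (hσ i hi).1 (hσ j hj).1, hadj i hi j hj]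
  · exact h.st
  · intro i hi
    rw [h.sp _ (hσ i hi).1, h1 i hi]
  · intro i hi
    rw [h.tp _ (hσ i hi).1, h1 i hi]

/-- The edges `xy` of a base graph that admit a second path between their ends: end edges of
strips, the hub edge of a book, the end edge of a strip with one diamond. -/
inductive EarSpot (X : Finset V) (B : SimpleGraph V) (x y : V) : Prop
  | strip (p : ℕ → V) (r : ℕ) (hr : 2 ≤ r) (h : StripOn B X p r)
      (hxy : s(x, y) = s(p (r - 2), p (r - 1))) : EarSpot X B x y
  | book (hX : 4 ≤ X.card) (h : BookOn B X x y) : EarSpot X B x y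
  | one (p : ℕ → V) (s t : V) (m : ℕ) (hm : 3 ≤ m) (h : OneOn B X p s t m)
      (hxy : s(x, y) = s(p (m - 2), p (m - 1))) : EarSpot X B x y

lemma EarSpot.symm {X : Finset V} {B : SimpleGraph V} {x y : V} (h : EarSpot X B x y) :
    EarSpot X B y x := by
  cases h with
  | strip p r hr h hxy => exact .strip p r hr h (Sym2.eq_swap.trans hxy)
  | book hX h => exact .book hX h.symm
  | one p s t m hm h hxy => exact .one p s t m hm h (Sym2.eq_swap.trans hxy)

lemma StripOn.card {B : SimpleGraph V} {X : Finset V} {p : ℕ → V} {r : ℕ} (h : StripOn B X p r) :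
    X.card = r := by
  classical
  have : X = (Finset.range r).image p := by
    ext x
    rw [h.mem]
    simp
  rw [this, Finset.card_image_of_injOn, Finset.card_range]
  intro i hi j hj hij
  exact h.inj i j (by simpa using hi) (by simpa using hj) hij

/-- On at most four vertices the strip has further automorphisms, and on four its middle edge is
the hub edge of a book. These are the cases that `Ladder.bad_of_ear` leaves. -/
lemma StripOn.earSpot {B G : SimpleGraph V} {X : Finset V} {p : ℕ → V} {r : ℕ}
    (h : StripOn B X p r) (hBG : B ≤ G) (hG : ¬ Bad G) {v : V} (hv : v ∉ X) {i j : ℕ}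
    (hij : i < j) (hj : j < r) (hji : j ≤ i + 2) (hi : G.Adj (p i) v) (hjv : G.Adj (p j) v) :
    EarSpot X B (p i) (p j) := by
  by_cases hend : i + 2 = r ∧ j + 1 = r
  · refine .strip p r (by omega) h ?_
    rw [show r - 2 = i by omega, show r - 1 = j by omega]
  by_cases hfirst : i = 0 ∧ j = 1
  · obtain ⟨rfl, rfl⟩ := hfirst
    refine .strip _ r (by omega) h.rev ?_
    rw [show r - 1 - (r - 2) = 1 by omega, show r - 1 - (r - 1) = 0 by omega]
    exact Sym2.eq_swap
  -- an inner edge of a longer strip is excluded by an obstruction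
  by_cases hr : 5 ≤ r
  · exact absurd ((h.ladder hBG).bad_of_ear (h.first hBG (by omega)) hr
      (fun k hk hkv => hv ((h.mem _).2 ⟨k, hk, hkv⟩)) hij hj hji hfirst hend hi hjv) hG
  obtain rfl | rfl : r = 3 ∨ r = 4 := by omega
  · obtain ⟨rfl, rfl⟩ : i = 0 ∧ j = 2 := by omega
    exact .strip _ 3 (by omega) (h.comp (Equiv.swap 0 1) (by decide) (by decide)) rfl
  · have h' := h.comp (Equiv.swap 1 2) (by decide) (by decide)
    obtain ⟨rfl, rfl⟩ | ⟨rfl, rfl⟩ | ⟨rfl, rfl⟩ :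
      (i = 0 ∧ j = 2) ∨ (i = 1 ∧ j = 2) ∨ (i = 1 ∧ j = 3) := by omega
    · exact .strip _ 4 (by omega) h'.rev Sym2.eq_swap
    · refine .book (by rw [h.card]) ⟨?_, ?_, ?_, ?_⟩
      · intro h12
        have := h.inj _ _ (by omega) (by omega) h12
        omega
      · exact (h.mem _).2 ⟨1, by omega, rfl⟩
      · exact (h.mem _).2 ⟨2, by omega, rfl⟩
      · intro x y hx hy
        obtain ⟨a, ha, rfl⟩ := (h.mem x).1 hx
        obtain ⟨b, hb, rfl⟩ := (h.mem y).1 hy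
        have e : ∀ a b, a < 4 → b < 4 → (p a = p b ↔ a = b) := fun a b ha hb =>
          ⟨h.inj a b ha hb, fun h => h ▸ rfl⟩
        rw [h.adj a b ha hb, ne_eq (p a), e a b ha hb, e a 1 ha (by omega), e a 2 ha (by omega),
          e b 1 hb (by omega), e b 2 hb (by omega)]
        omega
    · exact .strip _ 4 (by omega) h' rfl

/-- A second path along an edge from a hub vertex to a page of a book with at least three pages. -/
lemma BookOn.bad_of_spoke_ear [DecidableEq V] {B G : SimpleGraph V} {X : Finset V} {g k z v : V}
    (h : BookOn B X g k) (hX : 5 ≤ X.card) (hBG : B ≤ G) (hz : z ∈ X) (hzg : z ≠ g)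
    (hzk : z ≠ k) (hv : v ∉ X) (h1 : G.Adj k v) (h2 : G.Adj z v) : Bad G := by
  have hc : 1 < (((X.erase g).erase k).erase z).card := by
    rw [Finset.card_erase_of_mem (by simp [hzg, hzk, hz]),
      Finset.card_erase_of_mem (by simp [h.ne.symm, h.hk]), Finset.card_erase_of_mem h.hg]
    omega
  obtain ⟨x, hx, y, hy, hxy⟩ := Finset.one_lt_card.1 hc
  simp only [Finset.mem_erase] at hx hy
  obtain ⟨hxz, hxk, hxg, hx⟩ := hx
  obtain ⟨hyz, hyk, hyg, hy⟩ := hy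
  have hg := h.hg
  have hk := h.hk
  have hgk := h.ne
  have ag : ∀ w ∈ X, w ≠ g → G.Adj g w := fun w hw hwg =>
    hBG ((h.adj g w h.hg hw).2 ⟨hwg.symm, by simp⟩)
  have ak : ∀ w ∈ X, w ≠ k → G.Adj k w := fun w hw hwk =>
    hBG ((h.adj k w h.hk hw).2 ⟨hwk.symm, by simp⟩)
  have hne : ∀ w ∈ X, w ≠ v := fun w hw h => hv (h ▸ hw)
  refine bad_of_book_spoke (g := g) (k := k) (z := z) (x := x) (y := y) (w := v) ?_
    ⟨ag y hy hyg, (ak y hy hyk).symm, ak z hz hzk, ag x hx hxg, (ak x hx hxk).symm, h1, h2.symm,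
      ag k h.hk h.ne.symm, ag z hz hzg⟩
  have n1 := hne g hg
  have n2 := hne k hk
  have n3 := hne z hz
  have n4 := hne x hx
  have n5 := hne y hy
  simp [hgk, hzg.symm, hxg.symm, hyg.symm, hzk.symm, hxk.symm, hyk.symm, hxz.symm, hyz.symm, hxy,
    n1, n2, n3, n4, n5]

lemma OneOn.earSpot {B G : SimpleGraph V} {X : Finset V} {p : ℕ → V} {s t : V} {m : ℕ}
    (h : OneOn B X p s t m) (hm : 3 ≤ m) (hBG : B ≤ G) (hG : ¬ Bad G) {v : V} (hv : v ∉ X)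
    {i j : ℕ} (hij : i < j) (hj : j < m) (hji : j ≤ i + 2) (hadj : B.Adj (p i) (p j))
    (hi : G.Adj (p i) v) (hjv : G.Adj (p j) v) : EarSpot X B (p i) (p j) := by
  have hfirst := (h.adj i j (by omega) hj).1 hadj
  by_cases hend : i + 2 = m ∧ j + 1 = m
  · refine .one p s t m hm h ?_
    rw [show m - 2 = i by omega, show m - 1 = j by omega]
  by_cases hm4 : 4 ≤ m
  · exact absurd ((h.diamondLadder hBG hm).bad_of_ear hm4
      (fun k hk hkv => hv ((h.mem _).2 (Or.inl ⟨k, hk, hkv⟩)))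
      (fun h' => hv ((h.mem _).2 (by simp [h']))) (fun h' => hv ((h.mem _).2 (by simp [h'])))
      hij hj hji hend hi hjv) hG
  · obtain rfl : m = 3 := by omega
    obtain ⟨rfl, rfl⟩ : i = 0 ∧ j = 2 := by omega
    exact .one _ s t 3 (by omega) h.swap_tips rfl

lemma PrismOn.bad_of_ear {B G : SimpleGraph V} {X : Finset V} {f : Fin 3 → Fin 2 → V}
    (h : PrismOn B X f) (hBG : B ≤ G) {v : V} (hv : v ∉ X) {x y : V} (hx : x ∈ X) (hy : y ∈ X)
    (hxy : B.Adj x y) (hxv : G.Adj x v) (hyv : G.Adj y v) : Bad G := by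
  obtain ⟨i, e, rfl⟩ := (h.mem x).1 hx
  obtain ⟨j, d, rfl⟩ := (h.mem y).1 hy
  have hq : ∀ i e, f i e ≠ v := fun i e h' => hv (h' ▸ (h.mem _).2 ⟨i, e, rfl⟩)
  rcases (h.adj _ _ _ _).1 hxy with ⟨hij, rfl⟩ | ⟨rfl, hed⟩
  · obtain ⟨l, hli, hlj, -⟩ := fin3_third i j hij
    obtain ⟨d, hde, -⟩ := fin2_other e
    refine bad_of_prism_triangle_ear (a₀ := f i e) (a₁ := f j e) (a₂ := f l e) (b₀ := f i d)
      (b₁ := f j d) (b₂ := f l d) (v := v) ?_ ⟨hxv, hyv.symm, ?_, ?_, ?_, ?_, ?_, ?_, ?_, ?_⟩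
    · simp [h.eq_iff, hq, hij, hli.symm, hlj.symm, hde.symm]
    all_goals
      apply hBG
      rw [h.adj]
      simp [hij, hli.symm, hlj.symm, hde, hde.symm]
  · obtain ⟨j, l, hji, hli, hlj, -⟩ := fin3_others i
    refine bad_of_prism_rung_ear (a₀ := f i e) (b₀ := f i d) (a₁ := f j e) (a₂ := f l e)
      (b₁ := f j d) (b₂ := f l d) (v := v) ?_ ⟨?_, ?_, hxv, hyv.symm, ?_, ?_, ?_, ?_, ?_, ?_⟩
    · simp [h.eq_iff, hq, hji.symm, hli.symm, hlj.symm, hed]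
    all_goals
      apply hBG
      rw [h.adj]
      simp [hji.symm, hli, hli.symm, hlj, hed, hed.symm]

/-- If a second path along the edge `xy` of a base graph does not create three disjoint
connectors, then `xy` is one of the edges listed in `EarSpot`. -/
lemma Base.earSpot [DecidableEq V] {B G : SimpleGraph V} {X : Finset V} (hB : Base X B)
    (hX : EdgesIn B X) (hBG : B ≤ G) (hG : ¬ Bad G) {v : V} (hv : v ∉ X) {x y : V}
    (hxy : B.Adj x y) (hxv : G.Adj x v) (hyv : G.Adj y v) : EarSpot X B x y := by
  have hx := hX _ _ hxy
  have hy := hX _ _ hxy.symm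
  have hne : ∀ w ∈ X, v ≠ w := fun w hw h => hv (h ▸ hw)
  cases hB with
  | strip p r hr h =>
    obtain ⟨i, hi, rfl⟩ := (h.mem x).1 hx
    obtain ⟨j, hj, rfl⟩ := (h.mem y).1 hy
    have hij := (h.adj i j hi hj).1 hxy
    rcases Nat.lt_or_gt_of_ne hij.1 with hlt | hlt
    · exact h.earSpot hBG hG hv hlt hj (by omega) hxv hyv
    · exact (h.earSpot hBG hG hv hlt hi (by omega) hyv hxv).symm
  | book g k hc h =>
    have hpage : ∀ g k z, BookOn B X g k → z ∈ X → z ≠ g → z ≠ k → G.Adj k v → G.Adj z v →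
        EarSpot X B x y := fun g k z h hz hzg hzk h1 h2 =>
      absurd (h.bad_of_spoke_ear hc hBG hz hzg hzk hv h1 h2) hG
    by_cases hxg : x = g
    · subst hxg
      by_cases hyk : y = k
      · subst hyk; exact .book (by omega) h
      · exact hpage k x y h.symm hy hyk hxy.ne' hxv hyv
    by_cases hxk : x = k
    · subst hxk
      by_cases hyg : y = g
      · subst hyg; exact .book (by omega) h.symm
      · exact hpage g x y h hy hyg hxy.ne' hxv hyv
    rcases h.adj_page hX hxg hxk y hxy with rfl | rfl
    · exact hpage k y x h.symm hx hxk hxg hyv hxv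
    · exact hpage g y x h hx hxg hxk hyv hxv
  | one p s t m hm h =>
    have hp : ∀ i, i < m → p i ≠ v := fun i hi => (hne _ ((h.mem _).2 (Or.inl ⟨i, hi, rfl⟩))).symm
    have hs : v ≠ s := hne _ ((h.mem _).2 (by simp))
    have ht : v ≠ t := hne _ ((h.mem _).2 (by simp))
    have hdia : ∀ s t, OneOn B X p s t m → v ≠ s → v ≠ t → ∀ z, B.Adj s z → G.Adj s v →
        G.Adj z v → Bad G := by
      intro s t h hs ht z hz hsv hzv
      refine (h.diamondLadder hBG hm).bad_of_diamond_ear hm hp hs ht hsv ?_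
      rcases (h.mem z).1 (hX _ _ hz.symm) with ⟨i, hi, rfl⟩ | rfl | rfl
      · obtain rfl | rfl : i = 0 ∨ i = 1 := by
          have := (h.sp i hi).1 hz
          omega
        · exact Or.inr (Or.inl hzv)
        · exact Or.inr (Or.inr hzv)
      · exact absurd rfl hz.ne
      · exact Or.inl hzv
    by_cases hxs : x = s
    · subst hxs; exact absurd (hdia x t h hs ht y hxy hxv hyv) hG
    by_cases hxt : x = t
    · subst hxt; exact absurd (hdia x s h.swap ht hs y hxy hxv hyv) hG
    by_cases hys : y = s
    · subst hys; exact absurd (hdia y t h hs ht x hxy.symm hyv hxv) hG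
    by_cases hyt : y = t
    · subst hyt; exact absurd (hdia y s h.swap ht hs x hxy.symm hyv hxv) hG
    obtain ⟨i, hi, rfl⟩ : ∃ i, i < m ∧ p i = x := by
      have := (h.mem x).1 hx
      tauto
    obtain ⟨j, hj, rfl⟩ : ∃ i, i < m ∧ p i = y := by
      have := (h.mem y).1 hy
      tauto
    have hij := (h.adj i j hi hj).1 hxy
    rcases Nat.lt_or_gt_of_ne hij.1 with hlt | hlt
    · exact h.earSpot hm hBG hG hv hlt hj (by omega) hxy hxv hyv
    · exact (h.earSpot hm hBG hG hv hlt hi (by omega) hxy.symm hyv hxv).symm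
  | two p s t s' t' m hm h =>
    exfalso
    apply hG
    have hdia : ∀ p s t s' t', TwoOn B X p s t s' t' m → ∀ z, B.Adj s z → G.Adj s v →
        G.Adj z v → Bad G := by
      intro p s t s' t' h z hz hsv hzv
      refine (h.doubleLadder hBG hm).bad_of_diamond_ear hm
        (fun i hi => (hne _ ((h.mem _).2 (Or.inl ⟨i, hi, rfl⟩))).symm) (hne _ ((h.mem _).2 (by simp)))
        (hne _ ((h.mem _).2 (by simp))) (hne _ ((h.mem _).2 (by simp)))
        (hne _ ((h.mem _).2 (by simp))) hsv ?_
      rcases (h.mem z).1 (hX _ _ hz.symm) with ⟨i, hi, rfl⟩ | rfl | rfl | rfl | rfl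
      · obtain rfl | rfl : i = 0 ∨ i = 1 := by
          have := (h.sp i hi).1 hz
          omega
        · exact Or.inr (Or.inl hzv)
        · exact Or.inr (Or.inr hzv)
      · exact absurd rfl hz.ne
      · exact Or.inl hzv
      · exact absurd hz h.ss'
      · exact absurd hz h.st''
    have hall : ∀ x y, B.Adj x y → G.Adj x v → G.Adj y v → x = s ∨ x = t ∨ x = s' ∨ x = t' →
        Bad G := by
      rintro x y hxy hxv hyv (rfl | rfl | rfl | rfl)
      · exact hdia _ _ _ _ _ h y hxy hxv hyv
      · exact hdia _ _ _ _ _ h.swap y hxy hxv hyv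
      · exact hdia _ _ _ _ _ (h.rev hm) y hxy hxv hyv
      · exact hdia _ _ _ _ _ (h.rev hm).swap y hxy hxv hyv
    rcases (h.mem x).1 hx with ⟨i, hi, rfl⟩ | hx'
    · rcases (h.mem y).1 hy with ⟨j, hj, rfl⟩ | hy'
      · have hij := (h.adj i j hi hj).1 hxy
        have D := h.doubleLadder hBG hm
        have hp : ∀ i, i < m → p i ≠ v := fun i hi =>
          (hne _ ((h.mem _).2 (Or.inl ⟨i, hi, rfl⟩))).symm
        have hw : ∀ w, w = s ∨ w = t ∨ w = s' ∨ w = t' → v ≠ w := fun w hw =>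
          hne _ ((h.mem _).2 (Or.inr hw))
        have hear := fun i j => D.bad_of_ear hm hp (hw s (by simp)) (hw t (by simp))
          (hw s' (by simp)) (hw t' (by simp)) (i := i) (j := j)
        rcases Nat.lt_or_gt_of_ne hij.1 with hlt | hlt
        · exact hear i j hlt hj (by omega) hxv hyv
        · exact hear j i hlt hi (by omega) hyv hxv
      · exact hall _ _ hxy.symm hyv hxv hy'
    · exact hall _ _ hxy hxv hyv hx'
  | prism f h => exact absurd (h.bad_of_ear hBG hv hx hy hxy hxv hyv) hG

/-! ### Extending a base graph by a triangle or a diamond -/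

lemma adj_iff_of_sym2 {P : V → Prop} {x y a b : V} (h : ∀ z, P z ↔ z = x ∨ z = y)
    (hxy : s(x, y) = s(a, b)) (z : V) : P z ↔ z = a ∨ z = b := by
  rw [h]
  rcases Sym2.eq_iff.1 hxy with ⟨rfl, rfl⟩ | ⟨rfl, rfl⟩
  · rfl
  · exact or_comm

/-- A new vertex joined to the ends of an admissible edge gives a base graph again. -/
lemma EarSpot.base_insert [DecidableEq V] {B G : SimpleGraph V} {X : Finset V} {x y v : V}
    (hE : EarSpot X B x y) (hv : v ∉ X)
    (hB : ∀ z w, z ≠ v → w ≠ v → (G.Adj z w ↔ B.Adj z w))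
    (hGv : ∀ z, G.Adj v z ↔ z = x ∨ z = y) : Base (insert v X) G := by
  cases hE with
  | strip p r hr h hxy =>
    have hGv := adj_iff_of_sym2 hGv hxy
    have hp : ∀ i, i < r → p i ≠ v := fun i hi h' => hv (h' ▸ (h.mem _).2 ⟨i, hi, rfl⟩)
    have e : ∀ a b, a < r → b < r → (p a = p b ↔ a = b) := fun a b ha hb =>
      ⟨h.inj a b ha hb, fun h => h ▸ rfl⟩
    have hvp : ∀ i, i < r → (G.Adj v (p i) ↔ r ≤ i + 2) := by
      intro i hi
      rw [hGv, e i _ hi (by omega), e i _ hi (by omega)]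
      omega
    refine .strip (snocSeq p r v) (r + 1) (by omega) ⟨?_, ?_, ?_⟩
    · intro i j hi hj hij
      unfold snocSeq at hij
      split_ifs at hij with h1 h2 h2
      · exact h.inj i j h1 h2 hij
      · exact absurd hij (hp i h1)
      · exact absurd hij.symm (hp j h2)
      · omega
    · intro z
      rw [Finset.mem_insert, h.mem]
      constructor
      · rintro (rfl | ⟨i, hi, rfl⟩)
        · exact ⟨r, by omega, snocSeq_self⟩
        · exact ⟨i, by omega, snocSeq_lt hi⟩
      · rintro ⟨i, hi, rfl⟩
        rcases Nat.lt_or_ge i r with hir | hir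
        · exact Or.inr ⟨i, hir, (snocSeq_lt hir).symm⟩
        · exact Or.inl (if_neg (by omega))
    · intro i j hi hj
      rcases Nat.lt_or_ge i r with hir | hir <;> rcases Nat.lt_or_ge j r with hjr | hjr
      · rw [snocSeq_lt hir, snocSeq_lt hjr, hB _ _ (hp i hir) (hp j hjr), h.adj i j hir hjr]
      · obtain rfl : j = r := by omega
        rw [snocSeq_lt hir, snocSeq_self, G.adj_comm, hvp i hir]
        omega
      · obtain rfl : i = r := by omega
        rw [snocSeq_lt hjr, snocSeq_self, hvp j hjr]
        omega
      · obtain rfl : i = r := by omega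
        obtain rfl : j = i := by omega
        simp
  | book hX h =>
    refine .book x y (by rw [Finset.card_insert_of_notMem hv]; omega) ⟨h.ne, ?_, ?_, ?_⟩
    · exact Finset.mem_insert_of_mem h.hg
    · exact Finset.mem_insert_of_mem h.hk
    · have hxv : x ≠ v := fun h' => hv (h' ▸ h.hg)
      have hyv : y ≠ v := fun h' => hv (h' ▸ h.hk)
      intro z w hz hw
      by_cases hzv : z = v
      · subst hzv
        rw [hGv]
        grind
      · by_cases hwv : w = v
        · subst hwv
          rw [G.adj_comm, hGv]
          grind
        · rw [hB z w hzv hwv, h.adj z w (Finset.mem_of_mem_insert_of_ne hz hzv)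
            (Finset.mem_of_mem_insert_of_ne hw hwv)]
  | one p s t m hm h hxy =>
    have hGv := adj_iff_of_sym2 hGv hxy
    have hp : ∀ i, i < m → p i ≠ v := fun i hi h' => hv (h' ▸ (h.mem _).2 (Or.inl ⟨i, hi, rfl⟩))
    have hsv : s ≠ v := fun h' => hv (h' ▸ (h.mem _).2 (by simp))
    have htv : t ≠ v := fun h' => hv (h' ▸ (h.mem _).2 (by simp))
    have e : ∀ a b, a < m → b < m → (p a = p b ↔ a = b) := fun a b ha hb =>
      ⟨h.inj a b ha hb, fun h => h ▸ rfl⟩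
    have hvp : ∀ i, i < m → (G.Adj v (p i) ↔ m ≤ i + 2) := by
      intro i hi
      rw [hGv, e i _ hi (by omega), e i _ hi (by omega)]
      omega
    have hvs : ¬ G.Adj s v := by
      rw [G.adj_comm, hGv]
      exact fun h' => h'.elim (fun h' => h.ne_s _ (by omega) h'.symm)
        (fun h' => h.ne_s _ (by omega) h'.symm)
    have hvt : ¬ G.Adj t v := by
      rw [G.adj_comm, hGv]
      exact fun h' => h'.elim (fun h' => h.ne_t _ (by omega) h'.symm)
        (fun h' => h.ne_t _ (by omega) h'.symm)
    refine .one (snocSeq p m v) s t (m + 1) (by omega) ⟨?_, ?_, ?_, ?_, ?_, ?_, ?_, ?_⟩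
    · intro i j hi hj hij
      unfold snocSeq at hij
      split_ifs at hij with h1 h2 h2
      · exact h.inj i j h1 h2 hij
      · exact absurd hij (hp i h1)
      · exact absurd hij.symm (hp j h2)
      · omega
    · intro i hi
      unfold snocSeq
      split_ifs with h1
      · exact h.ne_s i h1
      · exact hsv.symm
    · intro i hi
      unfold snocSeq
      split_ifs with h1
      · exact h.ne_t i h1
      · exact htv.symm
    · intro z
      rw [Finset.mem_insert, h.mem]
      constructor
      · rintro (rfl | ⟨i, hi, rfl⟩ | h')
        · exact Or.inl ⟨m, by omega, snocSeq_self⟩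
        · exact Or.inl ⟨i, by omega, snocSeq_lt hi⟩
        · exact Or.inr h'
      · rintro (⟨i, hi, rfl⟩ | h')
        · rcases Nat.lt_or_ge i m with hir | hir
          · exact Or.inr (Or.inl ⟨i, hir, (snocSeq_lt hir).symm⟩)
          · exact Or.inl (if_neg (by omega))
        · exact Or.inr (Or.inr h')
    · intro i j hi hj
      rcases Nat.lt_or_ge i m with hir | hir <;> rcases Nat.lt_or_ge j m with hjr | hjr
      · rw [snocSeq_lt hir, snocSeq_lt hjr, hB _ _ (hp i hir) (hp j hjr), h.adj i j hir hjr]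
      · obtain rfl : j = m := by omega
        rw [snocSeq_lt hir, snocSeq_self, G.adj_comm, hvp i hir]
        omega
      · obtain rfl : i = m := by omega
        rw [snocSeq_lt hjr, snocSeq_self, hvp j hjr]
        omega
      · obtain rfl : i = m := by omega
        obtain rfl : j = i := by omega
        simp
    · rw [hB _ _ hsv htv]; exact h.st
    · intro i hi
      unfold snocSeq
      split_ifs with h1
      · rw [hB _ _ hsv (hp i h1), h.sp i h1]
      · exact iff_of_false hvs (by omega)
    · intro i hi
      unfold snocSeq
      split_ifs with h1
      · rw [hB _ _ htv (hp i h1), h.tp i h1]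
      · exact iff_of_false hvt (by omega)

lemma or_rotate_two {a b c : Prop} : a ∨ b ∨ c ↔ c ∨ a ∨ b := by tauto

/-- The sequence `a, b, c, d`. -/
def seqFour (a b c d : V) : ℕ → V
  | 0 => a
  | 1 => b
  | 2 => c
  | _ => d

lemma stripOn_four {G : SimpleGraph V} {X : Finset V} {a b c d : V} (hn : [a, b, c, d].Nodup)
    (hX : ∀ z, z ∈ X ↔ z = a ∨ z = b ∨ z = c ∨ z = d) (hab : G.Adj a b) (hac : G.Adj a c)
    (hbc : G.Adj b c) (hbd : G.Adj b d) (hcd : G.Adj c d) (had : ¬ G.Adj a d) :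
    StripOn G X (seqFour a b c d) 4 where
  inj i j hi hj hij := by
    simp only [List.nodup_cons, List.mem_cons, List.not_mem_nil, or_false, not_or,
      List.nodup_nil, and_true, not_false_eq_true] at hn
    obtain ⟨⟨n1, n2, n3⟩, ⟨n4, n5⟩, n6⟩ := hn
    have key : ∀ i j, i < j → j < 4 → seqFour a b c d i ≠ seqFour a b c d j := by
      intro i j hi hj
      interval_cases j <;> interval_cases i <;> assumption
    rcases Nat.lt_trichotomy i j with h | h | h
    · exact absurd hij (key i j h hj)
    · exact h
    · exact absurd hij.symm (key j i h hi)
  mem z := by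
    rw [hX]
    constructor
    · rintro (rfl | rfl | rfl | rfl)
      · exact ⟨0, by omega, rfl⟩
      · exact ⟨1, by omega, rfl⟩
      · exact ⟨2, by omega, rfl⟩
      · exact ⟨3, by omega, rfl⟩
    · rintro ⟨i, hi, rfl⟩
      interval_cases i <;> simp [seqFour]
  adj i j hi hj := by
    interval_cases i <;> interval_cases j <;>
      simp [seqFour, hab, hac, hbc, hbd, hcd, had, hab.symm, hac.symm, hbc.symm, hbd.symm,
        hcd.symm, G.adj_comm d a]

/-- Replacing an admissible edge by a diamond gives a base graph again: strips become strips with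
one diamond, and strips with one diamond get a second one. Hub edges of books are excluded, as
the two pages and the diamond form `bad_of_diamond_pages`. -/
lemma EarSpot.base_diamond [DecidableEq V] {B G : SimpleGraph V} {X : Finset V} {x y s t : V}
    (hE : EarSpot X B x y) (hs : s ∉ X) (ht : t ∉ X) (hst : s ≠ t) (hG : ¬ Bad G)
    (hB : ∀ z w, z ∈ X → w ∈ X → (G.Adj z w ↔ B.Adj z w ∧ s(z, w) ≠ s(x, y)))
    (hGs : ∀ z, G.Adj s z ↔ z = t ∨ z = x ∨ z = y)
    (hGt : ∀ z, G.Adj t z ↔ z = s ∨ z = x ∨ z = y) : Base (insert s (insert t X)) G := by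
  have nes : ∀ z ∈ X, z ≠ s := fun z hz h => hs (h ▸ hz)
  have net : ∀ z ∈ X, z ≠ t := fun z hz h => ht (h ▸ hz)
  have hGs' : ∀ z ∈ X, (G.Adj s z ↔ z = x ∨ z = y) := fun z hz => by
    rw [hGs]; exact ⟨fun h => h.resolve_left (net z hz), Or.inr⟩
  have hGt' : ∀ z ∈ X, (G.Adj t z ↔ z = x ∨ z = y) := fun z hz => by
    rw [hGt]; exact ⟨fun h => h.resolve_left (nes z hz), Or.inr⟩
  have hGst : G.Adj s t := (hGs t).2 (Or.inl rfl)
  cases hE with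
  | strip p r hr h hxy =>
    have hmem : ∀ i, i < r → p i ∈ X := fun i hi => (h.mem _).2 ⟨i, hi, rfl⟩
    have e : ∀ a b, a < r → b < r → (p a = p b ↔ a = b) := fun a b ha hb =>
      ⟨h.inj a b ha hb, fun h => h ▸ rfl⟩
    have hsp : ∀ i, i < r → (G.Adj s (p i) ↔ r ≤ i + 2) := by
      intro i hi
      rw [hGs' _ (hmem i hi), adj_iff_of_sym2 (P := fun z => z = x ∨ z = y) (fun _ => Iff.rfl) hxy,
        e i _ hi (by omega), e i _ hi (by omega)]
      omega
    have htp : ∀ i, i < r → (G.Adj t (p i) ↔ r ≤ i + 2) := by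
      intro i hi
      rw [hGt' _ (hmem i hi), adj_iff_of_sym2 (P := fun z => z = x ∨ z = y) (fun _ => Iff.rfl) hxy,
        e i _ hi (by omega), e i _ hi (by omega)]
      omega
    have hpp : ∀ i j, i < r → j < r → (G.Adj (p i) (p j) ↔
        (i ≠ j ∧ i ≤ j + 2 ∧ j ≤ i + 2) ∧ i + j + 3 ≠ 2 * r) := by
      intro i j hi hj
      rw [hB _ _ (hmem i hi) (hmem j hj), h.adj i j hi hj, hxy, ne_eq s(p i, p j), Sym2.eq_iff,
        e i _ hi (by omega), e i _ hi (by omega), e j _ hj (by omega), e j _ hj (by omega)]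
      omega
    by_cases hr2 : r = 2
    · subst hr2
      have n1 : p 0 ≠ p 1 := fun h' => absurd ((e 0 1 (by omega) (by omega)).1 h') (by omega)
      have n2 := nes _ (hmem 0 (by omega))
      have n3 := nes _ (hmem 1 (by omega))
      have n4 := net _ (hmem 0 (by omega))
      have n5 := net _ (hmem 1 (by omega))
      have a1 := (hsp 0 (by omega)).2 (by omega)
      have a2 := (hsp 1 (by omega)).2 (by omega)
      have a3 := (htp 0 (by omega)).2 (by omega)
      have a4 := (htp 1 (by omega)).2 (by omega)
      have a5 : ¬ G.Adj (p 0) (p 1) := fun h' => absurd rfl ((hpp 0 1 (by omega) (by omega)).1 h').2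
      refine .strip _ 4 (by omega) (stripOn_four (a := p 0) (b := s) (c := t) (d := p 1) ?_ ?_
        a1.symm a3.symm hGst a2 a4 a5)
      · simp [n1, n2, n3.symm, n4, n5.symm, hst]
      · intro z
        rw [Finset.mem_insert, Finset.mem_insert, h.mem]
        constructor
        · rintro (rfl | rfl | ⟨i, hi, rfl⟩)
          · simp
          · simp
          · interval_cases i <;> simp
        · rintro (rfl | rfl | rfl | rfl)
          · exact Or.inr (Or.inr ⟨0, by omega, rfl⟩)
          · exact Or.inl rfl
          · exact Or.inr (Or.inl rfl)
          · exact Or.inr (Or.inr ⟨1, by omega, rfl⟩)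
    · refine .one (fun i => p (r - 1 - i)) s t r (by omega) ⟨h.rev.inj, ?_, ?_, ?_, ?_, hGst, ?_, ?_⟩
      · exact fun i hi => nes _ (hmem _ (by omega))
      · exact fun i hi => net _ (hmem _ (by omega))
      · intro z
        rw [Finset.mem_insert, Finset.mem_insert, h.rev.mem]
        exact or_rotate_two
      · intro i j hi hj
        rw [hpp _ _ (by omega) (by omega)]
        omega
      · intro i hi
        rw [hsp _ (by omega)]
        omega
      · intro i hi
        rw [htp _ (by omega)]
        omega
  | book hX h =>
    obtain ⟨a, b, ha, hb, hab, hax, hay, hbx, hby⟩ := h.exists_pages hX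
    have key : ∀ z w, z ∈ X → w ∈ X → w ≠ x → w ≠ y → z ≠ w → (z = x ∨ z = y) → G.Adj z w := by
      intro z w hz hw hwx hwy hzw hzx
      rw [hB z w hz hw, h.adj z w hz hw, ne_eq s(z, w), Sym2.eq_iff]
      tauto
    refine absurd (bad_of_diamond_pages (x := x) (y := y) (s := s) (t := t) (p := a) (q := b) ?_
      ⟨((hGt x).2 (by simp)).symm, (hGt y).2 (by simp), hGst.symm, ((hGs x).2 (by simp)).symm,
        key x a h.hg ha hax hay hax.symm (by simp), (key y a h.hk ha hax hay hay.symm (by simp)).symm,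
        key x b h.hg hb hbx hby hbx.symm (by simp), (key y b h.hk hb hbx hby hby.symm (by simp)).symm,
        ((hGs y).2 (by simp)).symm⟩) hG
    simp [h.ne, nes x h.hg, net x h.hg, nes y h.hk, net y h.hk, hst, hax.symm, hay.symm, hbx.symm,
      hby.symm, hab, (nes a ha).symm, (nes b hb).symm, (net a ha).symm, (net b hb).symm]
  | one p s₀ t₀ m hm h hxy =>
    have hmem : ∀ i, i < m → p i ∈ X := fun i hi => (h.mem _).2 (Or.inl ⟨i, hi, rfl⟩)
    have hs₀ : s₀ ∈ X := (h.mem _).2 (by simp)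
    have ht₀ : t₀ ∈ X := (h.mem _).2 (by simp)
    have e : ∀ a b, a < m → b < m → (p a = p b ↔ a = b) := fun a b ha hb =>
      ⟨h.inj a b ha hb, fun h => h ▸ rfl⟩
    have hxyp : ∀ z, (z = x ∨ z = y) ↔ (z = p (m - 2) ∨ z = p (m - 1)) :=
      adj_iff_of_sym2 (P := fun z => z = x ∨ z = y) (fun _ => Iff.rfl) hxy
    have hs₀' : ∀ i, i < m → s₀ ≠ p i := fun i hi => (h.ne_s i hi).symm
    have ht₀' : ∀ i, i < m → t₀ ≠ p i := fun i hi => (h.ne_t i hi).symm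
    have hB' : ∀ z w, z ∈ X → w ∈ X → (z = s₀ ∨ z = t₀) → (G.Adj z w ↔ B.Adj z w) := by
      intro z w hz hw hzs
      rw [hB z w hz hw, hxy, ne_eq s(z, w), Sym2.eq_iff]
      refine and_iff_left ?_
      rcases hzs with rfl | rfl
      · simp [hs₀' (m - 1) (by omega), hs₀' (m - 2) (by omega)]
      · simp [ht₀' (m - 1) (by omega), ht₀' (m - 2) (by omega)]
    refine .two p s₀ t₀ s t m hm ⟨h.inj, h.ne_s, h.ne_t, fun i hi => nes _ (hmem i hi),
      fun i hi => net _ (hmem i hi), ?_, ?_, ?_, ?_, ?_, ?_, hGst, ?_, ?_, ?_, ?_, ?_, ?_⟩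
    · simp [h.st.ne, nes s₀ hs₀, net s₀ hs₀, nes t₀ ht₀, net t₀ ht₀, hst]
    · intro z
      rw [Finset.mem_insert, Finset.mem_insert, h.mem]
      rw [or_rotate_two, or_assoc, or_assoc]
    · intro i j hi hj
      rw [hB _ _ (hmem i hi) (hmem j hj), h.adj i j hi hj, hxy, ne_eq s(p i, p j), Sym2.eq_iff,
        e i _ hi (by omega), e i _ hi (by omega), e j _ hj (by omega), e j _ hj (by omega)]
      omega
    · rw [hB' _ _ hs₀ ht₀ (by simp)]; exact h.st
    · intro i hi
      rw [hB' _ _ hs₀ (hmem i hi) (by simp), h.sp i hi]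
    · intro i hi
      rw [hB' _ _ ht₀ (hmem i hi) (by simp), h.tp i hi]
    · intro i hi
      rw [hGs' _ (hmem i hi), hxyp, e i _ hi (by omega), e i _ hi (by omega)]
      omega
    · intro i hi
      rw [hGt' _ (hmem i hi), hxyp, e i _ hi (by omega), e i _ hi (by omega)]
      omega
    · rw [G.adj_comm, hGs' _ hs₀, hxyp]
      simp [hs₀' (m - 1) (by omega), hs₀' (m - 2) (by omega)]
    · rw [G.adj_comm, hGs' _ ht₀, hxyp]
      simp [ht₀' (m - 1) (by omega), ht₀' (m - 2) (by omega)]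
    · rw [G.adj_comm, hGt' _ hs₀, hxyp]
      simp [hs₀' (m - 1) (by omega), hs₀' (m - 2) (by omega)]
    · rw [G.adj_comm, hGt' _ ht₀, hxyp]
      simp [ht₀' (m - 1) (by omega), ht₀' (m - 2) (by omega)]

/-! ### Subdividing an edge of a base graph and joining the new vertex to a third one -/

/-- The far end of a strip serves as a single edge from `p k` to a vertex `v` joined to the last
vertex of the strip. -/
lemma Ladder.bad_of_tail {G : SimpleGraph V} {p : ℕ → V} {m : ℕ} (L : Ladder G p m) {v : V}
    (hv : G.Adj (p (m - 1)) v) {k : ℕ} (hk1 : 1 ≤ k) (hk : k < m)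
    (h : ∀ G' : SimpleGraph V, G'.Adj (p k) v →
      (∀ x y, G.Adj x y → (∀ i, k ≤ i → i < m → x = p i → i = k ∧ y ≠ v) →
        (∀ i, k ≤ i → i < m → y = p i → i = k ∧ x ≠ v) → G'.Adj x y) → Bad G')
    (hvp : ∀ i, i < m → p i ≠ v) : Bad G := by
  let A : Set V := {x | x = v ∨ ∃ i, k ≤ i ∧ i < m ∧ x = p i}
  have hkA : p k ∈ A := Or.inr ⟨k, le_rfl, hk, rfl⟩
  have hvA : v ∈ A := Or.inl rfl
  have hreach : ∀ j, k + j < m → (within G A).Reachable (p k) (p (k + j)) := by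
    intro j
    induction j with
    | zero => intro _; exact SimpleGraph.Reachable.refl _
    | succ j ih =>
      intro hj
      have hadj : (within G A).Adj (p (k + j)) (p (k + (j + 1))) :=
        ⟨L.step1 (k + j) (by omega) (by omega), Or.inr ⟨k + j, by omega, by omega, rfl⟩,
          Or.inr ⟨k + (j + 1), by omega, by omega, rfl⟩⟩
      exact (ih (by omega)).trans hadj.reachable
  have hlast : (within G A).Adj (p (m - 1)) v := ⟨hv, Or.inr ⟨m - 1, by omega, by omega, rfl⟩, hvA⟩
  have h1 := hreach (m - 1 - k) (by omega)
  rw [show k + (m - 1 - k) = m - 1 by omega] at h1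
  refine Bad.of_bypass hkA hvA (h1.trans hlast.reachable) (h _ ?_ ?_)
  · exact ⟨hvp k hk, Or.inl ⟨rfl, rfl⟩⟩
  · intro x y hxy hx hy
    refine ⟨hxy.ne, Or.inr (Or.inr ⟨hxy, ?_, ?_, ?_⟩)⟩
    · rintro ⟨rfl | ⟨i, hi, him, rfl⟩, hy' | ⟨j, hj, hjm, hy'⟩⟩
      · exact hxy.ne hy'.symm
      · exact (hy j hj hjm hy').2 rfl
      · exact (hx i hi him rfl).2 hy'
      · subst hy'
        obtain ⟨rfl, -⟩ := hx i hi him rfl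
        obtain ⟨rfl, -⟩ := hy j hj hjm rfl
        exact hxy.ne rfl
    · rintro (h' | ⟨i, hi, him, h'⟩)
      · exact Or.inr h'
      · rw [h', (hx i hi him h').1]; exact Or.inl rfl
    · rintro (h' | ⟨i, hi, him, h'⟩)
      · exact Or.inr h'
      · rw [h', (hy i hi him h').1]; exact Or.inl rfl

/-- A strip together with `s, t, v` outside of it, `v` being joined to the last vertex. -/
structure StripWithThree (G : SimpleGraph V) (p : ℕ → V) (s t v : V) (m : ℕ) : Prop extends
    Ladder G p m where
  ne_s : ∀ i, i < m → p i ≠ s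
  ne_t : ∀ i, i < m → p i ≠ t
  ne_v : ∀ i, i < m → p i ≠ v
  st : s ≠ t
  sv : s ≠ v
  tv : t ≠ v
  last : G.Adj (p (m - 1)) v
  s_v : G.Adj s v

/-- The diamond on the first edge has its edge `st` subdivided by `v`: a subdivided `K₃,₃`. -/
lemma StripWithThree.bad_of_st {G : SimpleGraph V} {p : ℕ → V} {s t v : V} {m : ℕ}
    (S : StripWithThree G p s t v m) (hm : 3 ≤ m) (htv : G.Adj t v) (hs0 : G.Adj s (p 0))
    (hs1 : G.Adj s (p 1)) (ht0 : G.Adj t (p 0)) (ht1 : G.Adj t (p 1)) : Bad G := by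
  refine S.toLadder.bad_of_tail S.last (k := 2) (by omega) (by omega) ?_ S.ne_v
  intro G' h2v hG'
  have hne : ∀ a b, a < m → b < m → a ≠ b → p a ≠ p b := fun a b ha hb h h' =>
    h (S.inj a b ha hb h')
  have e1 : ∀ z w, (z = s ∨ z = t) → (w = v ∨ w = p 0 ∨ w = p 1) → G.Adj z w → G'.Adj z w := by
    intro z w hz hw h
    refine hG' z w h ?_ ?_
    · rintro i hi him rfl
      rcases hz with h' | h'
      · exact absurd h' (S.ne_s i him)
      · exact absurd h' (S.ne_t i him)
    · rintro i hi him rfl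
      rcases hw with h' | h' | h'
      · exact absurd h' (S.ne_v i him)
      · exact absurd h' (hne _ _ him (by omega) (by omega))
      · exact absurd h' (hne _ _ him (by omega) (by omega))
  have e2 : ∀ j, j < 2 → G.Adj (p 2) (p j) → G'.Adj (p 2) (p j) := by
    intro j hj h
    refine hG' _ _ h ?_ ?_
    · intro i hi him h'
      exact ⟨(S.inj _ _ (by omega) him h').symm, S.ne_v _ (by omega)⟩
    · intro i hi him h'
      have := S.inj _ _ (by omega) him h'
      omega
  refine bad_of_K33 (a := p 0) (b := p 1) (c := v) (x := s) (y := t) (z := p 2) ?_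
    ⟨(e1 _ _ (by simp) (by simp) hs0).symm, e1 _ _ (by simp) (by simp) hs1,
      e1 _ _ (by simp) (by simp) S.s_v, (e1 _ _ (by simp) (by simp) ht0).symm,
      e1 _ _ (by simp) (by simp) ht1, e1 _ _ (by simp) (by simp) htv,
      (e2 0 (by omega) (S.step2 0 (by omega)).symm).symm,
      e2 1 (by omega) (S.step1 1 (by omega) (by omega)).symm, h2v⟩
  simp [hne 0 1 (by omega) (by omega) (by omega), hne 0 2 (by omega) (by omega) (by omega),
    hne 1 2 (by omega) (by omega) (by omega), S.ne_s 0 (by omega), S.ne_s 1 (by omega),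
    (S.ne_s 2 (by omega)).symm, S.ne_t 0 (by omega), S.ne_t 1 (by omega),
    (S.ne_t 2 (by omega)).symm, S.ne_v 0 (by omega), S.ne_v 1 (by omega),
    (S.ne_v 2 (by omega)).symm, S.st, S.sv.symm, S.tv.symm]

/-- The diamond on the first edge has its edge `s (p 0)` subdivided by `v`. -/
lemma StripWithThree.bad_of_s0 {G : SimpleGraph V} {p : ℕ → V} {s t v : V} {m : ℕ}
    (S : StripWithThree G p s t v m) (hm : 4 ≤ m) (hst : G.Adj s t)
    (hs1 : G.Adj s (p 1)) (ht0 : G.Adj t (p 0)) (ht1 : G.Adj t (p 1)) : Bad G := by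
  refine S.toLadder.bad_of_tail S.last (k := 3) (by omega) (by omega) ?_ S.ne_v
  intro G' h3v hG'
  have hne : ∀ a b, a < m → b < m → a ≠ b → p a ≠ p b := fun a b ha hb h h' =>
    h (S.inj a b ha hb h')
  have low : ∀ z, (z = s ∨ z = t ∨ z = v ∨ z = p 0 ∨ z = p 1 ∨ z = p 2) →
      ∀ i, 3 ≤ i → i < m → z ≠ p i := by
    rintro z hz i hi him rfl
    rcases hz with h | h | h | h | h | h
    · exact S.ne_s i him h
    · exact S.ne_t i him h
    · exact S.ne_v i him h
    · exact hne _ _ him (by omega) (by omega) h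
    · exact hne _ _ him (by omega) (by omega) h
    · exact hne _ _ him (by omega) (by omega) h
  have e1 : ∀ z w, (z = s ∨ z = t ∨ z = v ∨ z = p 0 ∨ z = p 1 ∨ z = p 2) →
      (w = s ∨ w = t ∨ w = v ∨ w = p 0 ∨ w = p 1 ∨ w = p 2) → G.Adj z w → G'.Adj z w :=
    fun z w hz hw h => hG' z w h (fun i hi him h' => absurd h' (low z hz i hi him))
      (fun i hi him h' => absurd h' (low w hw i hi him))
  have e2 : ∀ j, j < 3 → G.Adj (p 3) (p j) → G'.Adj (p 3) (p j) := by
    intro j hj h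
    refine hG' _ _ h ?_ ?_
    · intro i hi him h'
      exact ⟨(S.inj _ _ (by omega) him h').symm, S.ne_v _ (by omega)⟩
    · intro i hi him h'
      have := S.inj _ _ (by omega) him h'
      omega
  refine bad_of_diamond_tip (p₁ := p 1) (s := s) (p₂ := p 2) (t := t) (p₀ := p 0) (p₃ := p 3)
    (v := v) ?_ ⟨(e1 _ _ (by simp) (by simp) ht1).symm, (e1 _ _ (by simp) (by simp) hst).symm,
      e1 _ _ (by simp) (by simp) ht0, e1 _ _ (by simp) (by simp) (S.step2 0 (by omega)),
      (e2 1 (by omega) (S.step2 1 (by omega)).symm).symm,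
      e2 2 (by omega) (S.step1 2 (by omega) (by omega)).symm, h3v,
      (e1 _ _ (by simp) (by simp) S.s_v).symm, (e1 _ _ (by simp) (by simp) hs1).symm,
      e1 _ _ (by simp) (by simp) (S.step1 1 (by omega) (by omega))⟩
  have n : ∀ a b, a < 4 → b < 4 → a ≠ b → p a ≠ p b := fun a b ha hb =>
    hne a b (by omega) (by omega)
  simp [n, S.ne_s 1 (by omega), S.ne_t 1 (by omega), S.ne_v 1 (by omega),
    (S.ne_s 2 (by omega)).symm, (S.ne_s 0 (by omega)).symm, (S.ne_s 3 (by omega)).symm, S.st, S.sv,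
    S.ne_t 2 (by omega), S.ne_v 2 (by omega), (S.ne_t 0 (by omega)).symm,
    (S.ne_t 3 (by omega)).symm, S.tv, S.ne_v 0 (by omega), S.ne_v 3 (by omega)]

/-- The diamond on the first edge has its edge `s (p 1)` subdivided by `v`. -/
lemma StripWithThree.bad_of_s1 {G : SimpleGraph V} {p : ℕ → V} {s t v : V} {m : ℕ}
    (S : StripWithThree G p s t v m) (hm : 4 ≤ m) (hst : G.Adj s t)
    (h1v : G.Adj (p 1) v) (ht0 : G.Adj t (p 0)) (ht1 : G.Adj t (p 1)) : Bad G := by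
  refine S.toLadder.bad_of_tail S.last (k := 3) (by omega) (by omega) ?_ S.ne_v
  intro G' h3v hG'
  have hne : ∀ a b, a < m → b < m → a ≠ b → p a ≠ p b := fun a b ha hb h h' =>
    h (S.inj a b ha hb h')
  have low : ∀ z, (z = s ∨ z = t ∨ z = v ∨ z = p 0 ∨ z = p 1 ∨ z = p 2) →
      ∀ i, 3 ≤ i → i < m → z ≠ p i := by
    rintro z hz i hi him rfl
    rcases hz with h | h | h | h | h | h
    · exact S.ne_s i him h
    · exact S.ne_t i him h
    · exact S.ne_v i him h
    · exact hne _ _ him (by omega) (by omega) h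
    · exact hne _ _ him (by omega) (by omega) h
    · exact hne _ _ him (by omega) (by omega) h
  have e1 : ∀ z w, (z = s ∨ z = t ∨ z = v ∨ z = p 0 ∨ z = p 1 ∨ z = p 2) →
      (w = s ∨ w = t ∨ w = v ∨ w = p 0 ∨ w = p 1 ∨ w = p 2) → G.Adj z w → G'.Adj z w :=
    fun z w hz hw h => hG' z w h (fun i hi him h' => absurd h' (low z hz i hi him))
      (fun i hi him h' => absurd h' (low w hw i hi him))
  have e2 : ∀ j, j < 3 → G.Adj (p 3) (p j) → G'.Adj (p 3) (p j) := by
    intro j hj h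
    refine hG' _ _ h ?_ ?_
    · intro i hi him h'
      exact ⟨(S.inj _ _ (by omega) him h').symm, S.ne_v _ (by omega)⟩
    · intro i hi him h'
      have := S.inj _ _ (by omega) him h'
      omega
  refine bad_of_diamond_tip' (p₁ := p 1) (s := s) (p₂ := p 2) (t := t) (p₀ := p 0) (p₃ := p 3)
    (v := v) ?_ ⟨(e1 _ _ (by simp) (by simp) ht1).symm, (e1 _ _ (by simp) (by simp) hst).symm,
      e1 _ _ (by simp) (by simp) S.s_v,
      e1 _ _ (by simp) (by simp) ht0, e1 _ _ (by simp) (by simp) (S.step2 0 (by omega)),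
      (e2 1 (by omega) (S.step2 1 (by omega)).symm).symm, h3v,
      e2 2 (by omega) (S.step1 2 (by omega) (by omega)).symm,
      e1 _ _ (by simp) (by simp) h1v,
      e1 _ _ (by simp) (by simp) (S.step1 1 (by omega) (by omega))⟩
  have n : ∀ a b, a < 4 → b < 4 → a ≠ b → p a ≠ p b := fun a b ha hb =>
    hne a b (by omega) (by omega)
  simp [n, S.ne_s 1 (by omega), S.ne_t 1 (by omega), S.ne_v 1 (by omega),
    (S.ne_s 0 (by omega)).symm, (S.ne_s 3 (by omega)).symm, S.st.symm, S.sv.symm, S.ne_s 2 (by omega),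
    S.ne_t 2 (by omega), (S.ne_v 2 (by omega)).symm, (S.ne_t 0 (by omega)).symm,
    (S.ne_t 3 (by omega)).symm, S.tv.symm, (S.ne_v 0 (by omega)).symm, (S.ne_v 3 (by omega)).symm]

/-- `G` arises from `B` by subdividing the edge `ab` by the new vertex `v` and joining `v` to
`c`. -/
structure SubdividedFrom (G B : SimpleGraph V) (X : Finset V) (a b c v : V) : Prop where
  hv : v ∉ X
  hc : c ∈ X
  hca : c ≠ a
  hcb : c ≠ b
  ab : B.Adj a b
  adj : ∀ z w, z ≠ v → w ≠ v → (G.Adj z w ↔ B.Adj z w ∧ s(z, w) ≠ s(a, b))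
  adj_v : ∀ z, G.Adj v z ↔ z = a ∨ z = b ∨ z = c

lemma SubdividedFrom.symm {G B : SimpleGraph V} {X : Finset V} {a b c v : V}
    (h : SubdividedFrom G B X a b c v) : SubdividedFrom G B X b a c v where
  hv := h.hv
  hc := h.hc
  hca := h.hcb
  hcb := h.hca
  ab := h.ab.symm
  adj z w hz hw := by rw [h.adj z w hz hw, Sym2.eq_swap (a := a)]
  adj_v z := by rw [h.adj_v]; tauto

/-- A vertex other than `c` has as many neighbours in `B` as in `G`. -/
lemma SubdividedFrom.exists_adj_ne {G B : SimpleGraph V} {X : Finset V} {a b c v : V}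
    (h : SubdividedFrom G B X a b c v) {z : V} (hz : z ∈ X) (hzc : z ≠ c)
    (hdeg : 2 < (G.neighborSet z).ncard) (x y : V) : ∃ w, B.Adj z w ∧ w ≠ x ∧ w ≠ y := by
  have hzv : z ≠ v := fun h' => h.hv (h' ▸ hz)
  have hab := h.ab.ne
  have hBv : ∀ w, w ≠ v → G.Adj z w → B.Adj z w := fun w hw hzw => ((h.adj z w hzv hw).1 hzw).1
  have key : ∀ a b, SubdividedFrom G B X a b c v → z = a → ∃ w, B.Adj z w ∧ w ≠ x ∧ w ≠ y := by
    rintro a b h rfl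
    have hnb : ¬ G.Adj z b := by
      intro h'
      by_cases hbv : b = v
      · rw [hbv] at h'
        have h2 := h.adj_v v
        simp [hbv] at h2
      · exact ((h.adj z b hzv hbv).1 h').2 rfl
    by_cases hx : b = x
    · obtain ⟨w, hw, hwv, hwy⟩ := exists_adj_ne_of_two_lt hdeg v y
      exact ⟨w, hBv w hwv hw, fun h' => hnb (by rw [hx, ← h']; exact hw), hwy⟩
    · by_cases hy : b = y
      · obtain ⟨w, hw, hwv, hwx⟩ := exists_adj_ne_of_two_lt hdeg v x
        exact ⟨w, hBv w hwv hw, hwx, fun h' => hnb (by rw [hy, ← h']; exact hw)⟩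
      · exact ⟨b, h.ab, hx, hy⟩
  by_cases hza : z = a
  · exact key a b h hza
  by_cases hzb : z = b
  · exact key b a h.symm hzb
  have hnv : ¬ G.Adj z v := by
    rw [G.adj_comm, h.adj_v]
    tauto
  obtain ⟨w, hw, hwx, hwy⟩ := exists_adj_ne_of_two_lt hdeg x y
  exact ⟨w, hBv w (fun h' => hnv (h' ▸ hw)) hw, hwx, hwy⟩

/-- `G` has no diamond: two adjacent vertices of degree `3` with the same two further neighbours,
these being non-adjacent. -/
def NoDiamond (G : SimpleGraph V) : Prop :=
  ∀ s t x y, x ≠ y → ¬ G.Adj x y → (∀ w, G.Adj s w ↔ w = t ∨ w = x ∨ w = y) →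
    ¬ ∀ w, G.Adj t w ↔ w = s ∨ w = x ∨ w = y

lemma SubdividedFrom.adj_of_adj {G B : SimpleGraph V} {X : Finset V} {a b c v : V}
    (h : SubdividedFrom G B X a b c v) (hX : EdgesIn B X) {z w : V} (hzw : B.Adj z w)
    (hne : s(z, w) ≠ s(a, b)) : G.Adj z w :=
  (h.adj z w (fun h' => h.hv (h' ▸ hX _ _ hzw)) (fun h' => h.hv (h' ▸ hX _ _ hzw.symm))).2
    ⟨hzw, hne⟩

/-- If the minimum degree of `G` exceeds `2`, then `c` is the only vertex of degree at most `2`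
of `B`. -/
lemma SubdividedFrom.eq_of_low {G B : SimpleGraph V} {X : Finset V} {a b c v : V}
    (h : SubdividedFrom G B X a b c v) (hdeg : ∀ z ∈ X, 2 < (G.neighborSet z).ncard) {z : V}
    (hz : z ∈ X) (x y : V) (hxy : ∀ w, B.Adj z w → w = x ∨ w = y) : z = c := by
  by_contra hzc
  obtain ⟨w, hw, hwx, hwy⟩ := h.exists_adj_ne hz hzc (hdeg z hz) x y
  exact (hxy w hw).elim hwx hwy

/-- If `G` has no diamond, then every diamond of `B` is met by the subdivided edge or by `c`. -/
lemma SubdividedFrom.meets_diamond {G B : SimpleGraph V} {X : Finset V} {a b c v : V}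
    (h : SubdividedFrom G B X a b c v) (hX : EdgesIn B X) (hD : NoDiamond G) {s t x y : V}
    (hxy : x ≠ y) (hnxy : ¬ B.Adj x y) (hs : ∀ w, B.Adj s w ↔ w = t ∨ w = x ∨ w = y)
    (ht : ∀ w, B.Adj t w ↔ w = s ∨ w = x ∨ w = y) :
    (a = s ∨ a = t ∨ b = s ∨ b = t) ∨ c = s ∨ c = t := by
  by_contra hc
  push Not at hc
  obtain ⟨⟨has, hat, hbs, hbt⟩, hcs, hct⟩ := hc
  have hne : ∀ z w, B.Adj z w → z ≠ v ∧ w ≠ v := fun z w hzw =>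
    ⟨fun h' => h.hv (h' ▸ hX _ _ hzw), fun h' => h.hv (h' ▸ hX _ _ hzw.symm)⟩
  have key : ∀ s, a ≠ s → b ≠ s → c ≠ s → s ≠ v → ∀ w, G.Adj s w ↔ B.Adj s w := by
    intro s has hbs hcs hsv w
    by_cases hwv : w = v
    · subst hwv
      constructor
      · intro h'
        rcases (h.adj_v s).1 h'.symm with h1 | h1 | h1
        · exact absurd h1.symm has
        · exact absurd h1.symm hbs
        · exact absurd h1.symm hcs
      · intro h'
        exact absurd rfl (hne _ _ h').2
    · rw [h.adj s w hsv hwv, and_iff_left]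
      rw [ne_eq, Sym2.eq_iff]
      rintro (⟨h1, -⟩ | ⟨h1, -⟩)
      · exact has h1.symm
      · exact hbs h1.symm
  have hsx := (hs x).2 (by simp)
  have hsy := (hs y).2 (by simp)
  have htx := (ht x).2 (by simp)
  refine hD s t x y hxy ?_ (fun w => (key s has hbs hcs (hne _ _ hsx).1 w).trans (hs w))
    (fun w => (key t hat hbt hct (hne _ _ htx).1 w).trans (ht w))
  rw [h.adj x y (hne _ _ hsx).2 (hne _ _ hsy).2]
  exact fun h' => hnxy h'.1

lemma OneOn.adj_s {B : SimpleGraph V} {X : Finset V} {p : ℕ → V} {s t : V} {m : ℕ}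
    (h : OneOn B X p s t m) (hX : EdgesIn B X) (hm : 3 ≤ m) (w : V) :
    B.Adj s w ↔ w = t ∨ w = p 0 ∨ w = p 1 := by
  constructor
  · intro hw
    rcases (h.mem w).1 (hX _ _ hw.symm) with ⟨i, hi, rfl⟩ | rfl | rfl
    · obtain rfl | rfl : i = 0 ∨ i = 1 := by
        have := (h.sp i hi).1 hw
        omega
      · simp
      · simp
    · exact absurd rfl hw.ne
    · simp
  · rintro (rfl | rfl | rfl)
    · exact h.st
    · exact (h.sp _ (by omega)).2 (by omega)
    · exact (h.sp _ (by omega)).2 (by omega)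

lemma TwoOn.adj_s {B : SimpleGraph V} {X : Finset V} {p : ℕ → V} {s t s' t' : V} {m : ℕ}
    (h : TwoOn B X p s t s' t' m) (hX : EdgesIn B X) (hm : 3 ≤ m) (w : V) :
    B.Adj s w ↔ w = t ∨ w = p 0 ∨ w = p 1 := by
  constructor
  · intro hw
    rcases (h.mem w).1 (hX _ _ hw.symm) with ⟨i, hi, rfl⟩ | rfl | rfl | rfl | rfl
    · obtain rfl | rfl : i = 0 ∨ i = 1 := by
        have := (h.sp i hi).1 hw
        omega
      · simp
      · simp
    · exact absurd rfl hw.ne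
    · simp
    · exact absurd hw h.ss'
    · exact absurd hw h.st''
  · rintro (rfl | rfl | rfl)
    · exact h.st
    · exact (h.sp _ (by omega)).2 (by omega)
    · exact (h.sp _ (by omega)).2 (by omega)

/-- Subdividing the edge `s (p 0)` of the smallest strip with one diamond gives the prism. -/
lemma OneOn.prismOn [DecidableEq V] {G B : SimpleGraph V} {X : Finset V} {p : ℕ → V} {s t v : V}
    (h : OneOn B X p s t 3) (S : SubdividedFrom G B X s (p 0) (p 2) v) :
    PrismOn G (insert v X) ![![s, v], ![t, p 0], ![p 1, p 2]] := by
  have hv := S.hv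
  have hne : ∀ w ∈ X, w ≠ v := fun w hw h => hv (h ▸ hw)
  have vs := hne s ((h.mem _).2 (by simp))
  have vt := hne t ((h.mem _).2 (by simp))
  have v0 := hne (p 0) ((h.mem _).2 (Or.inl ⟨0, by omega, rfl⟩))
  have v1 := hne (p 1) ((h.mem _).2 (Or.inl ⟨1, by omega, rfl⟩))
  have v2 := hne (p 2) ((h.mem _).2 (Or.inl ⟨2, by omega, rfl⟩))
  have n : ∀ a b, a < 3 → b < 3 → a ≠ b → p a ≠ p b := fun a b ha hb h1 h2 =>
    h1 (h.inj a b ha hb h2)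
  have n01 := n 0 1 (by omega) (by omega) (by omega)
  have n02 := n 0 2 (by omega) (by omega) (by omega)
  have n12 := n 1 2 (by omega) (by omega) (by omega)
  have s0 := h.ne_s 0 (by omega)
  have s1 := h.ne_s 1 (by omega)
  have s2 := h.ne_s 2 (by omega)
  have t0 := h.ne_t 0 (by omega)
  have t1 := h.ne_t 1 (by omega)
  have t2 := h.ne_t 2 (by omega)
  have hst := h.st.ne
  have b01 : ¬ B.Adj (p 0) (p 1) := by rw [h.adj _ _ (by omega) (by omega)]; omega
  have b02 : B.Adj (p 0) (p 2) := by rw [h.adj _ _ (by omega) (by omega)]; omega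
  have b12 : B.Adj (p 1) (p 2) := by rw [h.adj _ _ (by omega) (by omega)]; omega
  have bs1 : B.Adj s (p 1) := by rw [h.sp _ (by omega)]
  have bs2 : ¬ B.Adj s (p 2) := by rw [h.sp _ (by omega)]; omega
  have bt0 : B.Adj t (p 0) := by rw [h.tp _ (by omega)]; omega
  have bt1 : B.Adj t (p 1) := by rw [h.tp _ (by omega)]
  have bt2 : ¬ B.Adj t (p 2) := by rw [h.tp _ (by omega)]; omega
  have hG : ∀ z w, z ≠ v → w ≠ v → B.Adj z w → (z ≠ s ∧ w ≠ s ∨ z ≠ p 0 ∧ w ≠ p 0) → G.Adj z w := by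
    intro z w hz hw hzw hh
    refine (S.adj z w hz hw).2 ⟨hzw, ?_⟩
    rw [ne_eq, Sym2.eq_iff]
    tauto
  have hG' : ∀ z w, z ≠ v → w ≠ v → ¬ B.Adj z w → ¬ G.Adj z w := fun z w hz hw h h' =>
    h ((S.adj z w hz hw).1 h').1
  have g01 := hG' _ _ v0 v1 b01
  have g02 := hG _ _ v0 v2 b02 (by simp [*])
  have g12 := hG _ _ v1 v2 b12 (by simp [*])
  have gst := hG _ _ vs vt h.st (by simp [*, hst.symm, s0.symm, t0.symm])
  have gs1 := hG _ _ vs v1 bs1 (by simp [*, s0.symm, n01.symm])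
  have gs2 := hG' _ _ vs v2 bs2
  have gt0 := hG _ _ vt v0 bt0 (by simp [*, hst.symm])
  have gt1 := hG _ _ vt v1 bt1 (by simp [*, hst.symm])
  have gt2 := hG' _ _ vt v2 bt2
  have gs0 : ¬ G.Adj s (p 0) := fun h' => ((S.adj _ _ vs v0).1 h').2 rfl
  have gvs := (S.adj_v s).2 (by simp)
  have gv0 := (S.adj_v (p 0)).2 (by simp)
  have gv2 := (S.adj_v (p 2)).2 (by simp)
  have gvt : ¬ G.Adj v t := by rw [S.adj_v]; simp [hst.symm, t0.symm, t2.symm]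
  have gv1 : ¬ G.Adj v (p 1) := by rw [S.adj_v]; simp [s1, n01.symm, n12]
  have c := G.adj_comm
  constructor
  · intro i j e d
    fin_cases i <;> fin_cases j <;> fin_cases e <;> fin_cases d <;>
      simp [*, hst.symm, s0.symm, s1.symm, s2.symm, t0.symm, t1.symm, t2.symm, vs.symm, vt.symm,
        v0.symm, v1.symm, v2.symm, n01.symm, n02.symm, n12.symm, -ne_eq]
  · intro x
    rw [Finset.mem_insert, h.mem]
    constructor
    · rintro (rfl | ⟨i, hi, rfl⟩ | rfl | rfl)
      · exact ⟨0, 1, rfl⟩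
      · interval_cases i
        · exact ⟨1, 1, rfl⟩
        · exact ⟨2, 0, rfl⟩
        · exact ⟨2, 1, rfl⟩
      · exact ⟨0, 0, rfl⟩
      · exact ⟨1, 0, rfl⟩
    · rintro ⟨i, e, rfl⟩
      fin_cases i <;> fin_cases e
      · simp
      · simp
      · simp
      · exact Or.inr (Or.inl ⟨0, by omega, rfl⟩)
      · exact Or.inr (Or.inl ⟨1, by omega, rfl⟩)
      · exact Or.inr (Or.inl ⟨2, by omega, rfl⟩)
  · intro i j e d
    fin_cases i <;> fin_cases j <;> fin_cases e <;> fin_cases d <;>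
      simp [g01, g02, g12, gst, gs1, gs2, gt0, gt1, gt2, gs0, gvs, gv0, gv2, gvt, gv1, g02.symm,
        g12.symm, gst.symm, gs1.symm, gt0.symm, gt1.symm, gvs.symm, gv0.symm, gv2.symm,
        c (p 1) (p 0), c (p 2) s, c (p 2) t, c (p 0) s, c t v, c (p 1) v]

/-- If an edge at the vertex `s` of the diamond is subdivided and the new vertex is joined to the
far end of the strip, then three disjoint connectors arise, except for the smallest strip with
one diamond, which becomes the prism. -/
lemma OneOn.base_of_subdivided [DecidableEq V] {G B : SimpleGraph V} {X : Finset V} {p : ℕ → V}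
    {s t b v : V} {m : ℕ} (h : OneOn B X p s t m) (hX : EdgesIn B X) (hm : 3 ≤ m)
    (S : SubdividedFrom G B X s b (p (m - 1)) v) (hG : ¬ Bad G) : Base (insert v X) G := by
  have hne : ∀ w ∈ X, w ≠ v := fun w hw h => S.hv (h ▸ hw)
  have hnd : ∀ z w, z ≠ s → w ≠ s → B.Adj z w → G.Adj z w := fun z w hz hw hzw =>
    S.adj_of_adj hX hzw (by rw [ne_eq, Sym2.eq_iff]; tauto)
  have hp : ∀ i, i < m → p i ≠ s := h.ne_s
  have L := h.diamondLadder le_rfl hm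
  have W : StripWithThree G p s t v m :=
    { inj := h.inj
      step1 := fun i hi him => hnd _ _ (hp _ (by omega)) (hp _ (by omega)) (L.step1 i hi him)
      step2 := fun i hi => hnd _ _ (hp _ (by omega)) (hp _ (by omega)) (L.step2 i hi)
      ne_s := h.ne_s
      ne_t := h.ne_t
      ne_v := fun i hi => hne _ ((h.mem _).2 (Or.inl ⟨i, hi, rfl⟩))
      st := h.st.ne
      sv := hne _ ((h.mem _).2 (by simp))
      tv := hne _ ((h.mem _).2 (by simp))
      last := ((S.adj_v _).2 (by simp)).symm
      s_v := ((S.adj_v _).2 (by simp)).symm }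
  have n01 : p 0 ≠ p 1 := fun h' => by
    have := h.inj _ _ (by omega) (by omega) h'
    omega
  have t0 := h.ne_t 0 (by omega)
  have t1 := h.ne_t 1 (by omega)
  have ht0 := hnd _ _ h.st.ne' (hp 0 (by omega)) L.t0
  have ht1 := hnd _ _ h.st.ne' (hp 1 (by omega)) L.t1
  have hsz : ∀ z, B.Adj s z → z ≠ b → G.Adj s z := fun z hz hzb =>
    S.adj_of_adj hX hz (by
      rw [ne_eq, Sym2.eq_iff]
      rintro (⟨-, h'⟩ | ⟨-, h'⟩)
      · exact hzb h'
      · exact hz.ne h'.symm)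
  rcases (h.adj_s hX hm b).1 S.ab with rfl | rfl | rfl
  · exact absurd (W.bad_of_st hm ((S.adj_v _).2 (by simp)).symm (hsz _ L.s0 t0) (hsz _ L.s1 t1)
      ht0 ht1) hG
  · by_cases hm4 : 4 ≤ m
    · exact absurd (W.bad_of_s0 hm4 (hsz _ L.st t0.symm) (hsz _ L.s1 n01.symm) ht0 ht1) hG
    · obtain rfl : m = 3 := by omega
      exact .prism _ (h.prismOn S)
  · by_cases hm4 : 4 ≤ m
    · exact absurd (W.bad_of_s1 hm4 (hsz _ L.st t1.symm) ((S.adj_v _).2 (by simp)).symm ht0 ht1) hG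
    · obtain rfl : m = 3 := by omega
      exact .prism _ (h.swap_tips.prismOn S)

/-- If an edge at the vertex `s` of one diamond is subdivided and the new vertex is joined to the
vertex `s'` of the other one, then `t'` serves as a path between the tips of the other diamond,
and `s'` becomes the far end of a strip. -/
lemma TwoOn.bad_of_subdivided [DecidableEq V] {G B : SimpleGraph V} {X : Finset V} {p : ℕ → V}
    {s t s' t' b v : V} {m : ℕ} (h : TwoOn B X p s t s' t' m) (hX : EdgesIn B X) (hm : 3 ≤ m)
    (S : SubdividedFrom G B X s b s' v) : Bad G := by
  have hne : ∀ w ∈ X, w ≠ v := fun w hw h => S.hv (h ▸ hw)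
  have hnd : ∀ z w, z ≠ s → w ≠ s → B.Adj z w → G.Adj z w := fun z w hz hw hzw =>
    S.adj_of_adj hX hzw (by rw [ne_eq, Sym2.eq_iff]; tauto)
  have hp : ∀ i, i < m → p i ≠ s := h.ne_s
  have L := h.doubleLadder le_rfl hm
  have hn := h.nodup
  simp only [List.nodup_cons, List.mem_cons, List.not_mem_nil, or_false, not_or,
          List.nodup_nil, and_true, not_false_eq_true] at hn
  obtain ⟨⟨n1, n2, n3⟩, ⟨n4, n5⟩, n6⟩ := hn
  have n01 : p 0 ≠ p 1 := fun h' => by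
    have := h.inj _ _ (by omega) (by omega) h'
    omega
  have vt' : v ≠ t' := (hne _ ((h.mem _).2 (by simp))).symm
  have T : TailLadder G p s' t' m :=
    { L.tail with
      step1 := fun i hi him => hnd _ _ (hp _ (by omega)) (hp _ (by omega)) (L.tail.step1 i hi him)
      step2 := fun i hi => hnd _ _ (hp _ (by omega)) (hp _ (by omega)) (L.tail.step2 i hi)
      s0 := hnd _ _ (Ne.symm n2) (hp _ (by omega)) L.tail.s0
      s1 := hnd _ _ (Ne.symm n2) (hp _ (by omega)) L.tail.s1
      t0 := hnd _ _ (Ne.symm n3) (hp _ (by omega)) L.tail.t0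
      t1 := hnd _ _ (Ne.symm n3) (hp _ (by omega)) L.tail.t1 }
  obtain ⟨Q, key⟩ := T.bypass hm
  refine Bad.of_bypass_path T.t1.symm T.t0 ?_
  have l0 : snocSeq p m s' 0 = p 0 := snocSeq_lt (by omega)
  have l1 : snocSeq p m s' 1 = p 1 := snocSeq_lt (by omega)
  have hsnoc : ∀ w, (∀ i, i < m → p i ≠ w) → s' ≠ w → ∀ i, i < m + 1 → snocSeq p m s' i ≠ w := by
    intro w h1 h2 i _
    unfold snocSeq
    split_ifs with h'
    · exact h1 i h'
    · exact h2
  have W : StripWithThree (bypass G {p (m - 2), t', p (m - 1)} (p (m - 2)) (p (m - 1)))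
      (snocSeq p m s') s t v (m + 1) :=
    { Q with
      ne_s := hsnoc s h.ne_s (Ne.symm n2)
      ne_t := hsnoc t h.ne_t (Ne.symm n4)
      ne_v := hsnoc v (fun i hi => hne _ ((h.mem _).2 (Or.inl ⟨i, hi, rfl⟩)))
        (hne _ ((h.mem _).2 (by simp)))
      st := n1
      sv := hne _ ((h.mem _).2 (by simp))
      tv := hne _ ((h.mem _).2 (by simp))
      last := by
        rw [show m + 1 - 1 = m by omega, snocSeq_self]
        exact key _ _ n6 vt' ((S.adj_v _).2 (by simp)).symm
      s_v := key _ _ n3 vt' ((S.adj_v _).2 (by simp)).symm }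
  have nt0 := L.tail.ne_t 0 (by omega)
  have nt1 := L.tail.ne_t 1 (by omega)
  have t0 := h.ne_t 0 (by omega)
  have t1 := h.ne_t 1 (by omega)
  have ht0 := key _ _ n5 nt0 (hnd _ _ h.st.ne' (hp 0 (by omega)) L.t0)
  have ht1 := key _ _ n5 nt1 (hnd _ _ h.st.ne' (hp 1 (by omega)) L.t1)
  rw [← l0] at ht0
  rw [← l1] at ht1
  have hsz : ∀ z, B.Adj s z → z ≠ b → z ≠ t' →
      (bypass G {p (m - 2), t', p (m - 1)} (p (m - 2)) (p (m - 1))).Adj s z :=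
    fun z hz hzb hzt => key _ _ n3 hzt (S.adj_of_adj hX hz (by
      rw [ne_eq, Sym2.eq_iff]
      rintro (⟨-, h'⟩ | ⟨-, h'⟩)
      · exact hzb h'
      · exact hz.ne h'.symm))
  rcases (h.adj_s hX hm b).1 S.ab with rfl | rfl | rfl
  · refine W.bad_of_st (by omega) (key _ _ n5 vt' ((S.adj_v _).2 (by simp)).symm) ?_ ?_ ht0 ht1
    · rw [l0]; exact hsz _ L.s0 t0 nt0
    · rw [l1]; exact hsz _ L.s1 t1 nt1
  · refine W.bad_of_s0 (by omega) (hsz _ L.st t0.symm n5) ?_ ht0 ht1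
    rw [l1]; exact hsz _ L.s1 n01.symm nt1
  · refine W.bad_of_s1 (by omega) (hsz _ L.st t1.symm n5) ?_ ht0 ht1
    rw [l1]; exact key _ _ nt1 vt' ((S.adj_v _).2 (by simp)).symm

/-- The prism leads to no further base graph: any edge and any third vertex give one of four
graphs, all of which have three disjoint connectors. -/
lemma PrismOn.bad_of_subdivided {G B : SimpleGraph V} {X : Finset V} {f : Fin 3 → Fin 2 → V}
    {a b c v : V} (h : PrismOn B X f) (hX : EdgesIn B X) (S : SubdividedFrom G B X a b c v) :
    Bad G := by
  have hq : ∀ i e, f i e ≠ v := fun i e h' => S.hv (h' ▸ (h.mem _).2 ⟨i, e, rfl⟩)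
  have hq' : ∀ i e, v ≠ f i e := fun i e => (hq i e).symm
  have hva := (S.adj_v a).2 (by simp)
  have hvb := (S.adj_v b).2 (by simp)
  have hvc := (S.adj_v c).2 (by simp)
  obtain ⟨i, e, rfl⟩ := (h.mem a).1 (hX _ _ S.ab)
  obtain ⟨j, d, rfl⟩ := (h.mem b).1 (hX _ _ S.ab.symm)
  obtain ⟨k, g, rfl⟩ := (h.mem c).1 S.hc
  have hadj : ∀ i' j' e' d', (i' ≠ j' ∧ e' = d') ∨ (i' = j' ∧ e' ≠ d') →
      ¬ ((i' = i ∧ e' = e) ∧ (j' = j ∧ d' = d) ∨ (i' = j ∧ e' = d) ∧ (j' = i ∧ d' = e)) →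
      G.Adj (f i' e') (f j' d') := by
    intro i' j' e' d' h1 h2
    refine S.adj_of_adj hX ((h.adj _ _ _ _).2 h1) ?_
    rw [ne_eq, Sym2.eq_iff, h.eq_iff, h.eq_iff, h.eq_iff, h.eq_iff]
    exact h2
  rcases (h.adj _ _ _ _).1 S.ab with ⟨hij, rfl⟩ | ⟨rfl, hed⟩
  · obtain ⟨l, hli, hlj, hl⟩ := fin3_third i j hij
    obtain ⟨d, hde, hd⟩ := fin2_other e
    rcases hd g with rfl | rfl
    · have hk : k = l := by
        rcases hl k with rfl | rfl | rfl
        · exact absurd rfl S.hca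
        · exact absurd rfl S.hcb
        · rfl
      subst hk
      refine bad_of_prism_sub_same (a₂ := f k g) (a₀ := f i g) (a₁ := f j g) (b₂ := f k d)
        (b₀ := f i d) (b₁ := f j d) (v := v) ?_
        ⟨hvc.symm, hva, hvb, ?_, ?_, ?_, ?_, ?_, ?_, ?_⟩
      · simp [h.eq_iff, hq, hij, hli, hlj, hde.symm]
      all_goals
        apply hadj <;> simp [hij, hli, hlj, hij.symm, hde, hde.symm]
    · rcases hl k with rfl | rfl | rfl
      · refine bad_of_prism_sub_mate (b₀ := f k g) (a₀ := f k e) (b₁ := f j g) (v := v)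
          (a₁ := f j e) (b₂ := f l g) (a₂ := f l e) ?_
          ⟨hvc.symm, hva, hvb, ?_, ?_, ?_, ?_, ?_, ?_, ?_⟩
        · simp [h.eq_iff, hq, hq', hij, hli.symm, hlj.symm, hde, hde.symm]
        all_goals
          apply hadj <;> simp [hij, hli, hlj, hij.symm, hli.symm, hde, hde.symm]
      · refine bad_of_prism_sub_mate (b₀ := f k g) (a₀ := f k e) (b₁ := f i g) (v := v)
          (a₁ := f i e) (b₂ := f l g) (a₂ := f l e) ?_
          ⟨hvc.symm, hvb, hva, ?_, ?_, ?_, ?_, ?_, ?_, ?_⟩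
        · simp [h.eq_iff, hq, hq', hij.symm, hli.symm, hlj.symm, hde, hde.symm]
        all_goals
          apply hadj <;> simp [hij, hli, hlj, hij.symm, hlj.symm, hde, hde.symm]
      · refine bad_of_prism_sub_opp (a₀ := f i e) (a₁ := f j e) (b₂ := f k g) (v := v)
          (a₂ := f k e) (b₀ := f i g) (b₁ := f j g) ?_
          ⟨hva.symm, hvb, hvc, ?_, ?_, ?_, ?_, ?_, ?_, ?_⟩
        · simp [h.eq_iff, hq, hq', hij, hli, hlj, hli.symm, hlj.symm, hde, hde.symm]
        all_goals
          apply hadj <;> simp [hij, hli, hlj, hij.symm, hli.symm, hde, hde.symm]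
  · have key : ∀ e d : Fin 2, e ≠ d → g = e →
        (∀ i' j' e' d', (i' ≠ j' ∧ e' = d') ∨ (i' = j' ∧ e' ≠ d') →
          ¬ (i' = i ∧ j' = i) → G.Adj (f i' e') (f j' d')) → G.Adj v (f i e) → G.Adj v (f i d) →
        f k g ≠ f i e → Bad G := by
      rintro e d hed rfl hadj hve hvd hne
      have hki : k ≠ i := by
        rintro rfl
        exact hne rfl
      obtain ⟨l, hli, hlk, -⟩ := fin3_third i k hki.symm
      refine bad_of_prism_sub_rung (a₁ := f k g) (a₀ := f i g) (b₁ := f k d) (a₂ := f l g)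
        (b₂ := f l d) (v := v) (b₀ := f i d) ?_
        ⟨?_, ?_, ?_, ?_, hvc.symm, hve, hvd, ?_, ?_, ?_⟩
      · simp [h.eq_iff, hq, hq', hki, hki.symm, hli, hli.symm, hlk.symm, hed]
      all_goals
        apply hadj <;> simp [hki, hki.symm, hli, hlk, hlk.symm, hed]
    have hadj' : ∀ i' j' e' d', (i' ≠ j' ∧ e' = d') ∨ (i' = j' ∧ e' ≠ d') →
          ¬ (i' = i ∧ j' = i) → G.Adj (f i' e') (f j' d') := fun i' j' e' d' h1 h2 =>
      hadj _ _ _ _ h1 (by tauto)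
    by_cases hge : g = e
    · exact key e d hed hge hadj' hva hvb S.hca
    · have hgd : g = d :=
        (by decide : ∀ g e d : Fin 2, e ≠ d → ¬ g = e → g = d) g e d hed hge
      exact key d e hed.symm hgd hadj' hvb hva S.hcb

/-- If subdividing an edge of a base graph and joining the new vertex to a third vertex yields
a graph of minimum degree at least `3` without diamonds, and no three disjoint connectors arise,
then the result is a base graph: the triangular prism. -/
lemma SubdividedFrom.base_insert [DecidableEq V] {G B : SimpleGraph V} {X : Finset V}
    {a b c v : V} (S : SubdividedFrom G B X a b c v) (hB : Base X B) (hX : EdgesIn B X)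
    (hdeg : ∀ z ∈ X, 2 < (G.neighborSet z).ncard) (hD : NoDiamond G) (hG : ¬ Bad G) :
    Base (insert v X) G := by
  cases hB with
  -- strips and books have two vertices of degree at most `2`, which cannot both be `c`
  | strip p r hr h =>
    have h0 := S.eq_of_low hdeg ((h.mem _).2 ⟨0, by omega, rfl⟩) _ _ (h.adj_zero hX hr)
    have h1 := S.eq_of_low hdeg ((h.mem _).2 ⟨r - 1, by omega, rfl⟩) _ _ (h.adj_last hX hr)
    have := h.inj 0 (r - 1) (by omega) (by omega) (h0.trans h1.symm)
    omega
  | book g k hc h =>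
    obtain ⟨x, y, hx, hy, hxy, hxg, hxk, hyg, hyk⟩ := h.exists_pages (by omega)
    have h0 := S.eq_of_low hdeg hx _ _ (h.adj_page hX hxg hxk)
    have h1 := S.eq_of_low hdeg hy _ _ (h.adj_page hX hyg hyk)
    exact absurd (h0.trans h1.symm) hxy
  | one p s t m hm h =>
    obtain rfl := S.eq_of_low hdeg ((h.mem _).2 (Or.inl ⟨m - 1, by omega, rfl⟩)) _ _
      (h.adj_last hX hm)
    have n01 : p 0 ≠ p 1 := fun h' => by
      have := h.inj _ _ (by omega) (by omega) h'
      omega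
    have hn : ¬ B.Adj (p 0) (p 1) := by
      rw [h.adj _ _ (by omega) (by omega)]
      omega
    rcases S.meets_diamond hX hD n01 hn (h.adj_s hX hm) (h.swap.adj_s hX hm) with
      (rfl | rfl | rfl | rfl) | h' | h'
    · exact h.base_of_subdivided hX hm S hG
    · exact h.swap.base_of_subdivided hX hm S hG
    · exact h.base_of_subdivided hX hm S.symm hG
    · exact h.swap.base_of_subdivided hX hm S.symm hG
    · exact absurd h' (h.ne_s _ (by omega))
    · exact absurd h' (h.ne_t _ (by omega))
  | two p s t s' t' m hm h =>
    exfalso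
    apply hG
    have n01 : p 0 ≠ p 1 := fun h' => by
      have := h.inj _ _ (by omega) (by omega) h'
      omega
    have hn : ¬ B.Adj (p 0) (p 1) := by
      rw [h.adj _ _ (by omega) (by omega)]
      omega
    have n01' : p (m - 1 - 0) ≠ p (m - 1 - 1) := fun h' => by
      have := h.inj _ _ (by omega) (by omega) h'
      omega
    have hn' : ¬ B.Adj (p (m - 1 - 0)) (p (m - 1 - 1)) := by
      rw [h.adj _ _ (by omega) (by omega)]
      omega
    have h1 := S.meets_diamond hX hD n01 hn (h.adj_s hX hm) (h.swap.adj_s hX hm)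
    have h2 := S.meets_diamond hX hD n01' hn' ((h.rev hm).adj_s hX hm)
      ((h.rev hm).swap.adj_s hX hm)
    -- no edge joins the diamonds, so the subdivided edge meets one of them and `c` lies in the other
    have key : ∀ p s t s' t', TwoOn B X p s t s' t' m → (a = s ∨ a = t ∨ b = s ∨ b = t) →
        (c = s' ∨ c = t') → Bad G := by
      intro p s t s' t' h ha hc
      have key' : ∀ s' t', TwoOn B X p s t s' t' m → c = s' → Bad G := by
        rintro s' t' h rfl
        rcases ha with rfl | rfl | rfl | rfl
        · exact h.bad_of_subdivided hX hm S
        · exact h.swap.bad_of_subdivided hX hm S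
        · exact h.bad_of_subdivided hX hm S.symm
        · exact h.swap.bad_of_subdivided hX hm S.symm
      rcases hc with hc | hc
      · exact key' _ _ h hc
      · refine key' t' s' ?_ hc
        have h3 := ((h.rev hm).swap).rev hm
        refine { h3 with
          inj := h.inj
          ne_s := h.ne_s
          ne_t := h.ne_t
          ne_s' := h.ne_t'
          ne_t' := h.ne_s'
          mem := fun x => by rw [h.mem]; grind
          adj := h.adj
          sp := h.sp
          tp := h.tp
          sp' := h.tp'
          tp' := h.sp' }
    rcases h1 with h1 | h1 <;> rcases h2 with h2 | h2
    · exfalso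
      have := h.nodup
      simp only [List.nodup_cons, List.mem_cons, List.not_mem_nil, or_false, not_or,
          List.nodup_nil, and_true, not_false_eq_true] at this
      obtain ⟨⟨n1, n2, n3⟩, ⟨n4, n5⟩, n6⟩ := this
      have e1 := h.ss'
      have e2 := h.ts'
      have e3 := h.st''
      have e4 := h.tt'
      have hab := S.ab
      have hba := S.ab.symm
      rcases h1 with rfl | rfl | rfl | rfl <;> rcases h2 with rfl | rfl | rfl | rfl <;>
        contradiction
    · exact key _ _ _ _ _ h h1 h2
    · exact key _ _ _ _ _ (h.rev hm) h2 h1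
    · exfalso
      have := h.nodup
      simp only [List.nodup_cons, List.mem_cons, List.not_mem_nil, or_false, not_or,
          List.nodup_nil, and_true, not_false_eq_true] at this
      obtain ⟨⟨n1, n2, n3⟩, ⟨n4, n5⟩, n6⟩ := this
      rcases h1 with rfl | rfl <;> rcases h2 with rfl | rfl <;> contradiction
  | prism f h => exact absurd (h.bad_of_subdivided hX S) hG

/-! ### Base graphs with copies of `K₄` attached -/

/-- `x` is a vertex of the copy of `K₄` attached at `u`, whose further vertices are `q u i`. -/
def InBlock (q : V → Fin 3 → V) (u x : V) : Prop := x = u ∨ ∃ i, x = q u i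

/-- `G`, on the vertex set `X`, arises from the base graph `B` on `X₀` by attaching a `K₄` at each
vertex `u ∈ U`; its new vertices are `q u 0`, `q u 1`, `q u 2`. -/
structure AttachOn (X : Finset V) (G : SimpleGraph V) (X₀ : Finset V) (B : SimpleGraph V)
    (U : Finset V) (q : V → Fin 3 → V) : Prop where
  base : Base X₀ B
  edges : EdgesIn B X₀
  sub : U ⊆ X₀
  deg : ∀ u ∈ U, (B.neighborSet u).ncard ≤ 2
  inj : ∀ u ∈ U, ∀ u' ∈ U, ∀ i j, q u i = q u' j → u = u' ∧ i = j
  new : ∀ u ∈ U, ∀ i, q u i ∉ X₀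
  mem : ∀ x, x ∈ X ↔ x ∈ X₀ ∨ ∃ u ∈ U, ∃ i, x = q u i
  adj : ∀ x y, G.Adj x y ↔ B.Adj x y ∨ ∃ u ∈ U, x ≠ y ∧ InBlock q u x ∧ InBlock q u y

/-- `G`, on the vertex set `X`, is a base graph with copies of `K₄` attached at some of its vertices
of degree at most `2`. -/
def Class (X : Finset V) (G : SimpleGraph V) : Prop := ∃ X₀ B U q, AttachOn X G X₀ B U q

lemma Base.class {X : Finset V} {G : SimpleGraph V} (h : Base X G) (hX : EdgesIn G X) :
    Class X G :=
  ⟨X, G, ∅, fun u _ => u, h, hX, by simp, by simp, by simp, by simp, by simp, by simp⟩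

/-- The copy of `K₄` attached at `u`. -/
lemma AttachOn.isNClique [DecidableEq V] {X X₀ U : Finset V} {G B : SimpleGraph V}
    {q : V → Fin 3 → V} (h : AttachOn X G X₀ B U q) {u : V} (hu : u ∈ U) :
    G.IsNClique 4 ({u, q u 0, q u 1, q u 2} : Finset V) := by
  have h0 : ∀ i, u ≠ q u i := fun i h' => h.new u hu i (h' ▸ h.sub hu)
  have h1 : ∀ i j, i ≠ j → q u i ≠ q u j := fun i j hij h' => hij (h.inj u hu u hu i j h').2
  have hmem : ∀ x ∈ ({u, q u 0, q u 1, q u 2} : Finset V), InBlock q u x := by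
    intro x hx
    simp only [Finset.mem_insert, Finset.mem_singleton] at hx
    rcases hx with rfl | rfl | rfl | rfl
    · exact Or.inl rfl
    · exact Or.inr ⟨0, rfl⟩
    · exact Or.inr ⟨1, rfl⟩
    · exact Or.inr ⟨2, rfl⟩
  refine ⟨fun x hx y hy hxy => (h.adj x y).2 (Or.inr ⟨u, hu, hxy, hmem x hx, hmem y hy⟩), ?_⟩
  rw [Finset.card_insert_of_notMem (by simp [h0]), Finset.card_insert_of_notMem (by simp [h1]),
    Finset.card_insert_of_notMem (by simp [h1]), Finset.card_singleton]

/-- Without `K₄`, only the base graph itself remains. -/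
lemma Class.base_of_no_clique {X : Finset V} {G : SimpleGraph V} (h : Class X G)
    (hG : ∀ Q : Finset V, ¬ G.IsNClique 4 Q) : Base X G := by
  classical
  obtain ⟨X₀, B, U, q, h⟩ := h
  have hU : ∀ u, u ∉ U := fun u hu => hG _ (h.isNClique hu)
  have hX : X = X₀ := by
    ext x
    rw [h.mem]
    simp [hU]
  have hB : G = B := by
    ext x y
    rw [h.adj]
    simp [hU]
  rw [hX, hB]
  exact h.base

/-- A `K₄` at a vertex of a graph of the class keeps the graph in the class, unless three disjoint
connectors arise. -/
lemma Class.attach [DecidableEq V] {A X : Finset V} {G₀ G : SimpleGraph V} (h : Class A G₀)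
    (hG : ¬ Bad G) {u x y z : V} (hu : u ∈ A) (hnd : [x, y, z].Nodup) (hx : x ∉ A) (hy : y ∉ A)
    (hz : z ∉ A) (hX : ∀ w, w ∈ X ↔ w ∈ A ∨ w = x ∨ w = y ∨ w = z)
    (hadj : ∀ v w, G.Adj v w ↔ G₀.Adj v w ∨ (v ≠ w ∧ (v = u ∨ v = x ∨ v = y ∨ v = z) ∧
      (w = u ∨ w = x ∨ w = y ∨ w = z))) : Class X G := by
  obtain ⟨X₀, B, U, q, h⟩ := h
  have hne : ∀ w ∈ A, w ≠ x ∧ w ≠ y ∧ w ≠ z := fun w hw =>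
    ⟨fun h => hx (h ▸ hw), fun h => hy (h ▸ hw), fun h => hz (h ▸ hw)⟩
  obtain ⟨hux, huy, huz⟩ := hne u hu
  have hle : G₀ ≤ G := fun v w hvw => (hadj v w).2 (Or.inl hvw)
  have hQ : G.IsNClique 4 ({u, x, y, z} : Finset V) := by
    refine ⟨fun v hv w hw hvw => (hadj v w).2 (Or.inr ⟨hvw, by simpa using hv, by simpa using hw⟩),
      ?_⟩
    simp only [List.nodup_cons, List.mem_cons, List.not_mem_nil, or_false, not_or] at hnd
    rw [Finset.card_insert_of_notMem (by simp [hux, huy, huz]),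
      Finset.card_insert_of_notMem (by simp [hnd]),
      Finset.card_insert_of_notMem (by simp [hnd]), Finset.card_singleton]
  have hXA : ∀ w, w ∈ X₀ → w ∈ A := fun w hw => (h.mem w).2 (Or.inl hw)
  have hqA : ∀ w ∈ U, ∀ i, q w i ∈ A := fun w hw i => (h.mem _).2 (Or.inr ⟨w, hw, i, rfl⟩)
  -- a second `K₄` at `u` is impossible
  have hblock : ∀ w ∈ U, ¬ InBlock q w u := by
    intro w hw hwu
    refine hG (bad_of_K4_K4 (u := u) hQ (R := {w, q w 0, q w 1, q w 2}) ?_ ?_)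
    · exact ⟨fun a ha b hb hab => hle ((h.isNClique hw).isClique ha hb hab),
        (h.isNClique hw).card_eq⟩
    · intro v
      constructor
      · rintro ⟨h1, h2⟩
        have hvA : v ∈ A := by
          simp only [Finset.mem_insert, Finset.mem_singleton] at h2
          rcases h2 with rfl | rfl | rfl | rfl
          · exact hXA _ (h.sub hw)
          · exact hqA w hw 0
          · exact hqA w hw 1
          · exact hqA w hw 2
        obtain ⟨n1, n2, n3⟩ := hne v hvA
        simpa [n1, n2, n3] using h1
      · rintro rfl
        refine ⟨by simp, ?_⟩
        rcases hwu with rfl | ⟨i, rfl⟩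
        · simp
        · fin_cases i <;> simp
  have huU : u ∉ U := fun h' => hblock u h' (Or.inl rfl)
  have huX : u ∈ X₀ := by
    rcases (h.mem u).1 hu with h' | ⟨w, hw, i, rfl⟩
    · exact h'
    · exact absurd (Or.inr ⟨i, rfl⟩) (hblock w hw)
  have hdeg : (B.neighborSet u).ncard ≤ 2 := by
    refine h.base.ncard_neighborSet_le_two h.edges
      (fun v w hvw => hle ((h.adj v w).2 (Or.inl hvw))) hG huX (q₁ := x) (q₂ := y) (q₃ := z)
      ⟨hnd, fun h' => hx (hXA _ h'), fun h' => hy (hXA _ h'), fun h' => hz (hXA _ h'), ?_, ?_, ?_,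
        ?_, ?_⟩
    all_goals
      rw [hadj]
      simp only [List.nodup_cons, List.mem_cons, List.not_mem_nil, or_false, not_or] at hnd
      simp [hux, huy, huz, hnd]
  have hold : ∀ w ∈ U, ∀ v, InBlock (Function.update q u ![x, y, z]) w v ↔ InBlock q w v := by
    intro w hw v
    have : w ≠ u := fun h' => huU (h' ▸ hw)
    simp [InBlock, Function.update_of_ne this]
  have hnew : ∀ v, InBlock (Function.update q u ![x, y, z]) u v ↔
      v = u ∨ v = x ∨ v = y ∨ v = z := by
    intro v
    simp [InBlock, Fin.exists_fin_succ]
  have hxyz : ∀ i, ![x, y, z] i ∉ A := by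
    intro i
    fin_cases i
    · exact hx
    · exact hy
    · exact hz
  have hupd : ∀ w ∈ U, Function.update q u ![x, y, z] w = q w := by
    intro w hw
    have : w ≠ u := fun h' => huU (h' ▸ hw)
    rw [Function.update_of_ne this]
  refine ⟨X₀, B, insert u U, Function.update q u ![x, y, z], h.base, h.edges, ?_, ?_, ?_, ?_, ?_,
    ?_⟩
  · intro w hw
    rcases Finset.mem_insert.1 hw with rfl | hw
    · exact huX
    · exact h.sub hw
  · intro w hw
    rcases Finset.mem_insert.1 hw with rfl | hw
    · exact hdeg
    · exact h.deg w hw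
  · intro w hw w' hw' i j hij
    rcases Finset.mem_insert.1 hw with h1 | h1 <;> rcases Finset.mem_insert.1 hw' with h2 | h2
    · rw [h1, h2, Function.update_self] at hij
      refine ⟨h1.trans h2.symm, ?_⟩
      simp only [List.nodup_cons, List.mem_cons, List.not_mem_nil, or_false, not_or] at hnd
      obtain ⟨⟨n1, n2⟩, n3, -⟩ := hnd
      fin_cases i <;> fin_cases j <;> simp_all [eq_comm]
    · rw [h1, Function.update_self, hupd w' h2] at hij
      exact absurd (hij ▸ hqA w' h2 j) (hxyz i)
    · rw [h2, Function.update_self, hupd w h1] at hij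
      exact absurd (hij ▸ hqA w h1 i) (hxyz j)
    · rw [hupd w h1, hupd w' h2] at hij
      exact h.inj w h1 w' h2 i j hij
  · intro w hw i
    rcases Finset.mem_insert.1 hw with rfl | hw
    · rw [Function.update_self]
      exact fun h' => hxyz i (hXA _ h')
    · rw [hupd w hw]
      exact h.new w hw i
  · intro w
    have h1 : (∃ i, w = ![x, y, z] i) ↔ w = x ∨ w = y ∨ w = z := by
      simp [Fin.exists_fin_succ]
    have h2 : (∃ a ∈ U, ∃ i, w = Function.update q u ![x, y, z] a i) ↔ ∃ a ∈ U, ∃ i, w = q a i :=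
      exists_congr fun a => and_congr_right fun ha => by rw [hupd a ha]
    simp only [Finset.mem_insert, exists_eq_or_imp, Function.update_self]
    rw [hX, h.mem, h1, h2, or_assoc]
    exact or_congr_right or_comm
  · intro v w
    have h2 : (∃ a ∈ U, v ≠ w ∧ InBlock (Function.update q u ![x, y, z]) a v ∧
        InBlock (Function.update q u ![x, y, z]) a w) ↔
        ∃ a ∈ U, v ≠ w ∧ InBlock q a v ∧ InBlock q a w :=
      exists_congr fun a => and_congr_right fun ha => by rw [hold a ha, hold a ha]
    simp only [Finset.mem_insert, exists_eq_or_imp, hnew]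
    rw [hadj, h.adj, h2, or_assoc]
    exact or_congr_right or_comm

/-! ### The bound on the number of edges -/

/-- The two further elements of a set of four. -/
lemma exists_of_card_four [DecidableEq V] {Y : Finset V} (hY : Y.card = 4) {x y : V} (hx : x ∈ Y)
    (hy : y ∈ Y) (hxy : x ≠ y) :
    ∃ z w, (∀ v, v ∈ Y ↔ v = x ∨ v = y ∨ v = z ∨ v = w) ∧ z ≠ x ∧ z ≠ y ∧ w ≠ x ∧ w ≠ y ∧ z ≠ w := by
  obtain ⟨z, w, hzw, h⟩ := Finset.card_eq_two.1
    (by rw [Finset.card_erase_of_mem (by simp [hxy.symm, hy]), Finset.card_erase_of_mem hx, hY] :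
      ((Y.erase x).erase y).card = 2)
  have h' : ∀ v, (v ≠ y ∧ v ≠ x ∧ v ∈ Y) ↔ v = z ∨ v = w := fun v => by
    rw [← Finset.mem_erase, ← Finset.mem_erase, h]
    simp
  have hz := (h' z).2 (Or.inl rfl)
  have hw := (h' w).2 (Or.inr rfl)
  refine ⟨z, w, fun v => ?_, hz.2.1, hz.1, hw.2.1, hw.1, hzw⟩
  rw [← h' v]
  by_cases h1 : v = x
  · simp [h1, hx]
  by_cases h2 : v = y
  · simp [h2, hy]
  simp [h1, h2]

lemma edgesIn_delete [DecidableEq V] {G : SimpleGraph V} {X : Finset V} (hX : EdgesIn G X)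
    (v : V) : EdgesIn (within G {v}ᶜ) (X.erase v) :=
  fun _ _ h => Finset.mem_erase.2 ⟨h.2.1, hX _ _ h.1⟩

lemma edgesIn_bypass [DecidableEq V] {G : SimpleGraph V} {X : Finset V} (hX : EdgesIn G X)
    {a v b : V} (h1 : G.Adj a v) (h2 : G.Adj v b) (hab : a ≠ b) :
    EdgesIn (bypass G {a, v, b} a b) (X.erase v) := by
  intro x y hxy
  rw [bypass_path_adj h1.ne h2.ne hab] at hxy
  rcases hxy with ⟨rfl, rfl⟩ | ⟨rfl, rfl⟩ | h
  · exact Finset.mem_erase.2 ⟨h1.ne, hX _ _ h1⟩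
  · exact Finset.mem_erase.2 ⟨h2.ne', hX _ _ h2.symm⟩
  · exact Finset.mem_erase.2 ⟨h.2.1, hX _ _ h.1⟩

lemma isNClique_four [DecidableEq V] {G : SimpleGraph V} {a b c d : V} (hab : G.Adj a b)
    (hac : G.Adj a c) (had : G.Adj a d) (hbc : G.Adj b c) (hbd : G.Adj b d) (hcd : G.Adj c d) :
    G.IsNClique 4 ({a, b, c, d} : Finset V) := by
  refine SimpleGraph.IsNClique.insert (n := 3) (SimpleGraph.is3Clique_triple_iff.2 ⟨hbc, hbd, hcd⟩)
    fun x hx => ?_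
  simp only [Finset.mem_insert, Finset.mem_singleton] at hx
  rcases hx with rfl | rfl | rfl
  · exact hab
  · exact hac
  · exact had

/-- A vertex of degree `3` lies in a `K₄` or has two non-adjacent neighbours. -/
lemma exists_not_adj_of_ncard_eq_three {G : SimpleGraph V} {v : V}
    (h : (G.neighborSet v).ncard = 3) (hQ : ∀ Q : Finset V, v ∈ Q → ¬ G.IsNClique 4 Q) :
    ∃ a b c, (∀ z, G.Adj v z ↔ z = a ∨ z = b ∨ z = c) ∧ a ≠ b ∧ c ≠ a ∧ c ≠ b ∧ ¬ G.Adj a b := by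
  classical
  obtain ⟨a, b, c, hab, hac, hbc, hN⟩ := Set.ncard_eq_three.1 h
  have hv : ∀ z, G.Adj v z ↔ z = a ∨ z = b ∨ z = c := fun z => by
    rw [← SimpleGraph.mem_neighborSet, hN]
    simp
  by_cases h1 : G.Adj a b
  · by_cases h2 : G.Adj a c
    · by_cases h3 : G.Adj b c
      · have va := (hv a).2 (by simp)
        have vb := (hv b).2 (by simp)
        have vc := (hv c).2 (by simp)
        exact absurd (isNClique_four va vb vc h1 h2 h3) (hQ _ (by simp))
      · exact ⟨b, c, a, fun z => by rw [hv]; tauto, hbc, hab, hac, h3⟩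
    · exact ⟨a, c, b, fun z => by rw [hv]; tauto, hac, hab.symm, hbc, h2⟩
  · exact ⟨a, b, c, hv, hab, hac.symm, hbc.symm, h1⟩

lemma bad_of_ear_on_K4 [DecidableEq V] {G : SimpleGraph V} {Y : Finset V} (hY : Y.card = 4)
    (hc : ∀ x ∈ Y, ∀ y ∈ Y, x ≠ y → G.Adj x y) {v x y : V} (hv : v ∉ Y) (hx : x ∈ Y) (hy : y ∈ Y)
    (hxy : x ≠ y) (hvx : G.Adj v x) (hvy : G.Adj v y) : Bad G := by
  obtain ⟨z, w, hm, hzx, hzy, hwx, hwy, hzw⟩ := exists_of_card_four hY hx hy hxy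
  have hz : z ∈ Y := (hm z).2 (by simp)
  have hw : w ∈ Y := (hm w).2 (by simp)
  have hne : ∀ u ∈ Y, u ≠ v := fun u hu h => hv (h ▸ hu)
  refine bad_of_K4_ear (q₀ := x) (q₁ := y) (q₂ := z) (q₃ := w) (z := v) ?_
    ⟨hc _ hx _ hw hwx.symm, hc _ hw _ hy hwy, hc _ hw _ hz hzw.symm, hc _ hx _ hy hxy,
      hc _ hy _ hz hzy.symm, hc _ hx _ hz hzx.symm, hvx.symm, hvy⟩
  simp [hxy, hzx.symm, hwx.symm, hzy.symm, hwy.symm, hzw, hne x hx, hne y hy, hne z hz, hne w hw]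

/-- `K₄` on `g, a, d, b` without its edge `ab`, and `v` joined to `a, b, g`: this is a wheel with
the four spokes `ga, gv, gb, gd`. -/
lemma bad_of_hub_wheel {G : SimpleGraph V} {g a d b v : V} (hnd : [g, a, d, b].Nodup)
    (hv : v ∉ [g, a, d, b]) (hgv : G.Adj g v) (hva : G.Adj v a) (hvb : G.Adj v b)
    (h : G.Adj g d ∧ G.Adj d a ∧ G.Adj d b ∧ G.Adj g a ∧ G.Adj g b) : Bad G := by
  refine bad_of_wheel (g := g) (a := a) (c := b) (b := v) (d := d) ?_ ⟨hgv, hva, hvb, h⟩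
  simp only [List.nodup_cons, List.mem_cons] at hnd hv ⊢
  grind

/-- The equality case of the bound `2n - 2`. Deleting a vertex of degree `2`, or splitting off a
vertex of degree `3`, gives a smaller equality case, hence `K₄`; undoing the step gives `K₄` with
a second path along an edge, or a wheel. -/
lemma complete_of_ncard_edgeSet [Fintype V] {n : ℕ} (ih : ∀ m, 0 < m → m < n → CountBound V m)
    {X : Finset V} {G : SimpleGraph V} (hn : X.card = n) (hX : EdgesIn G X) (hG : ¬ Bad G)
    (he : G.edgeSet.ncard + 2 = 2 * n) :
    n = 1 ∨ (n = 4 ∧ ∀ x ∈ X, ∀ y ∈ X, x ≠ y → G.Adj x y) := by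
  classical
  by_cases h1 : n = 1
  · exact Or.inl h1
  right
  obtain ⟨v, hv, hd⟩ := exists_ncard_neighborSet_le_three hX (by omega)
  have hcard : (X.erase v).card = n - 1 := by rw [Finset.card_erase_of_mem hv, hn]
  have hdel := ncard_edgeSet_delete G v
  have hle := within_le G {v}ᶜ
  have ihd := ih (n - 1) (by omega) (by omega) _ _ hcard (edgesIn_delete hX v)
    (fun h => hG (h.mono hle))
  have hsub := Set.ncard_le_ncard (neighborSet_subset_erase hX v)
  rw [Set.ncard_coe_finset, hcard] at hsub
  have hd2 : 2 ≤ (G.neighborSet v).ncard := by omega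
  by_cases hd' : (G.neighborSet v).ncard = 2
  · obtain ⟨x, y, hxy, hN⟩ := Set.ncard_eq_two.1 hd'
    have hv' : ∀ z, G.Adj v z ↔ z = x ∨ z = y := fun z => by
      rw [← SimpleGraph.mem_neighborSet, hN]
      simp
    have hvx := (hv' x).2 (by simp)
    have hvy := (hv' y).2 (by simp)
    rcases ihd.2 (by omega) with h | ⟨h4, hc⟩
    · omega
    · refine absurd (bad_of_ear_on_K4 (hcard.trans h4) (fun a ha b hb hab => hle (hc a ha b hb hab))
        (Finset.notMem_erase v X) ?_ ?_ hxy hvx hvy) hG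
      · exact Finset.mem_erase.2 ⟨hvx.ne', hX _ _ hvx.symm⟩
      · exact Finset.mem_erase.2 ⟨hvy.ne', hX _ _ hvy.symm⟩
  have hd3 : (G.neighborSet v).ncard = 3 := by omega
  by_cases hQ : ∃ Q : Finset V, v ∈ Q ∧ G.IsNClique 4 Q
  · obtain ⟨Q, -, hQ⟩ := hQ
    rcases K4_peel ih hn hX hG hQ (by omega) with rfl | h
    · exact ⟨hn.symm.trans hQ.card_eq, fun x hx y hy hxy => hQ.isClique hx hy hxy⟩
    · omega
  push Not at hQ
  obtain ⟨a, b, c, hv', hab, hca, hcb, hnab⟩ := exists_not_adj_of_ncard_eq_three hd3 hQ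
  have hva := (hv' a).2 (by simp)
  have hvb := (hv' b).2 (by simp)
  have hvc := (hv' c).2 (by simp)
  have hmem : ∀ z, G.Adj v z → z ∈ X.erase v := fun z hz =>
    Finset.mem_erase.2 ⟨hz.ne', hX _ _ hz.symm⟩
  have hcount := ncard_edgeSet_bypass hva.symm hvb hab hnab
  have ihb := ih (n - 1) (by omega) (by omega) _ _ hcard (edgesIn_bypass hX hva.symm hvb hab)
    (fun h => hG (h.of_bypass_path hva.symm hvb))
  rcases ihb.2 (by omega) with h | ⟨h4, hc⟩
  · omega
  exfalso
  obtain ⟨z, w, hm, hza, hzb, hwa, hwb, hzw⟩ :=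
    exists_of_card_four (hcard.trans h4) (hmem a hva) (hmem b hvb) hab
  have key : ∀ x ∈ X.erase v, ∀ y ∈ X.erase v, x ≠ y → y ≠ a → y ≠ b → G.Adj x y := by
    intro x hx y hy hxy hya hyb
    rcases (bypass_path_adj hva.ne' hvb.ne hab).1 (hc x hx y hy hxy) with h | h | h
    · exact absurd h.2 hyb
    · exact absurd h.2 hya
    · exact h.1
  have hw' : ∃ d ∈ X.erase v, d ≠ a ∧ d ≠ b ∧ d ≠ c := by
    by_cases hcz : c = z
    · exact ⟨w, (hm w).2 (by simp), hwa, hwb, fun h => hzw (hcz.symm.trans h.symm)⟩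
    · exact ⟨z, (hm z).2 (by simp), hza, hzb, fun h => hcz h.symm⟩
  obtain ⟨d, hd, hda, hdb, hdc⟩ := hw'
  have hdv : d ≠ v := (Finset.mem_erase.1 hd).1
  refine hG (bad_of_hub_wheel (g := c) (a := a) (d := d) (b := b) (v := v) ?_ ?_ hvc.symm hva hvb
    ⟨key _ (hmem c hvc) _ hd hdc.symm hda hdb, (key _ (hmem a hva) _ hd hda.symm hda hdb).symm,
      (key _ (hmem b hvb) _ hd hdb.symm hda hdb).symm,
      (key _ (hmem a hva) _ (hmem c hvc) hca.symm hca hcb).symm,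
      (key _ (hmem b hvb) _ (hmem c hvc) hcb.symm hca hcb).symm⟩)
  · simp [hca, hcb, hdc.symm, hda.symm, hab, hdb]
  · simp [hvc.ne, hva.ne, hvb.ne, hdv.symm]

/-- A graph on `n > 0` vertices without three disjoint connectors has at most `2n - 2` edges,
with equality only for `K₁` and `K₄`. -/
lemma countBound [Fintype V] : ∀ n, 0 < n → CountBound V n := by
  classical
  intro n
  induction n using Nat.strong_induction_on with
  | _ n ihn =>
    intro hn0 X G hn hX hG
    have ih : ∀ m, 0 < m → m < n → CountBound V m := fun m h0 hm => ihn m hm h0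
    refine ⟨?_, complete_of_ncard_edgeSet ih hn hX hG⟩
    by_contra! hlt
    -- a spanning subgraph with exactly `2n - 2` edges is `K₁` or `K₄`, leaving no further edge
    obtain ⟨s, hs, hcard⟩ := Set.exists_subset_card_eq (s := G.edgeSet) (n := 2 * n - 2) (by omega)
    have hs' : (SimpleGraph.fromEdgeSet s).edgeSet = s := by
      rw [SimpleGraph.edgeSet_fromEdgeSet, sdiff_eq_left, Set.disjoint_left]
      exact fun e he hd => G.not_isDiag_of_mem_edgeSet (hs he) hd
    have hle : SimpleGraph.fromEdgeSet s ≤ G := by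
      rw [← SimpleGraph.edgeSet_subset_edgeSet, hs']
      exact hs
    rcases complete_of_ncard_edgeSet ih hn (fun x y h => hX x y (hle h))
      (fun h => hG (h.mono hle)) (by rw [hs', hcard]; omega) with h1 | ⟨h4, -⟩
    · obtain ⟨x, hx⟩ := Finset.card_eq_one.1 (hn.trans h1)
      have : G.edgeSet = ∅ := by
        ext e
        induction e with
        | h a b =>
          simp only [SimpleGraph.mem_edgeSet, Set.mem_empty_iff_false, iff_false]
          intro hab
          have ha := hX _ _ hab
          have hb := hX _ _ hab.symm
          rw [hx, Finset.mem_singleton] at ha hb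
          exact hab.ne (ha.trans hb.symm)
      rw [this, Set.ncard_empty] at hlt
      omega
    · have := ncard_edgeSet_le_six hX (hn.trans h4)
      omega

/-! ### The extremal graphs -/

/-- The part of the extremal statement for order `m` that identifies the graphs with `2m - 3`
edges. -/
def ClassBound (V : Type*) (m : ℕ) : Prop :=
  ∀ (X : Finset V) (G : SimpleGraph V), X.card = m → EdgesIn G X → ¬ Bad G →
    G.edgeSet.ncard + 3 = 2 * m → Class X G

/-- A graph with `2n - 3` edges that has a `K₄`: by `K4_peel` the `K₄` is attached at one vertex
to a smaller graph of the same kind. -/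
lemma class_of_K4 [Fintype V] {n : ℕ} (ih : ∀ m, m < n → ClassBound V m) {X : Finset V}
    {G : SimpleGraph V} (hn : X.card = n) (hX : EdgesIn G X) (hG : ¬ Bad G)
    (he : G.edgeSet.ncard + 3 = 2 * n) {Q : Finset V} (hQ : G.IsNClique 4 Q) : Class X G := by
  classical
  rcases K4_peel (fun m h0 _ => countBound m h0) hn hX hG hQ (by omega) with
    rfl | ⟨-, u, hu, A, -, hA3, hAQ, hXA, hcov, -, heA⟩
  · have h4 := hQ.card_eq
    have := ncard_edgeSet_complete hX (fun x hx y hy hxy => hQ.isClique hx hy hxy)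
    rw [h4] at this
    omega
  · obtain ⟨x, y, z, hm, hnd, -⟩ := exists_of_isNClique hQ hu
    have hcl := ih A.card (by omega) A (within G (A : Set V)) rfl (edgesIn_within A)
      (fun h => hG (h.mono (within_le _ _))) heA
    have hnd' : u ≠ x ∧ u ≠ y ∧ u ≠ z ∧ [x, y, z].Nodup := by
      simp only [List.nodup_cons, List.mem_cons] at hnd ⊢
      grind
    have hnot : ∀ w ∈ Q, u ≠ w → w ∉ A := fun w hw huw hwA =>
      huw ((hAQ w).1 ⟨hwA, hw⟩).symm
    refine hcl.attach hG (u := u) ((hAQ u).2 rfl).1 hnd'.2.2.2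
      (hnot x ((hm x).2 (by simp)) hnd'.1) (hnot y ((hm y).2 (by simp)) hnd'.2.1)
      (hnot z ((hm z).2 (by simp)) hnd'.2.2.1) ?_ ?_
    · intro w
      rw [hXA, hm]
      constructor
      · rintro (h | rfl | h)
        · exact Or.inl h
        · exact Or.inl ((hAQ w).2 rfl).1
        · exact Or.inr h
      · rintro (h | h)
        · exact Or.inl h
        · exact Or.inr (Or.inr h)
    · intro v w
      rw [← hm, ← hm]
      constructor
      · intro hvw
        rcases hcov v w hvw with h | h
        · exact Or.inl ⟨hvw, h⟩
        · exact Or.inr ⟨hvw.ne, h⟩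
      · rintro (h | ⟨h1, h2, h3⟩)
        · exact h.1
        · exact hQ.isClique h2 h3 h1

/-- The smallest strip with one diamond, which is `K₄` with one edge subdivided. -/
lemma oneOn_three {G : SimpleGraph V} {X : Finset V} {x y v s t : V} (hn : [x, y, v, s, t].Nodup)
    (hX : ∀ z, z ∈ X ↔ z = v ∨ z = x ∨ z = y ∨ z = s ∨ z = t) (hxy : ¬ G.Adj x y)
    (hv : ∀ z, G.Adj v z ↔ z = x ∨ z = y) (hst : G.Adj s t) (hsx : G.Adj s x) (hsy : G.Adj s y)
    (htx : G.Adj t x) (hty : G.Adj t y) : Base X G := by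
  simp only [List.nodup_cons, List.mem_cons, List.not_mem_nil, or_false, not_or, List.nodup_nil,
    and_true, not_false_eq_true] at hn
  obtain ⟨⟨n1, n2, n3, n4⟩, ⟨n5, n6, n7⟩, ⟨n8, n9⟩, n10⟩ := hn
  have c := G.adj_comm
  have hvx := (hv x).2 (by simp)
  have hvy := (hv y).2 (by simp)
  have hvs : ¬ G.Adj v s := by rw [hv]; simp [Ne.symm n3, Ne.symm n6]
  have hvt : ¬ G.Adj v t := by rw [hv]; simp [Ne.symm n4, Ne.symm n7]
  refine .one (seqFour x y v v) s t 3 le_rfl ⟨?_, ?_, ?_, ?_, ?_, hst, ?_, ?_⟩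
  · intro i j hi hj
    interval_cases i <;> interval_cases j <;>
      simp [seqFour, n1, n2, n5, Ne.symm n1, Ne.symm n2, Ne.symm n5]
  · intro i hi
    interval_cases i <;> simp [seqFour, n3, n6, n8]
  · intro i hi
    interval_cases i <;> simp [seqFour, n4, n7, n9]
  · intro z
    rw [hX]
    constructor
    · rintro (rfl | rfl | rfl | h)
      · exact Or.inl ⟨2, by omega, rfl⟩
      · exact Or.inl ⟨0, by omega, rfl⟩
      · exact Or.inl ⟨1, by omega, rfl⟩
      · exact Or.inr h
    · rintro (⟨i, hi, rfl⟩ | h)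
      · interval_cases i <;> simp [seqFour]
      · exact Or.inr (Or.inr (Or.inr h))
  · intro i j hi hj
    interval_cases i <;> interval_cases j <;> simp [seqFour, hxy, c y x, hvx, hvy, hvx.symm, hvy.symm]
  · intro i hi
    interval_cases i <;> simp [seqFour, hsx, hsy, c s v, hvs]
  · intro i hi
    interval_cases i <;> simp [seqFour, htx, hty, c t v, hvt]

/-- A graph with `2n - 3` edges, without `K₄`, that has a vertex `v` of degree at most `2`. If
the two neighbours of `v` are adjacent, `v` can be deleted, and it was a second path along an
admissible edge; otherwise splitting off `v` gives `K₄`. -/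
lemma base_of_degree_le_two [Fintype V] {n : ℕ} (ih : ∀ m, m < n → ClassBound V m)
    {X : Finset V} {G : SimpleGraph V} (hn : X.card = n) (hX : EdgesIn G X) (hG : ¬ Bad G)
    (he : G.edgeSet.ncard + 3 = 2 * n) (hQ : ∀ Q : Finset V, ¬ G.IsNClique 4 Q) {v : V}
    (hv : v ∈ X) (hd : (G.neighborSet v).ncard ≤ 2) : Base X G := by
  classical
  have hcard : (X.erase v).card = n - 1 := by rw [Finset.card_erase_of_mem hv, hn]
  have hdel := ncard_edgeSet_delete G v
  have hle := within_le G {v}ᶜ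
  have hXd := edgesIn_delete hX v
  have hGd : ¬ Bad (within G {v}ᶜ) := fun h => hG (h.mono hle)
  have ihd := countBound (n - 1) (by omega) _ _ hcard hXd hGd
  have hK : ∀ Y : Finset V, Y.card = 4 → ¬ ∀ x ∈ Y, ∀ y ∈ Y, x ≠ y → G.Adj x y :=
    fun Y h4 hc => hQ Y ⟨fun x hx y hy hxy => hc x hx y hy hxy, h4⟩
  have hd1 : 1 ≤ (G.neighborSet v).ncard := by omega
  have hmem : ∀ z, G.Adj v z → z ∈ X.erase v := fun z hz =>
    Finset.mem_erase.2 ⟨hz.ne', hX _ _ hz.symm⟩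
  by_cases hd' : (G.neighborSet v).ncard = 1
  · obtain ⟨x, hN⟩ := Set.ncard_eq_one.1 hd'
    have hvx : G.Adj v x := by
      rw [← SimpleGraph.mem_neighborSet, hN]
      rfl
    -- the rest attains the bound `2(n - 1) - 2`, so it is a single vertex or `K₄`
    rcases ihd.2 (by omega) with h | ⟨h4, hc⟩
    · obtain ⟨y, hy⟩ := Finset.card_eq_one.1 (hcard.trans h)
      have hxy := hmem x hvx
      rw [hy, Finset.mem_singleton] at hxy
      subst hxy
      refine .strip (fun i => if i = 0 then v else x) 2 le_rfl ⟨?_, ?_, ?_⟩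
      · intro i j hi hj
        interval_cases i <;> interval_cases j <;> simp [hvx.ne, hvx.ne']
      · intro z
        rw [← Finset.insert_erase hv, hy]
        simp only [Finset.mem_insert, Finset.mem_singleton]
        constructor
        · rintro (rfl | rfl)
          · exact ⟨0, by omega, rfl⟩
          · exact ⟨1, by omega, rfl⟩
        · rintro ⟨i, hi, rfl⟩
          interval_cases i <;> simp
      · intro i j hi hj
        interval_cases i <;> interval_cases j <;> simp [hvx, hvx.symm]
    · exact absurd (fun a ha b hb hab => hle (hc a ha b hb hab)) (hK _ (hcard.trans h4))
  have hd2 : (G.neighborSet v).ncard = 2 := by omega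
  obtain ⟨x, y, hxy, hN⟩ := Set.ncard_eq_two.1 hd2
  have hv' : ∀ z, G.Adj v z ↔ z = x ∨ z = y := fun z => by
    rw [← SimpleGraph.mem_neighborSet, hN]
    simp
  have hvx := (hv' x).2 (by simp)
  have hvy := (hv' y).2 (by simp)
  have hvX := Finset.notMem_erase v X
  by_cases hadj : G.Adj x y
  · have hcl := ih (n - 1) (by omega) _ _ hcard hXd hGd (by omega)
    have hB := hcl.base_of_no_clique fun Q hQ' => hQ Q (hQ'.mono hle)
    have hE := hB.earSpot hXd hle hG hvX (⟨hadj, hvx.ne', hvy.ne'⟩ : (within G {v}ᶜ).Adj x y)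
      hvx.symm hvy.symm
    have := hE.base_insert (G := G) hvX
      (fun z w hz hw => ⟨fun h => ⟨h, hz, hw⟩, fun h => h.1⟩) hv'
    rwa [Finset.insert_erase hv] at this
  · have hcount := ncard_edgeSet_bypass hvx.symm hvy hxy hadj
    have ihb := countBound (n - 1) (by omega) _ _ hcard (edgesIn_bypass hX hvx.symm hvy hxy)
      (fun h => hG (h.of_bypass_path hvx.symm hvy))
    rcases ihb.2 (by omega) with h | ⟨h4, hc⟩
    · have := Finset.card_le_one.1 (hcard.trans h).le x (hmem x hvx) y (hmem y hvy)
      exact absurd this hxy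
    obtain ⟨s, t, hm, hsx, hsy, htx, hty, hst⟩ :=
      exists_of_card_four (hcard.trans h4) (hmem x hvx) (hmem y hvy) hxy
    have hs := (hm s).2 (by simp)
    have ht := (hm t).2 (by simp)
    have key : ∀ z ∈ X.erase v, ∀ w ∈ X.erase v, z ≠ w → z ≠ x → z ≠ y → G.Adj z w := by
      intro z hz w hw hzw hzx hzy
      rcases (bypass_path_adj hvx.ne' hvy.ne hxy).1 (hc z hz w hw hzw) with h | h | h
      · exact absurd h.1 hzx
      · exact absurd h.1 hzy
      · exact h.1
    refine oneOn_three (x := x) (y := y) (v := v) (s := s) (t := t) ?_ ?_ hadj hv'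
      (key s hs t ht hst hsx hsy) (key s hs x (hmem x hvx) hsx hsx hsy)
      (key s hs y (hmem y hvy) hsy hsx hsy) (key t ht x (hmem x hvx) htx htx hty)
      (key t ht y (hmem y hvy) hty htx hty)
    · simp [hxy, hvx.ne', hvy.ne', hsx.symm, htx.symm, hsy.symm, hty.symm, hst,
        (Finset.mem_erase.1 hs).1.symm, (Finset.mem_erase.1 ht).1.symm]
    · intro z
      rw [← hm, Finset.mem_erase]
      by_cases hz : z = v
      · simp [hz, hv]
      · simp [hz]

/-- A graph with `2n - 3` edges, without `K₄`, that has a diamond: replacing the diamond by an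
edge gives a smaller graph of the same kind. -/
lemma base_of_diamond [Fintype V] {n : ℕ} (ih : ∀ m, m < n → ClassBound V m)
    {X : Finset V} {G : SimpleGraph V} (hn : X.card = n) (hX : EdgesIn G X) (hG : ¬ Bad G)
    (he : G.edgeSet.ncard + 3 = 2 * n) (hQ : ∀ Q : Finset V, ¬ G.IsNClique 4 Q)
    {s t x y : V} (hxy : x ≠ y) (hnxy : ¬ G.Adj x y)
    (hs : ∀ w, G.Adj s w ↔ w = t ∨ w = x ∨ w = y) (ht : ∀ w, G.Adj t w ↔ w = s ∨ w = x ∨ w = y) :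
    Base X G := by
  classical
  have hst := (hs t).2 (by simp)
  have hsx := (hs x).2 (by simp)
  have hsy := (hs y).2 (by simp)
  have htx := (ht x).2 (by simp)
  have hty := (ht y).2 (by simp)
  let H := within G {t}ᶜ
  have hHG : H ≤ G := within_le _ _
  have hHx : H.Adj x s := ⟨hsx.symm, htx.ne', hst.ne⟩
  have hHy : H.Adj s y := ⟨hsy, hst.ne, hty.ne'⟩
  have hHX : EdgesIn H (X.erase t) := edgesIn_delete hX t
  let B := bypass H {x, s, y} x y
  have hBadj : ∀ z w, B.Adj z w ↔
      (z = x ∧ w = y) ∨ (z = y ∧ w = x) ∨ (H.Adj z w ∧ z ≠ s ∧ w ≠ s) := fun z w =>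
    bypass_path_adj hsx.ne' hsy.ne hxy
  have hBX : EdgesIn B ((X.erase t).erase s) := edgesIn_bypass hHX hHx hHy hxy
  have hHbad : ¬ Bad H := fun h => hG (h.mono hHG)
  have hBbad : ¬ Bad B := fun h => hHbad (h.of_bypass_path hHx hHy)
  have hsX : s ∈ X.erase t := Finset.mem_erase.2 ⟨hst.ne, hX _ _ hst⟩
  have htX : t ∈ X := hX _ _ hst.symm
  have hcard : ((X.erase t).erase s).card = n - 2 := by
    rw [Finset.card_erase_of_mem hsX, Finset.card_erase_of_mem htX, hn]
    omega
  have hdegt : (G.neighborSet t).ncard = 3 := by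
    rw [Set.ncard_eq_three]
    refine ⟨s, x, y, hsx.ne, hsy.ne, hxy, ?_⟩
    ext w
    simp [ht]
  have hdegs : (H.neighborSet s).ncard = 2 := by
    rw [Set.ncard_eq_two]
    refine ⟨x, y, hxy, ?_⟩
    ext w
    simp only [SimpleGraph.mem_neighborSet, H, within, hs, Set.mem_compl_iff,
      Set.mem_singleton_iff, Set.mem_insert_iff]
    constructor
    · rintro ⟨h1, -, h2⟩
      exact h1.resolve_left h2
    · rintro h
      refine ⟨Or.inr h, hst.ne, ?_⟩
      rcases h with rfl | rfl
      · exact htx.ne'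
      · exact hty.ne'
  have hc1 := ncard_edgeSet_delete G t
  have hc2 := ncard_edgeSet_bypass hHx hHy hxy (fun h => hnxy (hHG h))
  change G.edgeSet.ncard = H.edgeSet.ncard + _ at hc1
  change B.edgeSet.ncard + _ = _ at hc2
  have hcl := ih (n - 2) (by omega) _ B hcard hBX hBbad (by omega)
  have hBG : ∀ z w, B.Adj z w → (z ≠ x ∨ w ≠ y) → (z ≠ y ∨ w ≠ x) → G.Adj z w := by
    intro z w h h1 h2
    rcases (hBadj z w).1 h with ⟨rfl, rfl⟩ | ⟨rfl, rfl⟩ | h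
    · simp at h1
    · simp at h2
    · exact hHG h.1
  have hBne : ∀ z w, B.Adj z w → z ≠ s ∧ z ≠ t := fun z w h => by
    have := hBX _ _ h
    simp only [Finset.mem_erase] at this
    exact ⟨this.1, this.2.1⟩
  have hB : Base ((X.erase t).erase s) B := by
    refine hcl.base_of_no_clique fun Q hQB => ?_
    by_cases hxQ : x ∈ Q ∧ y ∈ Q
    · obtain ⟨p, q, hm, hpx, hpy, hqx, hqy, hpq⟩ := exists_of_card_four hQB.card_eq hxQ.1 hxQ.2 hxy
      have hp : p ∈ Q := (hm p).2 (by simp)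
      have hq : q ∈ Q := (hm q).2 (by simp)
      have hxp := hQB.isClique hxQ.1 hp hpx.symm
      have hxq := hQB.isClique hxQ.1 hq hqx.symm
      have hpy' := hQB.isClique hp hxQ.2 hpy
      have hqy' := hQB.isClique hq hxQ.2 hqy
      refine hG (bad_of_diamond_pages (x := x) (y := y) (s := s) (t := t) (p := p) (q := q) ?_
        ⟨htx.symm, hty, hst.symm, hsx.symm, hBG _ _ hxp (Or.inr hpy) (Or.inl hxy),
          hBG _ _ hpy' (Or.inl hpx) (Or.inl hpy), hBG _ _ hxq (Or.inr hqy) (Or.inl hxy),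
          hBG _ _ hqy' (Or.inl hqx) (Or.inl hqy), hsy.symm⟩)
      simp [hxy, hsx.ne', hsy.ne', htx.ne', hty.ne', hpx.symm, hqx.symm, hpy.symm, hqy.symm,
        hst.ne, hpq, (hBne _ _ hpy').1.symm, (hBne _ _ hpy').2.symm, (hBne _ _ hqy').1.symm,
        (hBne _ _ hqy').2.symm]
    · refine hQ Q ⟨fun z hz w hw hzw => hBG z w (hQB.isClique hz hw hzw) ?_ ?_, hQB.card_eq⟩
      · by_contra! h
        exact hxQ ⟨h.1 ▸ hz, h.2 ▸ hw⟩
      · by_contra! h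
        exact hxQ ⟨h.2 ▸ hw, h.1 ▸ hz⟩
  have hsX' : s ∉ (X.erase t).erase s := Finset.notMem_erase _ _
  have htX' : t ∉ (X.erase t).erase s := by simp
  -- the diamond is recovered from the edge `xy` in two steps, `t` being a second path along `xy`
  have hE : EarSpot ((X.erase t).erase s) B x y := by
    refine hB.earSpot hBX (G := bypass G {x, s, y} x y) ?_
      (fun h => hG (h.of_bypass_path hsx.symm hsy)) htX' ((hBadj x y).2 (Or.inl ⟨rfl, rfl⟩)) ?_ ?_
    · intro z w h
      rw [bypass_path_adj hsx.ne' hsy.ne hxy]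
      rcases (hBadj z w).1 h with h | h | h
      · exact Or.inl h
      · exact Or.inr (Or.inl h)
      · exact Or.inr (Or.inr ⟨hHG h.1, h.2⟩)
    · rw [bypass_path_adj hsx.ne' hsy.ne hxy]
      exact Or.inr (Or.inr ⟨htx.symm, hsx.ne', hst.ne'⟩)
    · rw [bypass_path_adj hsx.ne' hsy.ne hxy]
      exact Or.inr (Or.inr ⟨hty.symm, hsy.ne', hst.ne'⟩)
  have := hE.base_diamond (G := G) hsX' htX' hst.ne hG ?_ hs ht
  · have hins : insert s (insert t ((X.erase t).erase s)) = X := by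
      rw [Finset.insert_comm, Finset.insert_erase hsX, Finset.insert_erase htX]
    rwa [hins] at this
  · intro z w hz hw
    simp only [Finset.mem_erase] at hz hw
    rw [hBadj, ne_eq s(z, w), Sym2.eq_iff]
    constructor
    · intro h
      refine ⟨Or.inr (Or.inr ⟨⟨h, hz.2.1, hw.2.1⟩, hz.1, hw.1⟩), ?_⟩
      rintro (⟨rfl, rfl⟩ | ⟨rfl, rfl⟩)
      · exact hnxy h
      · exact hnxy h.symm
    · rintro ⟨h | h | h, h'⟩
      · exact absurd (Or.inl h) h'
      · exact absurd (Or.inr h) h'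
      · exact hHG h.1

/-- Splitting off a vertex `v` of degree `3`, with non-adjacent neighbours `a, b` and a third
neighbour `c`, creates no `K₄`, if `G` has neither `K₄` nor diamonds. -/
lemma not_clique_bypass [Fintype V] [DecidableEq V] {n : ℕ} {X : Finset V} {G : SimpleGraph V}
    (hn : X.card = n) (hX : EdgesIn G X) (hG : ¬ Bad G) (he : G.edgeSet.ncard + 3 = 2 * n)
    (hQ : ∀ Q : Finset V, ¬ G.IsNClique 4 Q) (hD : NoDiamond G) {v a b c : V}
    (hv : ∀ z, G.Adj v z ↔ z = a ∨ z = b ∨ z = c) (hab : a ≠ b) (hca : c ≠ a) (hcb : c ≠ b)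
    (hnab : ¬ G.Adj a b) (hd : (G.neighborSet v).ncard = 3) (Q : Finset V) :
    ¬ (bypass G {a, v, b} a b).IsNClique 4 Q := by
  intro hQB
  have hva := (hv a).2 (by simp)
  have hvb := (hv b).2 (by simp)
  have hvc := (hv c).2 (by simp)
  have hvX : v ∈ X := hX _ _ hva
  have hcard : (X.erase v).card = n - 1 := by rw [Finset.card_erase_of_mem hvX, hn]
  have hcount := ncard_edgeSet_bypass hva.symm hvb hab hnab
  have hBX := edgesIn_bypass hX hva.symm hvb hab
  have hBadj : ∀ z w, (bypass G {a, v, b} a b).Adj z w ↔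
      (z = a ∧ w = b) ∨ (z = b ∧ w = a) ∨ (G.Adj z w ∧ z ≠ v ∧ w ≠ v) := fun z w =>
    bypass_path_adj hva.ne' hvb.ne hab
  have hBbad : ¬ Bad (bypass G {a, v, b} a b) := fun h => hG (h.of_bypass_path hva.symm hvb)
  set B := bypass G {a, v, b} a b
  have hBG : ∀ z w, B.Adj z w → (z ≠ a ∨ w ≠ b) → (z ≠ b ∨ w ≠ a) → G.Adj z w := by
    intro z w h h1 h2
    rcases (hBadj z w).1 h with ⟨rfl, rfl⟩ | ⟨rfl, rfl⟩ | h
    · simp at h1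
    · simp at h2
    · exact h.1
  have hBv : ∀ z w, B.Adj z w → z ≠ v := fun z w h => (Finset.mem_erase.1 (hBX _ _ h)).1
  have habQ : a ∈ Q ∧ b ∈ Q := by
    by_contra hnot
    refine hQ Q ⟨fun z hz w hw hzw => hBG z w (hQB.isClique hz hw hzw) ?_ ?_, hQB.card_eq⟩
    · by_contra! h
      exact hnot ⟨h.1 ▸ hz, h.2 ▸ hw⟩
    · by_contra! h
      exact hnot ⟨h.2 ▸ hw, h.1 ▸ hz⟩
  obtain ⟨haQ, hbQ⟩ := habQ
  -- the sides of the square through `a, b` and the two other vertices of `Q` are edges of `G`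
  have hQG : ∀ z ∈ Q, ∀ w ∈ Q, z ≠ w → z ≠ a → z ≠ b → G.Adj z w := fun z hz w hw hzw hza hzb =>
    hBG z w (hQB.isClique hz hw hzw) (Or.inl hza) (Or.inl hzb)
  have hQv : ∀ z ∈ Q, z ≠ v := by
    intro z hz
    by_cases hza : z = a
    · rw [hza]; exact hva.ne'
    · exact hBv z a (hQB.isClique hz haQ hza)
  have hwheel : ∀ g ∈ Q, ∀ d ∈ Q, g ≠ a → g ≠ b → d ≠ a → d ≠ b → g ≠ d →
      ∀ G' : SimpleGraph V, (∀ z ∈ Q, ∀ w ∈ Q, G.Adj z w → G'.Adj z w) → G'.Adj g v → G'.Adj v a →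
        G'.Adj v b → Bad G' := by
    intro g hg d hdQ hga hgb hda hdb hgd G' hG' h1 h2 h3
    refine bad_of_hub_wheel (g := g) (a := a) (d := d) (b := b) (v := v) ?_ ?_ h1 h2 h3
      ⟨hG' _ hg _ hdQ (hQG g hg d hdQ hgd hga hgb), hG' _ hdQ _ haQ (hQG d hdQ a haQ hda hda hdb),
        hG' _ hdQ _ hbQ (hQG d hdQ b hbQ hdb hda hdb), hG' _ hg _ haQ (hQG g hg a haQ hga hga hgb),
        hG' _ hg _ hbQ (hQG g hg b hbQ hgb hga hgb)⟩
    · simp [hga, hgd, hgb, hda.symm, hab, hdb]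
    · simp [(hQv g hg).symm, hva.ne, (hQv d hdQ).symm, hvb.ne]
  obtain ⟨z, w, hm, hza, hzb, hwa, hwb, hzw⟩ := exists_of_card_four hQB.card_eq haQ hbQ hab
  have hzQ : z ∈ Q := (hm z).2 (by simp)
  have hwQ : w ∈ Q := (hm w).2 (by simp)
  have hother : ∀ g ∈ Q, g ≠ a → g ≠ b → ∃ d ∈ Q, d ≠ a ∧ d ≠ b ∧ g ≠ d := by
    intro g hg hga hgb
    rcases (hm g).1 hg with h | h | rfl | rfl
    · exact absurd h hga
    · exact absurd h hgb
    · exact ⟨w, hwQ, hwa, hwb, hzw⟩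
    · exact ⟨z, hzQ, hza, hzb, hzw.symm⟩
  have hcQ : c ∉ Q := by
    intro hc
    obtain ⟨d, hdQ, hda, hdb, hgd⟩ := hother c hc hca hcb
    exact hG (hwheel c hc d hdQ hca hcb hda hdb hgd G (fun _ _ _ _ h => h) hvc.symm hva hvb)
  rcases K4_peel (fun m h0 _ => countBound m h0) hcard hBX hBbad hQB (by omega) with
    hXQ | ⟨-, u, hu, A, -, -, hAQ, hXA, hcov, hreach, -⟩
  · exact hcQ (hXQ ▸ Finset.mem_erase.2 ⟨hvc.ne', hX _ _ hvc.symm⟩)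
  have hcA : c ∈ A := ((hXA c).1 (Finset.mem_erase.2 ⟨hvc.ne', hX _ _ hvc.symm⟩)).resolve_right hcQ
  have hvA : v ∉ A := fun h => Finset.notMem_erase v X ((hXA v).2 (Or.inl h))
  by_cases huab : u = a ∨ u = b
  · -- the two other vertices of `Q` form a diamond
    have hlow : ∀ g ∈ Q, g ≠ u → ∀ x, B.Adj g x → x ∈ Q := by
      intro g hg hgu x hgx
      rcases hcov g x hgx with h | h
      · exact absurd ((hAQ g).1 ⟨h.1, hg⟩) hgu
      · exact h.2
    have hN : ∀ g ∈ Q, ∀ d ∈ Q, g ≠ a → g ≠ b → d ≠ a → d ≠ b → g ≠ d →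
        (∀ x ∈ Q, x = g ∨ x = d ∨ x = a ∨ x = b) → ∀ x, G.Adj g x ↔ x = d ∨ x = a ∨ x = b := by
      intro g hg d hdQ hga hgb hda hdb hgd hall x
      constructor
      · intro hgx
        have hgv : ¬ G.Adj g v := by
          intro h
          rcases (hv g).1 h.symm with h | h | h
          · exact hga h
          · exact hgb h
          · exact hcQ (h ▸ hg)
        have hgu : g ≠ u := by
          rintro rfl
          exact huab.elim hga hgb
        have hxv : x ≠ v := fun h => hgv (h ▸ hgx)
        have := hlow g hg hgu x ((hBadj g x).2 (Or.inr (Or.inr ⟨hgx, hQv g hg, hxv⟩)))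
        exact (hall x this).resolve_left hgx.ne'
      · rintro (rfl | rfl | rfl)
        · exact hQG g hg x hdQ hgd hga hgb
        · exact hQG g hg x haQ hga hga hgb
        · exact hQG g hg x hbQ hgb hga hgb
    refine hD z w a b hab hnab (hN z hzQ w hwQ hza hzb hwa hwb hzw ?_)
      (hN w hwQ z hzQ hwa hwb hza hzb hzw.symm ?_)
    · intro x hx
      have := (hm x).1 hx
      tauto
    · intro x hx
      have := (hm x).1 hx
      tauto
  · -- `A` and the edge `cv` lead from `u` to `v`
    push Not at huab
    obtain ⟨d, hdQ, hda, hdb, hgd⟩ := hother u hu huab.1 huab.2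
    have haA : a ∉ A := fun h => huab.1 ((hAQ a).1 ⟨h, haQ⟩).symm
    have hbA : b ∉ A := fun h => huab.2 ((hAQ b).1 ⟨h, hbQ⟩).symm
    have huA : u ∈ A := ((hAQ u).2 rfl).1
    let S : Set V := insert v (A : Set V)
    have hr : (within G S).Reachable u v := by
      have h1 : within B (A : Set V) ≤ within G S := by
        rintro x y ⟨h, hx, hy⟩
        have hx' : x ∈ A := hx
        have hy' : y ∈ A := hy
        refine ⟨hBG x y h (Or.inl ?_) (Or.inl ?_), Or.inr hx, Or.inr hy⟩
        · exact fun h => haA (h ▸ hx')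
        · exact fun h => hbA (h ▸ hx')
      have h2 : (within G S).Adj c v := ⟨hvc.symm, Or.inr hcA, Or.inl rfl⟩
      exact ((hreach c hcA).mono h1).trans h2.reachable
    have huv : u ≠ v := hQv u hu
    have hQS : ∀ x ∈ Q, x ∈ S → x = u := by
      rintro x hx (h | h)
      · exact absurd h (hQv x hx)
      · exact (hAQ x).1 ⟨h, hx⟩
    refine hG (Bad.of_bypass (A := S) (u := u) (c := v) (Or.inr huA) (Or.inl rfl) hr
      (hwheel u hu d hdQ huab.1 huab.2 hda hdb hgd _ ?_ ⟨huv, Or.inl ⟨rfl, rfl⟩⟩ ?_ ?_))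
    · intro x hx y hy hxy
      refine ⟨hxy.ne, Or.inr (Or.inr ⟨hxy, ?_, fun h => Or.inl (hQS x hx h),
        fun h => Or.inl (hQS y hy h)⟩)⟩
      rintro ⟨h1, h2⟩
      exact hxy.ne ((hQS x hx h1).trans (hQS y hy h2).symm)
    · refine ⟨hva.ne, Or.inr (Or.inr ⟨hva, ?_, fun _ => Or.inr rfl, ?_⟩)⟩
      · rintro ⟨-, h⟩
        exact huab.1 (hQS a haQ h).symm
      · exact fun h => Or.inl (hQS a haQ h)
    · refine ⟨hvb.ne, Or.inr (Or.inr ⟨hvb, ?_, fun _ => Or.inr rfl, ?_⟩)⟩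
      · rintro ⟨-, h⟩
        exact huab.2 (hQS b hbQ h).symm
      · exact fun h => Or.inl (hQS b hbQ h)

/-- A graph with `2n - 3` edges and minimum degree at least `3`, with neither `K₄` nor diamonds:
splitting off a vertex of degree `3` gives a smaller base graph. -/
lemma base_of_no_diamond [Fintype V] {n : ℕ} (ih : ∀ m, m < n → ClassBound V m)
    {X : Finset V} {G : SimpleGraph V} (hn : X.card = n) (hX : EdgesIn G X) (hG : ¬ Bad G)
    (he : G.edgeSet.ncard + 3 = 2 * n) (hQ : ∀ Q : Finset V, ¬ G.IsNClique 4 Q)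
    (hD : NoDiamond G) (hdeg : ∀ z ∈ X, 2 < (G.neighborSet z).ncard) : Base X G := by
  classical
  obtain ⟨v, hvX, hd⟩ := exists_ncard_neighborSet_le_three hX (by omega)
  have hd3 : (G.neighborSet v).ncard = 3 := by
    have := hdeg v hvX
    omega
  obtain ⟨a, b, c, hv, hab, hca, hcb, hnab⟩ :=
    exists_not_adj_of_ncard_eq_three hd3 (fun Q _ => hQ Q)
  have hva := (hv a).2 (by simp)
  have hvb := (hv b).2 (by simp)
  have hvc := (hv c).2 (by simp)
  have hcard : (X.erase v).card = n - 1 := by rw [Finset.card_erase_of_mem hvX, hn]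
  have hcount := ncard_edgeSet_bypass hva.symm hvb hab hnab
  have hBX := edgesIn_bypass hX hva.symm hvb hab
  have hB := (ih (n - 1) (by omega) _ _ hcard hBX (fun h => hG (h.of_bypass_path hva.symm hvb))
    (by omega)).base_of_no_clique (not_clique_bypass hn hX hG he hQ hD hv hab hca hcb hnab hd3)
  have hS : SubdividedFrom G (bypass G {a, v, b} a b) (X.erase v) a b c v := by
    refine ⟨Finset.notMem_erase _ _, Finset.mem_erase.2 ⟨hvc.ne', hX _ _ hvc.symm⟩, hca, hcb, ?_,
      ?_, hv⟩
    · rw [bypass_path_adj hva.ne' hvb.ne hab]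
      exact Or.inl ⟨rfl, rfl⟩
    · intro z w hz hw
      rw [bypass_path_adj hva.ne' hvb.ne hab, ne_eq s(z, w), Sym2.eq_iff]
      constructor
      · intro h
        refine ⟨Or.inr (Or.inr ⟨h, hz, hw⟩), ?_⟩
        rintro (⟨rfl, rfl⟩ | ⟨rfl, rfl⟩)
        · exact hnab h
        · exact hnab h.symm
      · rintro ⟨h | h | h, h'⟩
        · exact absurd (Or.inl h) h'
        · exact absurd (Or.inr h) h'
        · exact h.1
  have := hS.base_insert hB hBX (fun z hz => hdeg z (Finset.mem_of_mem_erase hz)) hD hG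
  rwa [Finset.insert_erase hvX] at this

/-- A graph on `n` vertices with `2n - 3` edges and without three disjoint connectors is a base
graph with copies of `K₄` attached. -/
lemma classBound [Fintype V] (n : ℕ) : ClassBound V n := by
  induction n using Nat.strong_induction_on with
  | _ n ih =>
    intro X G hn hX hG he
    by_cases hQ : ∃ Q : Finset V, G.IsNClique 4 Q
    · obtain ⟨Q, hQ⟩ := hQ
      exact class_of_K4 ih hn hX hG he hQ
    push Not at hQ
    apply Base.class _ hX
    by_cases hdeg : ∃ v ∈ X, (G.neighborSet v).ncard ≤ 2
    · obtain ⟨v, hv, hd⟩ := hdeg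
      exact base_of_degree_le_two ih hn hX hG he hQ hv hd
    push Not at hdeg
    by_cases hD : NoDiamond G
    · exact base_of_no_diamond ih hn hX hG he hQ hD hdeg
    · unfold NoDiamond at hD
      push Not at hD
      obtain ⟨s, t, x, y, hxy, hnxy, hs, ht⟩ := hD
      exact base_of_diamond ih hn hX hG he hQ hxy hnxy hs ht

/-! ### From the ambient description to the named graphs -/

/-- A base graph that is a copy of `K`, with copies of `K₄` attached inside the ambient vertex
type, is the graph `attachK4` of `K`. -/
lemma AttachOn.nonempty_iso [Fintype V] {G B : SimpleGraph V} {X₀ U : Finset V}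
    {q : V → Fin 3 → V} (h : AttachOn Finset.univ G X₀ B U q) {W : Type*} {K : SimpleGraph W}
    {f : W → V} (hf : Function.Injective f) (hX : ∀ x, x ∈ X₀ ↔ ∃ w, f w = x)
    (hK : ∀ a b, K.Adj a b ↔ B.Adj (f a) (f b)) :
    Nonempty (G ≃g attachK4 K {w | f w ∈ U}) := by
  let F : W ⊕ ({w | f w ∈ U} × Fin 3) → V := fun x =>
    match x with
    | .inl w => f w
    | .inr p => q (f p.1) p.2
  have hmem : ∀ w, f w ∈ X₀ := fun w => (hX _).2 ⟨w, rfl⟩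
  have hnew : ∀ (p : {w | f w ∈ U} × Fin 3) w, f w ≠ q (f p.1) p.2 := fun p w h' =>
    h.new _ p.1.2 p.2 (h' ▸ hmem w)
  have hinj : Function.Injective F := by
    rintro (a | a) (b | b) hab
    · exact congrArg _ (hf hab)
    · exact absurd hab (hnew b a)
    · exact absurd hab.symm (hnew a b)
    · obtain ⟨h1, h2⟩ := h.inj _ a.1.2 _ b.1.2 _ _ hab
      exact congrArg _ (Prod.ext (Subtype.ext (hf h1)) h2)
  have hsurj : Function.Surjective F := by
    intro x
    rcases (h.mem x).1 (Finset.mem_univ x) with hx | ⟨u, hu, i, rfl⟩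
    · obtain ⟨w, rfl⟩ := (hX x).1 hx
      exact ⟨.inl w, rfl⟩
    · obtain ⟨w, rfl⟩ := (hX u).1 (h.sub hu)
      exact ⟨.inr (⟨w, hu⟩, i), rfl⟩
  have hBq : ∀ (p : {w | f w ∈ U} × Fin 3) x, ¬ B.Adj (q (f p.1) p.2) x := fun p x h' =>
    h.new _ p.1.2 p.2 (h.edges _ _ h')
  have hbl : ∀ u ∈ U, ∀ w, InBlock q u (f w) ↔ f w = u := by
    intro u hu w
    constructor
    · rintro (h' | ⟨i, h'⟩)
      · exact h'
      · exact absurd (h' ▸ hmem w) (h.new u hu i)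
    · exact Or.inl
  have hbr : ∀ u ∈ U, ∀ p : {w | f w ∈ U} × Fin 3, InBlock q u (q (f p.1) p.2) ↔ f p.1 = u := by
    intro u hu p
    constructor
    · rintro (h' | ⟨i, h'⟩)
      · exact absurd (h' ▸ h.sub hu) (h.new _ p.1.2 p.2)
      · exact (h.inj _ p.1.2 _ hu _ _ h').1
    · rintro rfl
      exact Or.inr ⟨_, rfl⟩
  refine ⟨SimpleGraph.Iso.symm ⟨Equiv.ofBijective F ⟨hinj, hsurj⟩, ?_⟩⟩
  rintro (a | a) (b | b)
  · change G.Adj (f a) (f b) ↔ K.Adj a b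
    rw [h.adj, hK]
    refine or_iff_left ?_
    rintro ⟨u, hu, hne, h1, h2⟩
    exact hne (((hbl u hu a).1 h1).trans ((hbl u hu b).1 h2).symm)
  · change G.Adj (f a) (q (f b.1) b.2) ↔ a = b.1
    rw [h.adj]
    constructor
    · rintro (h' | ⟨u, hu, -, h1, h2⟩)
      · exact absurd h'.symm (hBq b _)
      · exact hf (((hbl u hu a).1 h1).trans ((hbr u hu b).1 h2).symm)
    · rintro rfl
      exact Or.inr ⟨f b.1, b.1.2, hnew b _, (hbl _ b.1.2 _).2 rfl, (hbr _ b.1.2 b).2 rfl⟩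
  · change G.Adj (q (f a.1) a.2) (f b) ↔ b = a.1
    rw [h.adj]
    constructor
    · rintro (h' | ⟨u, hu, -, h1, h2⟩)
      · exact absurd h' (hBq a _)
      · exact hf (((hbl u hu b).1 h2).trans ((hbr u hu a).1 h1).symm)
    · rintro rfl
      exact Or.inr ⟨f a.1, a.1.2, (hnew a _).symm, (hbr _ a.1.2 a).2 rfl, (hbl _ a.1.2 _).2 rfl⟩
  · change G.Adj (q (f a.1) a.2) (q (f b.1) b.2) ↔ a.1 = b.1 ∧ a.2 ≠ b.2
    rw [h.adj]
    constructor
    · rintro (h' | ⟨u, hu, hne, h1, h2⟩)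
      · exact absurd h' (hBq a _)
      · have h3 : a.1 = b.1 :=
          Subtype.ext (hf (((hbr u hu a).1 h1).trans ((hbr u hu b).1 h2).symm))
        refine ⟨h3, fun h4 => hne ?_⟩
        rw [h3, h4]
    · rintro ⟨h1, h2⟩
      refine Or.inr ⟨f a.1, a.1.2, fun h' => h2 (h.inj _ a.1.2 _ b.1.2 _ _ h').2,
        (hbr _ a.1.2 a).2 rfl, (hbr _ a.1.2 b).2 ?_⟩
      rw [h1]

lemma ncard_neighborSet_eq_of_embedding {G : SimpleGraph V} {W : Type*} {K : SimpleGraph W}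
    {f : W → V} (hf : Function.Injective f) (hK : ∀ a b, K.Adj a b ↔ G.Adj (f a) (f b)) {w : W}
    (hG : ∀ x, G.Adj (f w) x → ∃ w', f w' = x) :
    (K.neighborSet w).ncard = (G.neighborSet (f w)).ncard := by
  rw [← Set.ncard_image_of_injective _ hf]
  congr 1
  ext x
  constructor
  · rintro ⟨a, ha, rfl⟩
    exact (hK _ _).1 ha
  · intro hx
    obtain ⟨a, rfl⟩ := hG x hx
    exact ⟨a, (hK _ _).2 hx, rfl⟩

/-- The vertices of `U` have degree exactly `2` in the base graph, because `hdeg` excludes the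
smaller degrees that `AttachOn` allows. -/
lemma AttachOn.inAttachClass [Fintype V] {G B : SimpleGraph V} {X₀ U : Finset V}
    {q : V → Fin 3 → V} (h : AttachOn Finset.univ G X₀ B U q) {W : Type} [Fintype W]
    {K : SimpleGraph W} {f : W → V} (hf : Function.Injective f) (hX : ∀ x, x ∈ X₀ ↔ ∃ w, f w = x)
    (hK : ∀ a b, K.Adj a b ↔ B.Adj (f a) (f b)) {r : ℕ}
    (hWr : Fintype.card W = r) (hr : 3 ≤ r)
    (hdeg : ∀ u ∈ U, 2 ≤ (B.neighborSet u).ncard) {i : Fin 7}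
    (hi : ∀ H : SimpleGraph (Fin r), Nonempty (H ≃g K) → IsBaseGraph i r H) :
    InAttachClass i (Fintype.card V) G := by
  subst hWr
  let e := (Fintype.equivFin W).symm
  have hfe : Function.Injective (f ∘ e) := hf.comp e.injective
  have hK' : ∀ a b, (K.comap e).Adj a b ↔ B.Adj ((f ∘ e) a) ((f ∘ e) b) := fun a b => hK _ _
  have hX' : ∀ x, x ∈ X₀ ↔ ∃ w, (f ∘ e) w = x := fun x => by
    rw [hX]
    exact ⟨fun ⟨w, hw⟩ => ⟨e.symm w, by simpa using hw⟩, fun ⟨w, hw⟩ => ⟨e w, hw⟩⟩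
  refine ⟨Nat.card_eq_fintype_card, Fintype.card W, hr, Fintype.card_le_of_injective f hf,
    K.comap e, hi _ ⟨⟨e, Iff.rfl⟩⟩, {w | (f ∘ e) w ∈ U}, ?_, h.nonempty_iso hfe hX' hK'⟩
  intro w hw
  rw [ncard_neighborSet_eq_of_embedding hfe hK' fun x hx => (hX' x).1 (h.edges _ _ hx.symm)]
  exact le_antisymm (h.deg _ hw) (hdeg _ hw)

lemma two_le_ncard_neighborSet [Finite V] {G : SimpleGraph V} {u x y : V} (hx : G.Adj u x)
    (hy : G.Adj u y) (hxy : x ≠ y) : 2 ≤ (G.neighborSet u).ncard := by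
  rw [← Set.ncard_pair hxy]
  refine Set.ncard_le_ncard ?_
  rintro z (rfl | rfl)
  · exact hx
  · exact hy

/-- Apart from `K₂`, base graphs have minimum degree at least `2`. -/
lemma Base.two_le_ncard_neighborSet [Finite V] {B : SimpleGraph V} {X : Finset V} (h : Base X B)
    (hc : 3 ≤ X.card) {u : V} (hu : u ∈ X) : 2 ≤ (B.neighborSet u).ncard := by
  classical
  cases h with
  | strip p r hr h =>
    obtain ⟨i, hi, rfl⟩ := (h.mem u).1 hu
    have hr3 : 3 ≤ r := h.card ▸ hc
    have key : ∀ j k, j < r → k < r → j ≠ k → i ≠ j → i ≠ k → i ≤ j + 2 → j ≤ i + 2 → i ≤ k + 2 →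
        k ≤ i + 2 → 2 ≤ (B.neighborSet (p i)).ncard := fun j k hj hk hjk h1 h2 h3 h4 h5 h6 =>
      SteinerExtremal.two_le_ncard_neighborSet ((h.adj i j hi hj).2 ⟨h1, h3, h4⟩)
        ((h.adj i k hi hk).2 ⟨h2, h5, h6⟩) (fun h' => hjk (h.inj _ _ hj hk h'))
    by_cases h1 : i + 2 < r
    · exact key (i + 1) (i + 2) (by omega) (by omega) (by omega) (by omega) (by omega) (by omega)
        (by omega) (by omega) (by omega)
    by_cases h2 : i + 1 < r
    · exact key (i - 1) (i + 1) (by omega) (by omega) (by omega) (by omega) (by omega) (by omega)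
        (by omega) (by omega) (by omega)
    · exact key (i - 1) (i - 2) (by omega) (by omega) (by omega) (by omega) (by omega) (by omega)
        (by omega) (by omega) (by omega)
  | book g k h5 h =>
    obtain ⟨x, y, hx, hy, hxy, hxg, hxk, hyg, hyk⟩ := h.exists_pages (by omega)
    by_cases hg : u = g
    · subst hg
      exact SteinerExtremal.two_le_ncard_neighborSet
        ((h.adj u x hu hx).2 ⟨hxg.symm, by simp⟩) ((h.adj u y hu hy).2 ⟨hyg.symm, by simp⟩) hxy
    by_cases hk : u = k
    · subst hk
      exact SteinerExtremal.two_le_ncard_neighborSet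
        ((h.adj u x hu hx).2 ⟨hxk.symm, by simp⟩) ((h.adj u y hu hy).2 ⟨hyk.symm, by simp⟩) hxy
    exact SteinerExtremal.two_le_ncard_neighborSet
      ((h.adj u g hu h.hg).2 ⟨hg, by simp⟩) ((h.adj u k hu h.hk).2 ⟨hk, by simp⟩) h.ne
  | one p s t m hm h =>
    rcases (h.mem u).1 hu with ⟨i, hi, rfl⟩ | rfl | rfl
    · by_cases h1 : i ≤ 1
      · exact SteinerExtremal.two_le_ncard_neighborSet ((h.sp i hi).2 h1).symm
          ((h.tp i hi).2 h1).symm h.st.ne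
      · refine SteinerExtremal.two_le_ncard_neighborSet
          ((h.adj i (i - 1) hi (by omega)).2 (by omega))
          ((h.adj i (i - 2) hi (by omega)).2 (by omega)) (fun h' => ?_)
        have := h.inj _ _ (by omega) (by omega) h'
        omega
    · exact SteinerExtremal.two_le_ncard_neighborSet h.st ((h.sp 0 (by omega)).2 (by omega))
        (h.ne_t 0 (by omega)).symm
    · exact SteinerExtremal.two_le_ncard_neighborSet h.st.symm ((h.tp 0 (by omega)).2 (by omega))
        (h.ne_s 0 (by omega)).symm
  | two p s t s' t' m hm h =>
    rcases (h.mem u).1 hu with ⟨i, hi, rfl⟩ | rfl | rfl | rfl | rfl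
    · by_cases h1 : i ≤ 1
      · exact SteinerExtremal.two_le_ncard_neighborSet ((h.sp i hi).2 h1).symm
          ((h.tp i hi).2 h1).symm h.st.ne
      by_cases h2 : m ≤ i + 2
      · exact SteinerExtremal.two_le_ncard_neighborSet ((h.sp' i hi).2 h2).symm
          ((h.tp' i hi).2 h2).symm h.st'.ne
      · refine SteinerExtremal.two_le_ncard_neighborSet
          ((h.adj i (i - 1) hi (by omega)).2 (by omega))
          ((h.adj i (i - 2) hi (by omega)).2 (by omega)) (fun h' => ?_)
        have := h.inj _ _ (by omega) (by omega) h'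
        omega
    · exact SteinerExtremal.two_le_ncard_neighborSet h.st ((h.sp 0 (by omega)).2 (by omega))
        (h.ne_t 0 (by omega)).symm
    · exact SteinerExtremal.two_le_ncard_neighborSet h.st.symm ((h.tp 0 (by omega)).2 (by omega))
        (h.ne_s 0 (by omega)).symm
    · exact SteinerExtremal.two_le_ncard_neighborSet h.st' ((h.sp' (m - 1) (by omega)).2 (by omega))
        (h.ne_t' _ (by omega)).symm
    · exact SteinerExtremal.two_le_ncard_neighborSet h.st'.symm
        ((h.tp' (m - 1) (by omega)).2 (by omega)) (h.ne_s' _ (by omega)).symm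
  | prism f h =>
    obtain ⟨i, e, rfl⟩ := (h.mem u).1 hu
    obtain ⟨j, l, hji, hli, hlj, -⟩ := fin3_others i
    exact SteinerExtremal.two_le_ncard_neighborSet ((h.adj i j e e).2 (by simp [hji.symm]))
      ((h.adj i l e e).2 (by simp [hli.symm])) (fun h' => hlj (h.inj _ _ _ _ h').1.symm)

/-- The vertices of the prism have degree `3`, so nothing is attached to it. -/
lemma PrismOn.two_lt_ncard_neighborSet [Finite V] {B : SimpleGraph V} {X : Finset V}
    {f : Fin 3 → Fin 2 → V} (h : PrismOn B X f) {u : V} (hu : u ∈ X) :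
    2 < (B.neighborSet u).ncard := by
  obtain ⟨i, e, rfl⟩ := (h.mem u).1 hu
  obtain ⟨j, l, hji, hli, hlj, -⟩ := fin3_others i
  obtain ⟨d, hde, -⟩ := fin2_other e
  by_contra hlt
  have hsub : ({f j e, f l e, f i d} : Set V) ⊆ B.neighborSet (f i e) := by
    rintro z (rfl | rfl | rfl)
    · exact (h.adj i j e e).2 (by simp [hji.symm])
    · exact (h.adj i l e e).2 (by simp [hli.symm])
    · exact (h.adj i i e d).2 (by simp [hde.symm])
  have h3 : ({f j e, f l e, f i d} : Set V).ncard = 3 :=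
    Set.ncard_eq_three.2 ⟨_, _, _, by simp [h.eq_iff, hlj.symm], by simp [h.eq_iff, hji],
      by simp [h.eq_iff, hli], rfl⟩
  have := Set.ncard_le_ncard hsub
  omega

lemma nonempty_iso_top [Fintype V] {G : SimpleGraph V} {n : ℕ} (hn : Fintype.card V = n)
    (he : 2 * G.edgeSet.ncard = n * (n - 1)) : Nonempty (G ≃g (⊤ : SimpleGraph (Fin n))) := by
  have htop := ncard_edgeSet_complete (G := (⊤ : SimpleGraph V)) (X := Finset.univ)
    (fun x _ _ => Finset.mem_univ x) (fun x _ y _ h => h)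
  rw [Finset.card_univ, hn] at htop
  have hG : G = ⊤ := by
    apply SimpleGraph.edgeSet_injective
    exact Set.eq_of_subset_of_ncard_le (SimpleGraph.edgeSet_mono le_top) (by omega)
  subst hn
  rw [hG]
  exact ⟨SimpleGraph.Iso.completeGraph (Fintype.equivFin V)⟩

lemma AttachOn.strip_inAttachClass [Fintype V] {G B : SimpleGraph V} {X₀ U : Finset V}
    {q : V → Fin 3 → V} (h : AttachOn Finset.univ G X₀ B U q) {p : ℕ → V} {r : ℕ} (hr : 3 ≤ r)
    (hB : StripOn B X₀ p r) : ∃ i, InAttachClass i (Fintype.card V) G := by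
  have hdeg : ∀ u ∈ U, 2 ≤ (B.neighborSet u).ncard := fun u hu =>
    h.base.two_le_ncard_neighborSet (hr.trans hB.card.ge) (h.sub hu)
  have hf : Function.Injective fun j : Fin r => p j := fun a b hab =>
    Fin.ext (hB.inj a b a.2 b.2 hab)
  have hX : ∀ x, x ∈ X₀ ↔ ∃ w : Fin r, p w = x := fun x => by
    rw [hB.mem]
    exact ⟨fun ⟨i, hi, h⟩ => ⟨⟨i, hi⟩, h⟩, fun ⟨w, hw⟩ => ⟨w, w.2, hw⟩⟩
  have hK : ∀ a b : Fin r, (strip r).Adj a b ↔ B.Adj (p a) (p b) := fun a b => by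
    rw [hB.adj a b a.2 b.2, ne_eq, Fin.val_inj]
    rfl
  rcases Nat.even_or_odd r with he | ho
  · exact ⟨1, h.inAttachClass hf hX hK (Fintype.card_fin r) hr hdeg fun H hH => ⟨hr, he, hH⟩⟩
  · exact ⟨2, h.inAttachClass hf hX hK (Fintype.card_fin r) hr hdeg fun H hH => ⟨hr, ho, hH⟩⟩

lemma AttachOn.book_inAttachClass [Fintype V] {G B : SimpleGraph V} {X₀ U : Finset V}
    {q : V → Fin 3 → V} (h : AttachOn Finset.univ G X₀ B U q) {g k : V} (hc : 5 ≤ X₀.card)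
    (hB : BookOn B X₀ g k) : ∃ i, InAttachClass i (Fintype.card V) G := by
  classical
  have hdeg : ∀ u ∈ U, 2 ≤ (B.neighborSet u).ncard := fun u hu =>
    h.base.two_le_ncard_neighborSet (by omega) (h.sub hu)
  obtain ⟨m, hm⟩ : ∃ m, X₀.card = m + 2 := ⟨X₀.card - 2, by omega⟩
  have hpages : ((X₀.erase g).erase k).card = m := by
    rw [Finset.card_erase_of_mem (by simp [hB.ne.symm, hB.hk]), Finset.card_erase_of_mem hB.hg]
    omega
  let e := ((X₀.erase g).erase k).equivFin.symm
  let f : Fin (m + 2) → V := fun j =>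
    if h0 : (j : ℕ) = 0 then g else if h1 : (j : ℕ) = 1 then k else
      e ⟨j - 2, by rw [hpages]; have := j.2; omega⟩
  have he : ∀ j, (e j : V) ≠ g ∧ (e j : V) ≠ k ∧ (e j : V) ∈ X₀ := fun j => by
    have := (e j).2
    simp only [Finset.mem_erase] at this
    exact ⟨this.2.1, this.1, this.2.2⟩
  have hf : Function.Injective f := by
    intro a b hab
    apply Fin.ext
    simp only [f] at hab
    split_ifs at hab with h1 h2 h3 h4 h5 h6 h7 h8
    · omega
    · exact absurd hab hB.ne
    · exact absurd hab.symm (he _).1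
    · exact absurd hab.symm hB.ne
    · omega
    · exact absurd hab.symm (he _).2.1
    · exact absurd hab (he _).1
    · exact absurd hab (he _).2.1
    · have := congrArg Fin.val (e.injective (Subtype.ext hab))
      simp only at this
      omega
  have hX : ∀ x, x ∈ X₀ ↔ ∃ w, f w = x := by
    intro x
    constructor
    · intro hx
      by_cases hxg : x = g
      · exact ⟨⟨0, by omega⟩, by simp [f, hxg]⟩
      by_cases hxk : x = k
      · exact ⟨⟨1, by omega⟩, by simp [f, hxk]⟩
      have hx' : x ∈ (X₀.erase g).erase k := by simp [hxg, hxk, hx]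
      refine ⟨⟨e.symm ⟨x, hx'⟩ + 2, by have := (e.symm ⟨x, hx'⟩).2; omega⟩, ?_⟩
      simp [f]
    · rintro ⟨w, rfl⟩
      simp only [f]
      split_ifs
      · exact hB.hg
      · exact hB.hk
      · exact (he _).2.2
  have hgk : ∀ a, (f a = g ∨ f a = k) ↔ (a : ℕ) < 2 := by
    intro a
    simp only [f]
    split_ifs with h0 h1
    · simp [h0]
    · simp [h1]
    · have := he ⟨a - 2, by rw [hpages]; have := a.2; omega⟩
      exact iff_of_false (not_or.2 ⟨this.1, this.2.1⟩) (by omega)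
  refine ⟨0, h.inAttachClass hf hX (K := book (m + 2)) ?_ (Fintype.card_fin _) (by omega) hdeg
    fun H hH => ⟨by omega, hH⟩⟩
  intro a b
  rw [hB.adj _ _ ((hX _).2 ⟨a, rfl⟩) ((hX _).2 ⟨b, rfl⟩), hgk, hgk, ne_eq (f a), hf.eq_iff]
  rfl

lemma AttachOn.one_inAttachClass [Fintype V] {G B : SimpleGraph V} {X₀ U : Finset V}
    {q : V → Fin 3 → V} (h : AttachOn Finset.univ G X₀ B U q) {p : ℕ → V} {s t : V} {k : ℕ}
    (hB : OneOn B X₀ p s t (k + 3)) : ∃ i, InAttachClass i (Fintype.card V) G := by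
  let f : Fin (k + 3) ⊕ Fin 2 → V := Sum.elim (fun j => p j) ![s, t]
  have hst := hB.st.ne
  have hf : Function.Injective f := by
    refine Function.Injective.sumElim (fun a b hab => Fin.ext (hB.inj a b a.2 b.2 hab)) ?_ ?_
    · intro a b
      fin_cases a <;> fin_cases b <;> simp [hst, hst.symm]
    · intro a b
      fin_cases b
      · exact hB.ne_s a a.2
      · exact hB.ne_t a a.2
  have hX : ∀ x, x ∈ X₀ ↔ ∃ w, f w = x := by
    intro x
    rw [hB.mem]
    constructor
    · rintro (⟨i, hi, rfl⟩ | rfl | rfl)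
      · exact ⟨.inl ⟨i, hi⟩, rfl⟩
      · exact ⟨.inr 0, rfl⟩
      · exact ⟨.inr 1, rfl⟩
    · rintro ⟨a | b, rfl⟩
      · exact Or.inl ⟨a, a.2, rfl⟩
      · fin_cases b
        · exact Or.inr (Or.inl rfl)
        · exact Or.inr (Or.inr rfl)
  have hcard : X₀.card = k + 5 := by
    classical
    have : X₀ = Finset.univ.image f := by
      ext x
      rw [hX]
      simp
    rw [this, Finset.card_image_of_injective _ hf]
    simp
  have hdeg : ∀ u ∈ U, 2 ≤ (B.neighborSet u).ncard := fun u hu =>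
    h.base.two_le_ncard_neighborSet (by omega) (h.sub hu)
  have htip : ∀ (b : Fin 2) (a : Fin (k + 3)), B.Adj (![s, t] b) (p a) ↔
      a = ⟨0, by omega⟩ ∨ a = ⟨1, by omega⟩ := by
    intro b a
    rw [Fin.ext_iff, Fin.ext_iff]
    fin_cases b
    · exact (hB.sp a a.2).trans (by simp only; omega)
    · exact (hB.tp a a.2).trans (by simp only; omega)
  have hK : ∀ a b, (oneDiamondStrip k).Adj a b ↔ B.Adj (f a) (f b) := by
    rintro (a | a) (b | b)
    · change ((strip (k + 3)).Adj a b ∧ s(a, b) ≠ s(⟨0, by omega⟩, ⟨1, by omega⟩)) ↔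
        B.Adj (p a) (p b)
      rw [hB.adj a b a.2 b.2, ne_eq, Sym2.eq_iff]
      simp only [Fin.ext_iff, strip]
      omega
    · change (a = ⟨0, by omega⟩ ∨ a = ⟨1, by omega⟩) ↔ B.Adj (p a) (![s, t] b)
      rw [B.adj_comm, htip]
    · exact (htip a b).symm
    · change a ≠ b ↔ B.Adj (![s, t] a) (![s, t] b)
      fin_cases a <;> fin_cases b <;> simp [hB.st, hB.st.symm]
  have hW : Fintype.card (Fin (k + 3) ⊕ Fin 2) = k + 5 := by simp
  rcases Nat.even_or_odd (k + 5) with he | ho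
  · exact ⟨4, h.inAttachClass hf hX hK hW (by omega) hdeg fun H hH => ⟨he, k, rfl, hH⟩⟩
  · exact ⟨3, h.inAttachClass hf hX hK hW (by omega) hdeg fun H hH => ⟨ho, k, rfl, hH⟩⟩

lemma AttachOn.two_inAttachClass [Fintype V] {G B : SimpleGraph V} {X₀ U : Finset V}
    {q : V → Fin 3 → V} (h : AttachOn Finset.univ G X₀ B U q) {p : ℕ → V} {s t s' t' : V} {k : ℕ}
    (hB : TwoOn B X₀ p s t s' t' (k + 3)) : ∃ i, InAttachClass i (Fintype.card V) G := by
  let f : (Fin (k + 3) ⊕ Fin 2) ⊕ Fin 2 → V :=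
    Sum.elim (Sum.elim (fun j => p j) ![s, t]) ![s', t']
  have hn := hB.nodup
  simp only [List.nodup_cons, List.mem_cons, List.not_mem_nil, or_false, not_or,
          List.nodup_nil, and_true, not_false_eq_true] at hn
  obtain ⟨⟨n1, n2, n3⟩, ⟨n4, n5⟩, n6⟩ := hn
  have hf : Function.Injective f := by
    refine Function.Injective.sumElim (Function.Injective.sumElim
      (fun a b hab => Fin.ext (hB.inj a b a.2 b.2 hab)) ?_ ?_) ?_ ?_
    · intro a b
      fin_cases a <;> fin_cases b <;> simp [n1, Ne.symm n1]
    · intro a b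
      fin_cases b
      · exact hB.ne_s a a.2
      · exact hB.ne_t a a.2
    · intro a b
      fin_cases a <;> fin_cases b <;> simp [n6, Ne.symm n6]
    · rintro (a | a) b
      · fin_cases b
        · exact hB.ne_s' a a.2
        · exact hB.ne_t' a a.2
      · fin_cases a <;> fin_cases b
        · exact n2
        · exact n3
        · exact n4
        · exact n5
  have hX : ∀ x, x ∈ X₀ ↔ ∃ w, f w = x := by
    intro x
    rw [hB.mem]
    constructor
    · rintro (⟨i, hi, rfl⟩ | rfl | rfl | rfl | rfl)
      · exact ⟨.inl (.inl ⟨i, hi⟩), rfl⟩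
      · exact ⟨.inl (.inr 0), rfl⟩
      · exact ⟨.inl (.inr 1), rfl⟩
      · exact ⟨.inr 0, rfl⟩
      · exact ⟨.inr 1, rfl⟩
    · rintro ⟨(a | b) | b, rfl⟩
      · exact Or.inl ⟨a, a.2, rfl⟩
      · fin_cases b
        · exact Or.inr (Or.inl rfl)
        · exact Or.inr (Or.inr (Or.inl rfl))
      · fin_cases b
        · exact Or.inr (Or.inr (Or.inr (Or.inl rfl)))
        · exact Or.inr (Or.inr (Or.inr (Or.inr rfl)))
  have hcard : X₀.card = k + 7 := by
    classical
    have : X₀ = Finset.univ.image f := by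
      ext x
      rw [hX]
      simp
    rw [this, Finset.card_image_of_injective _ hf]
    simp
  have hdeg : ∀ u ∈ U, 2 ≤ (B.neighborSet u).ncard := fun u hu =>
    h.base.two_le_ncard_neighborSet (by omega) (h.sub hu)
  have htip : ∀ (b : Fin 2) (a : Fin (k + 3)), B.Adj (![s, t] b) (p a) ↔
      a = ⟨0, by omega⟩ ∨ a = ⟨1, by omega⟩ := by
    intro b a
    rw [Fin.ext_iff, Fin.ext_iff]
    fin_cases b
    · exact (hB.sp a a.2).trans (by simp only; omega)
    · exact (hB.tp a a.2).trans (by simp only; omega)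
  have htip' : ∀ (b : Fin 2) (a : Fin (k + 3)), B.Adj (![s', t'] b) (p a) ↔
      a = ⟨k + 1, by omega⟩ ∨ a = ⟨k + 2, by omega⟩ := by
    intro b a
    have := a.2
    rw [Fin.ext_iff, Fin.ext_iff]
    fin_cases b
    · exact (hB.sp' a a.2).trans (by simp only; omega)
    · exact (hB.tp' a a.2).trans (by simp only; omega)
  have hfar : ∀ a b : Fin 2, ¬ B.Adj (![s, t] a) (![s', t'] b) := by
    intro a b
    fin_cases a <;> fin_cases b
    · exact hB.ss'
    · exact hB.st''
    · exact hB.ts'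
    · exact hB.tt'
  have hK₁ : ∀ a b, (twoDiamondStrip k).Adj (.inl a) (.inl b) ↔ B.Adj (f (.inl a)) (f (.inl b)) := by
    rintro (a | a) (b | b)
    · change (((strip (k + 3)).Adj a b ∧ s(a, b) ≠ s(⟨0, by omega⟩, ⟨1, by omega⟩)) ∧
        s(Sum.inl a, Sum.inl b) ≠ s((.inl ⟨k + 1, by omega⟩ : Fin (k + 3) ⊕ Fin 2),
          .inl ⟨k + 2, by omega⟩)) ↔ B.Adj (p a) (p b)
      have := a.2
      have := b.2
      rw [hB.adj a b a.2 b.2, ne_eq, ne_eq, Sym2.eq_iff, Sym2.eq_iff]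
      simp only [Fin.ext_iff, strip, Sum.inl.injEq]
      omega
    · change ((a = ⟨0, by omega⟩ ∨ a = ⟨1, by omega⟩) ∧ _) ↔ B.Adj (p a) (![s, t] b)
      rw [B.adj_comm, htip, and_iff_left]
      simp
    · change ((b = ⟨0, by omega⟩ ∨ b = ⟨1, by omega⟩) ∧ _) ↔ B.Adj (![s, t] a) (p b)
      rw [htip, and_iff_left]
      simp
    · change (a ≠ b ∧ _) ↔ B.Adj (![s, t] a) (![s, t] b)
      rw [and_iff_left (by simp)]
      fin_cases a <;> fin_cases b <;> simp [hB.st, hB.st.symm]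
  have hK₂ : ∀ a b, (twoDiamondStrip k).Adj (.inl a) (.inr b) ↔ B.Adj (f (.inl a)) (f (.inr b)) := by
    rintro (a | a) b
    · change ((.inl a : Fin (k + 3) ⊕ Fin 2) = .inl ⟨k + 1, by omega⟩ ∨
        (.inl a : Fin (k + 3) ⊕ Fin 2) = .inl ⟨k + 2, by omega⟩) ↔ B.Adj (p a) (![s', t'] b)
      rw [B.adj_comm, htip', Sum.inl.injEq, Sum.inl.injEq]
    · refine iff_of_false ?_ (hfar a b)
      rintro (h' | h') <;> cases h'
  have hK : ∀ a b, (twoDiamondStrip k).Adj a b ↔ B.Adj (f a) (f b) := by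
    rintro (a | a) (b | b)
    · exact hK₁ a b
    · exact hK₂ a b
    · rw [SimpleGraph.adj_comm, B.adj_comm]
      exact hK₂ b a
    · change a ≠ b ↔ B.Adj (![s', t'] a) (![s', t'] b)
      fin_cases a <;> fin_cases b <;> simp [hB.st', hB.st'.symm]
  have hW : Fintype.card ((Fin (k + 3) ⊕ Fin 2) ⊕ Fin 2) = k + 7 := by simp
  rcases Nat.even_or_odd (k + 7) with he | ho
  · exact ⟨5, h.inAttachClass hf hX hK hW (by omega) hdeg fun H hH => ⟨he, k, rfl, hH⟩⟩
  · exact ⟨6, h.inAttachClass hf hX hK hW (by omega) hdeg fun H hH => ⟨ho, k, rfl, hH⟩⟩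

/-- Attaching copies of `K₄` to the ends of `K₂`. -/
lemma AttachOn.inGStar_of_edge [Fintype V] {G B : SimpleGraph V} {X₀ U : Finset V}
    {q : V → Fin 3 → V} (h : AttachOn Finset.univ G X₀ B U q) {p : ℕ → V}
    (hB : StripOn B X₀ p 2) (hn : 5 ≤ Fintype.card V) : InGStar (Fintype.card V) G := by
  have key : ∀ p : ℕ → V, StripOn B X₀ p 2 →
      Nonempty (G ≃g attachK4 (⊤ : SimpleGraph (Fin 2)) {w | p w ∈ U}) := by
    intro p hB
    refine h.nonempty_iso (f := fun w : Fin 2 => p w)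
      (fun a b hab => Fin.ext (hB.inj a b a.2 b.2 hab)) (fun x => ?_) (fun a b => ?_)
    · rw [hB.mem]
      exact ⟨fun ⟨i, hi, h⟩ => ⟨⟨i, hi⟩, h⟩, fun ⟨w, hw⟩ => ⟨w, w.2, hw⟩⟩
    · rw [hB.adj a b a.2 b.2, SimpleGraph.top_adj, ne_eq, ne_eq, Fin.ext_iff]
      omega
  have one : ∀ p : ℕ → V, StripOn B X₀ p 2 → p 0 ∈ U → p 1 ∉ U →
      InGStar (Fintype.card V) G := by
    intro p hB h0 h1
    have hU : {w : Fin 2 | p w ∈ U} = {0} := by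
      ext w
      fin_cases w <;> simp [h0, h1]
    have hiso := key p hB
    rw [hU] at hiso
    obtain ⟨e⟩ := hiso
    have hcard : Fintype.card V = 5 := by
      rw [← Nat.card_eq_fintype_card, Nat.card_congr e.toEquiv]
      simp
    exact Or.inr (Or.inr (Or.inr (Or.inl ⟨hcard, ⟨e⟩⟩)))
  by_cases h0 : p 0 ∈ U <;> by_cases h1 : p 1 ∈ U
  · have hU : {w : Fin 2 | p w ∈ U} = Set.univ := by
      ext w
      fin_cases w <;> simp [h0, h1]
    have hiso := key p hB
    rw [hU] at hiso
    obtain ⟨e⟩ := hiso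
    have hcard : Fintype.card V = 8 := by
      rw [← Nat.card_eq_fintype_card, Nat.card_congr e.toEquiv]
      simp
    exact Or.inr (Or.inr (Or.inr (Or.inr (Or.inr ⟨hcard, ⟨e⟩⟩))))
  · exact one p hB h0 h1
  · exact one _ hB.rev h1 h0
  · exfalso
    have hU : {w : Fin 2 | p w ∈ U} = ∅ := by
      ext w
      fin_cases w <;> simp [h0, h1]
    have hiso := key p hB
    rw [hU] at hiso
    obtain ⟨e⟩ := hiso
    have hcard : Fintype.card V = 2 := by
      rw [← Nat.card_eq_fintype_card, Nat.card_congr e.toEquiv]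
      simp
    omega

lemma AttachOn.inGStar_of_prism [Fintype V] {G B : SimpleGraph V} {X₀ U : Finset V}
    {q : V → Fin 3 → V} (h : AttachOn Finset.univ G X₀ B U q) {f : Fin 3 → Fin 2 → V}
    (hB : PrismOn B X₀ f) : InGStar (Fintype.card V) G := by
  have hU : ∀ u, u ∉ U := fun u hu =>
    absurd (h.deg u hu) (not_le.2 (hB.two_lt_ncard_neighborSet (h.sub hu)))
  have hX : ∀ x, x ∈ X₀ := fun x => by
    have := (h.mem x).1 (Finset.mem_univ x)
    simpa [hU] using this
  have hG : ∀ x y, G.Adj x y ↔ B.Adj x y := fun x y => by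
    rw [h.adj]
    simp [hU]
  let F : Fin 3 × Fin 2 → V := fun x => f x.1 x.2
  have hF : Function.Bijective F := by
    refine ⟨fun a b hab => ?_, fun x => ?_⟩
    · obtain ⟨h1, h2⟩ := hB.inj _ _ _ _ hab
      exact Prod.ext h1 h2
    · obtain ⟨i, e, hx⟩ := (hB.mem x).1 (hX x)
      exact ⟨(i, e), hx⟩
  have hcard : Fintype.card V = 6 := by
    rw [← Fintype.card_of_bijective hF]
    rfl
  refine Or.inr (Or.inr (Or.inr (Or.inr (Or.inl ⟨hcard, Or.inr
    ⟨SimpleGraph.Iso.symm ⟨Equiv.ofBijective F hF, ?_⟩⟩⟩))))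
  rintro ⟨i, e⟩ ⟨j, d⟩
  change G.Adj (f i e) (f j d) ↔ _
  rw [hG, hB.adj, sporadic4, SimpleGraph.boxProd_adj]
  simp only [SimpleGraph.top_adj]
  tauto

/-- The strip on two vertices gives the sporadic graphs that contain `K₄`, the prism gives
itself, and the other base graphs give the seven families. -/
lemma Class.inGStar [Fintype V] {G : SimpleGraph V} (h : Class Finset.univ G)
    (hn : 5 ≤ Fintype.card V) : InGStar (Fintype.card V) G := by
  obtain ⟨X₀, B, U, q, h⟩ := h
  have hcl : (∃ i, InAttachClass i (Fintype.card V) G) → InGStar (Fintype.card V) G := fun hi =>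
    Or.inr (Or.inr (Or.inl ⟨hn, hi⟩))
  cases h.base with
  | strip p r hr hB =>
    by_cases hr2 : r = 2
    · subst hr2
      exact h.inGStar_of_edge hB hn
    · exact hcl (h.strip_inAttachClass (by omega) hB)
  | book g k hc hB => exact hcl (h.book_inAttachClass hc hB)
  | one p s t m hm hB =>
    obtain ⟨k, rfl⟩ := Nat.exists_eq_add_of_le' hm
    exact hcl (h.one_inAttachClass hB)
  | two p s t s' t' m hm hB =>
    obtain ⟨k, rfl⟩ := Nat.exists_eq_add_of_le' hm
    exact hcl (h.two_inAttachClass hB)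
  | prism f hB => exact h.inGStar_of_prism hB

/-! ### The number of edges of the named graphs -/

lemma ncard_edgeSet_congr {G : SimpleGraph V} {W : Type*} {H : SimpleGraph W} (e : G ≃g H) :
    G.edgeSet.ncard = H.edgeSet.ncard :=
  Nat.card_congr e.mapEdgeSet

lemma two_mul_ncard_edgeSet_top (n : ℕ) :
    2 * (⊤ : SimpleGraph (Fin n)).edgeSet.ncard = n * (n - 1) := by
  have := ncard_edgeSet_complete (G := (⊤ : SimpleGraph (Fin n))) (X := Finset.univ)
    (fun x _ _ => Finset.mem_univ x) (fun x _ y _ h => h)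
  rw [← this]
  simp

lemma ncard_edgeSet_strip (k : ℕ) : (strip (k + 2)).edgeSet.ncard = 2 * k + 1 := by
  let f : Fin (k + 1) → Sym2 (Fin (k + 2)) := fun i => s(⟨i, by omega⟩, ⟨i + 1, by omega⟩)
  let g : Fin k → Sym2 (Fin (k + 2)) := fun i => s(⟨i, by omega⟩, ⟨i + 2, by omega⟩)
  have hf : Function.Injective f := by
    intro i j hij
    simp only [f, Sym2.eq_iff, Fin.mk.injEq] at hij
    apply Fin.ext
    omega
  have hg : Function.Injective g := by
    intro i j hij
    simp only [g, Sym2.eq_iff, Fin.mk.injEq] at hij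
    apply Fin.ext
    omega
  have h : (strip (k + 2)).edgeSet = Set.range f ∪ Set.range g := by
    ext e
    induction e with
    | h a b =>
      have ha := a.2
      have hb := b.2
      simp only [SimpleGraph.mem_edgeSet, Set.mem_union, Set.mem_range, f, g, Sym2.eq_iff,
        Fin.ext_iff, strip]
      constructor
      · rintro ⟨hne, h1, h2⟩
        have hne' : (a : ℕ) ≠ b := fun h => hne (Fin.ext h)
        by_cases h3 : (a : ℕ) + 1 = b
        · exact Or.inl ⟨⟨a, by omega⟩, Or.inl ⟨rfl, h3⟩⟩
        by_cases h4 : (b : ℕ) + 1 = a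
        · exact Or.inl ⟨⟨b, by omega⟩, Or.inr ⟨rfl, h4⟩⟩
        by_cases h5 : (a : ℕ) + 2 = b
        · exact Or.inr ⟨⟨a, by omega⟩, Or.inl ⟨rfl, h5⟩⟩
        · have h6 : (b : ℕ) + 2 = a := by omega
          exact Or.inr ⟨⟨b, by omega⟩, Or.inr ⟨rfl, h6⟩⟩
      · rintro (⟨i, hi⟩ | ⟨i, hi⟩)
        · refine ⟨fun h => ?_, by omega, by omega⟩
          rw [h] at hi
          omega
        · refine ⟨fun h => ?_, by omega, by omega⟩
          rw [h] at hi
          omega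
  rw [h, Set.ncard_union_eq, ← Set.image_univ, ← Set.image_univ, Set.ncard_image_of_injective _ hf,
    Set.ncard_image_of_injective _ hg, Set.ncard_univ, Set.ncard_univ, Nat.card_fin, Nat.card_fin]
  · omega
  · rw [Set.disjoint_left]
    rintro _ ⟨i, rfl⟩ ⟨j, hj⟩
    simp only [f, g, Sym2.eq_iff, Fin.mk.injEq] at hj
    omega

lemma ncard_edgeSet_book (k : ℕ) : (book (k + 2)).edgeSet.ncard = 2 * k + 1 := by
  let f : Fin (k + 1) → Sym2 (Fin (k + 2)) := fun i => s(⟨0, by omega⟩, ⟨i + 1, by omega⟩)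
  let g : Fin k → Sym2 (Fin (k + 2)) := fun i => s(⟨1, by omega⟩, ⟨i + 2, by omega⟩)
  have hf : Function.Injective f := by
    intro i j hij
    simp only [f, Sym2.eq_iff, Fin.mk.injEq] at hij
    apply Fin.ext
    omega
  have hg : Function.Injective g := by
    intro i j hij
    simp only [g, Sym2.eq_iff, Fin.mk.injEq] at hij
    apply Fin.ext
    omega
  have h : (book (k + 2)).edgeSet = Set.range f ∪ Set.range g := by
    ext e
    induction e with
    | h a b =>
      have ha := a.2
      have hb := b.2
      simp only [SimpleGraph.mem_edgeSet, Set.mem_union, Set.mem_range, f, g, Sym2.eq_iff,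
        Fin.ext_iff, book]
      constructor
      · rintro ⟨hne, h1⟩
        have hne' : (a : ℕ) ≠ b := fun h => hne (Fin.ext h)
        by_cases h3 : (a : ℕ) = 0
        · exact Or.inl ⟨⟨b - 1, by omega⟩, by simp only; omega⟩
        by_cases h4 : (b : ℕ) = 0
        · exact Or.inl ⟨⟨a - 1, by omega⟩, by simp only; omega⟩
        by_cases h5 : (a : ℕ) = 1
        · exact Or.inr ⟨⟨b - 2, by omega⟩, by simp only; omega⟩
        · exact Or.inr ⟨⟨a - 2, by omega⟩, by simp only; omega⟩
      · rintro (⟨i, hi⟩ | ⟨i, hi⟩)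
        · refine ⟨fun h => ?_, by omega⟩
          rw [h] at hi
          omega
        · refine ⟨fun h => ?_, by omega⟩
          rw [h] at hi
          omega
  rw [h, Set.ncard_union_eq, ← Set.image_univ, ← Set.image_univ, Set.ncard_image_of_injective _ hf,
    Set.ncard_image_of_injective _ hg, Set.ncard_univ, Set.ncard_univ, Nat.card_fin, Nat.card_fin]
  · omega
  · rw [Set.disjoint_left]
    rintro _ ⟨i, rfl⟩ ⟨j, hj⟩
    simp only [f, g, Sym2.eq_iff, Fin.mk.injEq] at hj
    omega

/-- One edge is lost and five are gained. -/
lemma ncard_edgeSet_replaceByDiamond [Finite V] {G : SimpleGraph V} {x y : V} (h : G.Adj x y) :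
    (replaceByDiamond G x y).edgeSet.ncard = G.edgeSet.ncard + 4 := by
  let S : Set (Sym2 (V ⊕ Fin 2)) := Sym2.map Sum.inl '' (G.edgeSet \ {s(x, y)})
  have hinj : Function.Injective (Sym2.map (Sum.inl : V → V ⊕ Fin 2)) :=
    Sym2.map.injective Sum.inl_injective
  have hl : ∀ a b : V, s(Sum.inl a, Sum.inl b) ∈ S ↔ G.Adj a b ∧ s(a, b) ≠ s(x, y) := by
    intro a b
    rw [← Sym2.map_mk, hinj.mem_set_image]
    rfl
  have hr : ∀ (a : Fin 2) (z : V ⊕ Fin 2), s(z, Sum.inr a) ∉ S := by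
    rintro a z ⟨e, -, he⟩
    induction e with
    | h u v => simp at he
  have hr' : ∀ (a : Fin 2) (z : V ⊕ Fin 2), s(Sum.inr a, z) ∉ S := fun a z => by
    rw [Sym2.eq_swap]
    exact hr a z
  have hset : (replaceByDiamond G x y).edgeSet =
      insert s(.inr 0, .inr 1) (insert s(.inl x, .inr 0) (insert s(.inl y, .inr 0)
        (insert s(.inl x, .inr 1) (insert s(.inl y, .inr 1) S)))) := by
    ext e
    induction e with
    | h u v =>
      simp only [SimpleGraph.mem_edgeSet, Set.mem_insert_iff]
      rcases u with a | a <;> rcases v with b | b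
      · rw [hl]
        simp [replaceByDiamond]
      · have h0 := hr 0 (.inl a)
        have h1 := hr 1 (.inl a)
        fin_cases b <;> simp [replaceByDiamond, h0, h1]
      · have h0 := hr' 0 (.inl b)
        have h1 := hr' 1 (.inl b)
        fin_cases a <;> simp [replaceByDiamond, h0, h1]
      · have h0 := hr 0 (.inr a)
        have h1 := hr 1 (.inr a)
        fin_cases a <;> fin_cases b <;> simp_all [replaceByDiamond]
  have hxy := h.ne
  have hS : S.ncard = G.edgeSet.ncard - 1 := by
    rw [Set.ncard_image_of_injective _ hinj, Set.ncard_sdiff_singleton_of_mem (by simpa using h)]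
  have hpos : 0 < G.edgeSet.ncard := (Set.ncard_pos).2 ⟨s(x, y), h⟩
  rw [hset, Set.ncard_insert_of_notMem, Set.ncard_insert_of_notMem, Set.ncard_insert_of_notMem,
    Set.ncard_insert_of_notMem, Set.ncard_insert_of_notMem, hS]
  · omega
  all_goals simp [hr, hxy]

/-- Each attached `K₄` brings six edges, by comparing the degree sums. -/
lemma ncard_edgeSet_attachK4 [Fintype V] (H : SimpleGraph V) (U : Set V) :
    (attachK4 H U).edgeSet.ncard = H.edgeSet.ncard + 6 * U.ncard := by
  classical
  have hold : ∀ a, ((attachK4 H U).neighborSet (.inl a)).ncard =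
      (H.neighborSet a).ncard + if a ∈ U then 3 else 0 := by
    intro a
    have h1 : (attachK4 H U).neighborSet (.inl a) =
        Sum.inl '' H.neighborSet a ∪ Sum.inr '' {p : U × Fin 3 | a = p.1} := by
      ext (b | p)
      · simp [attachK4]
      · simp [attachK4]
    rw [h1, Set.ncard_union_eq, Set.ncard_image_of_injective _ Sum.inl_injective,
      Set.ncard_image_of_injective _ Sum.inr_injective]
    · congr 1
      split_ifs with ha
      · have h2 : {p : U × Fin 3 | a = p.1} = (fun i => (⟨a, ha⟩, i)) '' (Set.univ : Set (Fin 3)) := by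
          ext ⟨u, i⟩
          simp [Subtype.ext_iff]
        rw [h2, Set.ncard_image_of_injective _ (Prod.mk_right_injective _), Set.ncard_univ,
          Nat.card_fin]
      · have h2 : {p : U × Fin 3 | a = p.1} = ∅ := by
          ext ⟨u, i⟩
          simp only [Set.mem_ofPred_eq, Set.mem_empty_iff_false, iff_false]
          exact fun h => ha (h ▸ u.2)
        rw [h2, Set.ncard_empty]
    · rw [Set.disjoint_left]
      rintro _ ⟨b, -, rfl⟩ ⟨p, -, hp⟩
      cases hp
  have hnew : ∀ p, ((attachK4 H U).neighborSet (.inr p)).ncard = 3 := by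
    rintro ⟨u, i⟩
    have h1 : (attachK4 H U).neighborSet (.inr (u, i)) =
        insert (.inl (u : V)) ((fun j => .inr (u, j)) '' ({i}ᶜ : Set (Fin 3))) := by
      ext (b | ⟨v, j⟩)
      · simp [attachK4]
      · simp only [attachK4, SimpleGraph.mem_neighborSet, Set.mem_insert_iff, reduceCtorEq,
          Set.mem_image, Set.mem_compl_iff, Set.mem_singleton_iff, Sum.inr.injEq, Prod.mk.injEq,
          false_or]
        constructor
        · rintro ⟨rfl, h⟩
          exact ⟨j, Ne.symm h, rfl, rfl⟩
        · rintro ⟨k, hk, rfl, rfl⟩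
          exact ⟨rfl, Ne.symm hk⟩
    rw [h1, Set.ncard_insert_of_notMem (by simp),
      Set.ncard_image_of_injective _ (fun j k h => by simpa using h), Set.ncard_compl,
      Set.ncard_singleton, Nat.card_fin]
  have hsum := sum_ncard_neighborSet (G := attachK4 H U) (X := Finset.univ)
    (fun x _ _ => Finset.mem_univ x)
  have hsumH := sum_ncard_neighborSet (G := H) (X := Finset.univ) (fun x _ _ => Finset.mem_univ x)
  have hU : (∑ a : V, if a ∈ U then 3 else 0) = 3 * U.ncard := by
    rw [Finset.sum_ite, Finset.sum_const, Finset.sum_const_zero, Set.ncard_eq_toFinset_card',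
      smul_eq_mul, mul_comm, add_zero]
    congr 2
    ext
    simp
  rw [Fintype.sum_sum_type] at hsum
  simp only [hold, hnew] at hsum
  rw [Finset.sum_add_distrib, hsumH, hU, Finset.sum_const, Finset.card_univ, Fintype.card_prod,
    Fintype.card_fin, ← Nat.card_eq_fintype_card, smul_eq_mul, Nat.card_coe_set_eq] at hsum
  omega

lemma ncard_edgeSet_of_isBaseGraph {i : Fin 7} {r : ℕ} {W : Type*} {H : SimpleGraph W}
    (h : IsBaseGraph i r H) : H.edgeSet.ncard + 3 = 2 * r := by
  have hbook : 3 ≤ r → Nonempty (H ≃g book r) → H.edgeSet.ncard + 3 = 2 * r := by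
    rintro hr ⟨e⟩
    obtain ⟨k, rfl⟩ : ∃ k, r = k + 2 := ⟨r - 2, by omega⟩
    rw [ncard_edgeSet_congr e, ncard_edgeSet_book]
    omega
  have hstrip : 3 ≤ r → Nonempty (H ≃g strip r) → H.edgeSet.ncard + 3 = 2 * r := by
    rintro hr ⟨e⟩
    obtain ⟨k, rfl⟩ : ∃ k, r = k + 2 := ⟨r - 2, by omega⟩
    rw [ncard_edgeSet_congr e, ncard_edgeSet_strip]
    omega
  have hone' : ∀ k, (oneDiamondStrip k).edgeSet.ncard = 2 * k + 7 := by
    intro k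
    rw [oneDiamondStrip, ncard_edgeSet_replaceByDiamond (by simp [strip]), ncard_edgeSet_strip]
    omega
  have hone : (∃ k, r = k + 5 ∧ Nonempty (H ≃g oneDiamondStrip k)) →
      H.edgeSet.ncard + 3 = 2 * r := by
    rintro ⟨k, rfl, ⟨e⟩⟩
    rw [ncard_edgeSet_congr e, hone']
    omega
  have htwo : (∃ k, r = k + 7 ∧ Nonempty (H ≃g twoDiamondStrip k)) →
      H.edgeSet.ncard + 3 = 2 * r := by
    rintro ⟨k, rfl, ⟨e⟩⟩
    rw [ncard_edgeSet_congr e, twoDiamondStrip, ncard_edgeSet_replaceByDiamond, hone']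
    · omega
    · simp [oneDiamondStrip, replaceByDiamond, strip]
  fin_cases i
  · exact hbook h.1 h.2
  · exact hstrip h.1 h.2.2
  · exact hstrip h.1 h.2.2
  · exact hone h.2
  · exact hone h.2
  · exact htwo h.2
  · exact htwo h.2

lemma ncard_edgeSet_of_degree_three [Fintype V] {G : SimpleGraph V}
    (h : ∀ v, (G.neighborSet v).ncard = 3) : 2 * G.edgeSet.ncard = 3 * Fintype.card V := by
  rw [← sum_ncard_neighborSet (G := G) (X := Finset.univ) (fun x _ _ => Finset.mem_univ x)]
  simp only [h]
  rw [Finset.sum_const, Finset.card_univ, smul_eq_mul, mul_comm]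

lemma ncard_edgeSet_sporadic3 : sporadic3.edgeSet.ncard = 9 := by
  have := ncard_edgeSet_of_degree_three (G := sporadic3) (fun v => ?_)
  · simp at this
    omega
  · have hr : ∀ v : Fin 3, sporadic3.neighborSet (.inl v) = Set.range Sum.inr := by
      intro v
      ext (w | w) <;> simp [sporadic3]
    have hl : ∀ v : Fin 3, sporadic3.neighborSet (.inr v) = Set.range Sum.inl := by
      intro v
      ext (w | w) <;> simp [sporadic3]
    rcases v with v | v
    · rw [hr, ← Set.image_univ, Set.ncard_image_of_injective _ Sum.inr_injective]
      simp
    · rw [hl, ← Set.image_univ, Set.ncard_image_of_injective _ Sum.inl_injective]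
      simp

lemma ncard_edgeSet_sporadic4 : sporadic4.edgeSet.ncard = 9 := by
  have := ncard_edgeSet_of_degree_three (G := sporadic4) (fun v => ?_)
  · simp at this
    omega
  · have h : ∀ v : Fin 3 × Fin 2, sporadic4.neighborSet v =
        {(v.1 + 1, v.2), (v.1 + 2, v.2), (v.1, v.2 + 1)} := by
      intro v
      ext w
      simp only [sporadic4, SimpleGraph.mem_neighborSet, SimpleGraph.boxProd_adj,
        SimpleGraph.top_adj, Set.mem_insert_iff, Set.mem_singleton_iff]
      revert v w
      decide
    rw [h, Set.ncard_eq_three]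
    refine ⟨_, _, _, ?_, ?_, ?_, rfl⟩ <;> (revert v; decide)

/-- Every graph of `𝒢ₙ*` has the extremal number of edges: an attached `K₄` brings three vertices
and six edges, so `e = 2n - 3` passes from the base graphs to all graphs of the seven families. -/
lemma InGStar.ncard_edgeSet [Fintype V] {n : ℕ} {G : SimpleGraph V} (h : InGStar n G) :
    G.edgeSet.ncard = if n = 4 then 2 * n - 2 else 2 * n - 3 := by
  rcases h with ⟨rfl, ⟨e⟩⟩ | ⟨rfl, ⟨e⟩⟩ | ⟨h5, i, hc, r, hr, -, H, hH, U, -, ⟨e⟩⟩ | ⟨rfl, ⟨e⟩⟩ |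
    ⟨rfl, he | he⟩ | ⟨rfl, ⟨e⟩⟩
  · have := two_mul_ncard_edgeSet_top 3
    rw [ncard_edgeSet_congr e, if_neg (by omega)]
    omega
  · have := two_mul_ncard_edgeSet_top 4
    rw [ncard_edgeSet_congr e, if_pos rfl]
    omega
  · have h1 := ncard_edgeSet_of_isBaseGraph hH
    have h2 := Nat.card_congr e.toEquiv
    rw [hc, Nat.card_sum, Nat.card_prod, Nat.card_fin, Nat.card_fin, Nat.card_coe_set_eq] at h2
    rw [ncard_edgeSet_congr e, ncard_edgeSet_attachK4, if_neg (by omega)]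
    omega
  · have := two_mul_ncard_edgeSet_top 2
    rw [ncard_edgeSet_congr e, sporadic1, ncard_edgeSet_attachK4, Set.ncard_singleton,
      if_neg (by omega)]
    omega
  · obtain ⟨e⟩ := he
    rw [ncard_edgeSet_congr e, ncard_edgeSet_sporadic3, if_neg (by omega)]
  · obtain ⟨e⟩ := he
    rw [ncard_edgeSet_congr e, ncard_edgeSet_sporadic4, if_neg (by omega)]
  · have := two_mul_ncard_edgeSet_top 2
    rw [ncard_edgeSet_congr e, sporadic2, ncard_edgeSet_attachK4, Set.ncard_univ, Nat.card_fin,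
      if_neg (by omega)]
    omega

end SteinerExtremal

theorem mainTheorem1 {V : Type*} [Fintype V] (G : SimpleGraph V) (n : ℕ)
    (hn : Fintype.card V = n) (hn3 : 3 ≤ n) (hG : G.Connected)
    (hκ : SteinerExtremal.maxGenLocalConnectivity 3 G ≤ 2) :
    G.edgeSet.ncard ≤ (if n = 4 then 2 * n - 2 else 2 * n - 3) ∧
      (G.edgeSet.ncard = (if n = 4 then 2 * n - 2 else 2 * n - 3) ↔
        SteinerExtremal.InGStar n G) := by
  have hbad : ¬ SteinerExtremal.Bad G := fun h => h.not_le_two hκ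
  have hX : SteinerExtremal.EdgesIn G Finset.univ := fun x _ _ => Finset.mem_univ x
  have hcard : (Finset.univ : Finset V).card = n := by rw [Finset.card_univ, hn]
  obtain ⟨h1, h2⟩ := SteinerExtremal.countBound n (by omega) Finset.univ G hcard hX hbad
  refine ⟨?_, fun he => ?_, fun h => h.ncard_edgeSet⟩
  · split_ifs with h4
    · omega
    · rcases Nat.lt_or_ge (G.edgeSet.ncard + 2) (2 * n) with h | h
      · omega
      · rcases h2 (le_antisymm h1 h) with h | h <;> omega
  · by_cases h3 : n = 3
    · subst h3
      rw [if_neg (by omega)] at he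
      exact Or.inl ⟨rfl, SteinerExtremal.nonempty_iso_top hn (by omega)⟩
    by_cases h4 : n = 4
    · subst h4
      rw [if_pos rfl] at he
      exact Or.inr (Or.inl ⟨rfl, SteinerExtremal.nonempty_iso_top hn (by omega)⟩)
    rw [if_neg h4] at he
    have hcl := SteinerExtremal.classBound n Finset.univ G hcard hX hbad (by omega)
    have := hcl.inGStar (by omega)
    rwa [hn] at this
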